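/- **Conventions.** For a category $\mathcal D$ let $\Delta^{\circ}\mathcal D$ be the category of simplicial objects and $\Delta^\circ\Delta^\circ\mathcal D$ that of bisimplicial objects $Z=(Z_{n,m})$ in $\mathcal D$; $\mathrm D Z$ is the diagonal, $(\mathrm DZ)_n=Z_{n,n}$. For $X$ in $\Delta^\circ\mathcal D$ let $\Delta\times X$ and $X\times\Delta$ be the bisimplicial objects $(\Delta\times X)_{n,m}=X_m$ and $(X\times \Delta)_{n,m}=X_n$; for an object $A$ of $\mathcal D$, $A\times\Delta$ is the constant simplicial object. Let $\Upsilon:\Delta^\circ\mathcal D\to\Delta^\circ\mathcal D$ be induced by reversing the order of each $[n]$. Functors are applied levelwise to simplicial objects; for $\mathbf s:\Delta^\circ\mathcal D\to\mathcal D$ put $\mathbf s\mathbf sZ=\mathbf s(n\mapsto \mathbf s(m\mapsto Z_{n,m}))$. If $\mathrm E$ is a class of morphisms of $\mathcal D$, then $\mathrm{Fun}(\mathcal J,\mathcal D)[\mathrm E^{-1}]$ is the localization of the functor category at the natural transformations all of whose components lie in $\mathrm E$ ($\mathrm{Fun}_{ad}$: additive functors only). If $\mathcal D$ has finite coproducts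 and a final object $\ast$, the simplicial cone $C(f)$ of $f:X\to Y$ in $\Delta^\circ\mathcal D$ is the pushout of $d_0\sqcup d_1:X\sqcup X\to\Delta[1]\boxtimes X$ along $X\sqcup X\to Y\sqcup\ast$, where $(\Delta[1]\boxtimes X)_n=\coprod_{\Delta[1]_n}X_n$. A *simplicial descent category* is a tuple $(\mathcal D,\mathrm E,\mathbf s,\mu,\lambda)$ in which $\mathcal D$ is a category, $\mathrm E$ is a class of morphisms of $\mathcal D$, $\mathbf s:\Delta^\circ\mathcal D\to\mathcal D$ is a functor, $\mu:\mathbf s\mathrm D\to\mathbf s\mathbf s$ is a morphism of $\mathrm{Fun}(\Delta^\circ\Delta^\circ\mathcal D,\mathcal D)[\mathrm E^{-1}]$ and $\lambda:\mathbf s(-\times\Delta)\to \mathrm{Id}_{\mathcal D}$ is a natural transformation, such that 1. $\mathcal D$ has finite coproducts and a final object; 2. $\mathrm E$ is saturated ($f\in\mathrm E$ if and only if $f$ becomes invertible in $\mathcal D[\mathrm E^{-1}]$) and is closed under coproducts of two morphisms; 3. the canonical morphism $\mathbf sX\sqcup\mathbf sY\to\mathbf s(X\sqcup Y)$ is in $\mathrm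 E$ for all $X,Y$ in $\Delta^\circ\mathcal D$; 4. $\mu$ is an isomorphism; 5. each $\lambda_A$ is in $\mathrm E$, there is a natural transformation $\rho:\mathrm{Id}_{\mathcal D}\to\mathbf s(-\times\Delta)$ with $\lambda\rho=\mathrm{Id}$, and both compositions $\mathbf sX\xrightarrow{\mu_{\Delta\times X}}\mathbf s(\mathbf sX\times\Delta)\xrightarrow{\lambda_{\mathbf sX}}\mathbf sX$ and $\mathbf sX\xrightarrow{\mu_{X\times\Delta}}\mathbf s(n\mapsto\mathbf s(X_n\times\Delta))\xrightarrow{\mathbf s(\lambda_{X_n})}\mathbf sX$ are the identity of $\mathbf s$ in $\mathrm{Fun}(\Delta^\circ\mathcal D,\mathcal D)[\mathrm E^{-1}]$; 6. if $f:X\to Y$ in $\Delta^\circ\mathcal D$ has all $f_n\in\mathrm E$, then $\mathbf sf\in\mathrm E$; 7. for every $f:A\to B$ in $\mathcal D$ the simplicial cone $C(f\times\Delta)$ exists, and $f\in\mathrm E$ if and only if $\mathbf sC(f\times\Delta)\to\ast$ is in $\mathrm E$; 8. for every $f$ in $\Delta^\circ\mathcal D$, $\mathbf s\Upsilon f\in\mathrm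 E$ if and only if $\mathbf sf\in\mathrm E$. It is an *additive simplicial descent category* if moreover $\mathcal D$ and $\mathbf s$ are additive and $\mu$ is the image of an isomorphism of $\mathrm{Fun}_{ad}(\Delta^\circ\Delta^\circ\mathcal D,\mathcal D)[\mathrm E^{-1}]$. A functor $\psi:\mathcal D\to\mathcal D'$ between simplicial descent categories is a *descent functor* if $\psi(\mathrm E)\subseteq\mathrm E'$, the canonical morphisms $\psi A\sqcup\psi B\to\psi(A\sqcup B)$ are in $\mathrm E'$, and there is an isomorphism $\Theta:\psi\mathbf s\to\mathbf s'\psi$ of $\mathrm{Fun}(\Delta^\circ\mathcal D,\mathcal D')[\mathrm E'^{-1}]$ such that $\lambda'_{\psi A}\circ\Theta_{A\times\Delta}=\psi(\lambda_A)$ in $\mathrm{Fun}(\mathcal D,\mathcal D')[\mathrm E'^{-1}]$ and $\mu'_{\psi Z}\circ\Theta_{\mathrm DZ}=\mathbf s'(\Theta_Z)\circ\Theta_{\mathbf sZ}\circ\psi(\mu_Z)$ in $\mathrm{Fun}(\Delta^\circ\Delta^\circ\mathcal D,\mathcal D')[\mathrm E'^{-1}]$. **The structures.** Let $\mathcal A$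 be an additive category. On $\Delta^\circ\mathcal A$ take as simple functor the diagonal $\mathrm D:\Delta^\circ\Delta^\circ\mathcal A\to\Delta^\circ\mathcal A$ and let $\mu$ and $\lambda$ be the identity transformations. With the simplicial homotopy equivalences as equivalences this is denoted ${}_H\Delta^\circ\mathcal A$; if $\mathcal A$ is abelian, with the quasi-isomorphisms (morphisms inducing isomorphisms on homology) as equivalences it is denoted ${}_Q\Delta^\circ\mathcal A$. On the category $Ch_+\mathcal A$ of non-negatively graded chain complexes take as simple functor the total complex, $(\mathbf sX)_q=\bigoplus_{p+n=q}X_{n,p}$ ($n$ the simplicial degree, $p$ the chain degree) with differential $d_{X_n}+(-1)^p\sum_i(-1)^id_i$ on $X_{n,p}$; as $\mu:\mathbf s\mathrm D\to\mathbf s\mathbf s$ the Alexander–Whitney map, given on $Z_{n,n,p}$ by the sum over $i+j=n$ of the maps $Z_{n,n,p}\to Z_{i,j,p}$ induced by the back face $[i]\to[n]$, $x\mapsto x+j$, in the first simplicial index and the front face $[j]\to[n]$, $x\mapsto x$, in the second; and as $\lambda_B:\mathbf s(B\times\Delta)\to B$ the projection onto the summands of simplicial degree $0$. With the chain homotopy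 equivalences as equivalences this is denoted ${}_HCh_+\mathcal A$; if $\mathcal A$ is abelian, with the quasi-isomorphisms as equivalences it is denoted ${}_QCh_+\mathcal A$. Let $K:\Delta^\circ\mathcal A\to Ch_+\mathcal A$ send $X$ to the complex with $(KX)_n=X_n$ and boundary $\sum_i(-1)^id_i$. **Proposition.** (i) Let $\mathcal A$ be an additive category. Then ${}_H\Delta^\circ\mathcal A$ is an additive simplicial descent category, ${}_HCh_+\mathcal A$ is a simplicial descent category, and $K:{}_H\Delta^\circ\mathcal A\to{}_HCh_+\mathcal A$ is a descent functor. (ii) Let $\mathcal A$ be an abelian category. Then ${}_Q\Delta^\circ\mathcal A$ is an additive simplicial descent category, ${}_QCh_+\mathcal A$ is a simplicial descent category, and $K:{}_Q\Delta^\circ\mathcal A\to{}_QCh_+\mathcal A$ is a descent functor. -/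

import Mathlib

open CategoryTheory CategoryTheory.Limits CategoryTheory.Functor Opposite Simplicial

universe v u v' u' v'' u''

noncomputable section

namespace SimplicialDescent

section Generalities

variable {D : Type u} [Category.{v} D] {D' : Type u'} [Category.{v'} D']

/-- Levelwise colimits: simplicial objects have finite coproducts if the category has them. -/
instance instHasFiniteCoproductsSimplicialObject [HasFiniteCoproducts D] :
    HasFiniteCoproducts (SimplicialObject D) :=
  inferInstanceAs (HasFiniteCoproducts (SimplexCategoryᵒᵖ ⥤ D))

instance instHasTerminalSimplicialObject [HasTerminal D] : HasTerminal (SimplicialObject D) :=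
  inferInstanceAs (HasTerminal (SimplexCategoryᵒᵖ ⥤ D))

instance instHasFiniteBiproductsSimplicialObject [Preadditive D] [HasFiniteBiproducts D] :
    HasFiniteBiproducts (SimplicialObject D) :=
  HasFiniteBiproducts.of_hasFiniteCoproducts

/-! ### Simplicial and bisimplicial objects -/

/-- The diagonal functor `D`: it sends a bisimplicial object `Z` (with
`Z_{n,m} = (Z.obj n).obj m`) to the simplicial object `n ↦ Z_{n,n}`. -/
@[simps]
def diag (D : Type u) [Category.{v} D] :
    SimplicialObject (SimplicialObject D) ⥤ SimplicialObject D where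
  obj Z :=
    { obj := fun n => (Z.obj n).obj n
      map := fun {n m} f => (Z.obj n).map f ≫ (Z.map f).app m }
  map f := { app := fun n => (f.app n).app n }

/-- The functor `F`, applied in every simplicial degree. -/
abbrev levelwise (F : D ⥤ D') : SimplicialObject D ⥤ SimplicialObject D' :=
  (SimplicialObject.whiskering D D').obj F

/-- `X ↦ Δ × X`, that is `(Δ × X)_{n,m} = X_m`. -/
abbrev constOuter (D : Type u) [Category.{v} D] :
    SimplicialObject D ⥤ SimplicialObject (SimplicialObject D) :=
  SimplicialObject.const (SimplicialObject D)

/-- `X ↦ X × Δ`, that is `(X × Δ)_{n,m} = X_n`. -/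
abbrev constInner (D : Type u) [Category.{v} D] :
    SimplicialObject D ⥤ SimplicialObject (SimplicialObject D) :=
  levelwise (SimplicialObject.const D)

/-- The canonical identification `D (Δ × X) = X`. -/
def diagConstOuter (D : Type u) [Category.{v} D] :
    constOuter D ⋙ diag D ≅ 𝟭 (SimplicialObject D) :=
  NatIso.ofComponents
    (fun X => NatIso.ofComponents (fun n => Iso.refl (X.obj n)) (fun {n m} f => by
      change (X.map f ≫ 𝟙 (X.obj m)) ≫ 𝟙 (X.obj m) = 𝟙 (X.obj n) ≫ X.map f
      simp))
    (fun {X Y} f => by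
      ext n
      change f.app n ≫ 𝟙 (Y.obj n) = 𝟙 (X.obj n) ≫ f.app n
      simp)

/-- The canonical identification `D (X × Δ) = X`. -/
def diagConstInner (D : Type u) [Category.{v} D] :
    constInner D ⋙ diag D ≅ 𝟭 (SimplicialObject D) :=
  NatIso.ofComponents
    (fun X => NatIso.ofComponents (fun n => Iso.refl (X.obj n)) (fun {n m} f => by
      change (𝟙 (X.obj n) ≫ X.map f) ≫ 𝟙 (X.obj m) = 𝟙 (X.obj n) ≫ X.map f
      simp))
    (fun {X Y} f => by
      ext n
      change f.app n ≫ 𝟙 (Y.obj n) = 𝟙 (X.obj n) ≫ f.app n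
      simp)

/-- The canonical identification `F (A × Δ) = F A × Δ`. -/
def constLevelwise (F : D ⥤ D') :
    SimplicialObject.const D ⋙ levelwise F ≅ F ⋙ SimplicialObject.const D' :=
  NatIso.ofComponents
    (fun A => NatIso.ofComponents (fun _ => Iso.refl (F.obj A)) (fun {n m} f => by
      change F.map (𝟙 A) ≫ 𝟙 (F.obj A) = 𝟙 (F.obj A) ≫ 𝟙 (F.obj A)
      simp))
    (fun {A B} f => by
      ext n
      change F.map f ≫ 𝟙 (F.obj B) = 𝟙 (F.obj A) ≫ F.map f
      simp)

/-- The canonical identification `F (D Z) = D (F Z)` for a bisimplicial object `Z`. -/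
def diagLevelwise (F : D ⥤ D') :
    diag D ⋙ levelwise F ≅ levelwise (levelwise F) ⋙ diag D' :=
  NatIso.ofComponents
    (fun Z => NatIso.ofComponents (fun n => Iso.refl (F.obj ((Z.obj n).obj n)))
      (fun {n m} f => by
        change F.map ((Z.obj n).map f ≫ (Z.map f).app m) ≫ 𝟙 _ =
          𝟙 _ ≫ F.map ((Z.obj n).map f) ≫ F.map ((Z.map f).app m)
        simp only [Category.comp_id, Category.id_comp, F.map_comp]))
    (fun {Z Z'} f => by
      ext n
      change F.map ((f.app n).app n) ≫ 𝟙 _ = 𝟙 _ ≫ F.map ((f.app n).app n)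
      simp only [Category.comp_id, Category.id_comp])

/-- The iterated simple functor `Z ↦ s (n ↦ s (m ↦ Z_{n,m}))`. -/
abbrev iterated (s : SimplicialObject D ⥤ D) : SimplicialObject (SimplicialObject D) ⥤ D :=
  levelwise s ⋙ s

/-! ### The simplicial cylinder and the simplicial cone -/

section Cone

variable [HasFiniteCoproducts D]

/-- The cylinder `Cyl X = Δ[1] ⊠ X`: in degree `n` it is the coproduct of copies of `X_n`
indexed by the set `Δ[1]_n = Hom([n], [1])`. -/
def cyl (X : SimplicialObject D) : SimplicialObject D where
  obj n := ∐ (fun _ : (n.unop ⟶ ⦋1⦌) => X.obj n)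
  map {n m} f := Sigma.desc (fun φ =>
    X.map f ≫ Sigma.ι (fun _ : (m.unop ⟶ ⦋1⦌) => X.obj m) (f.unop ≫ φ))

/-- The map `X = Δ[0] ⊠ X ⟶ Δ[1] ⊠ X` induced by a map `[0] ⟶ [1]`. -/
def toCyl (X : SimplicialObject D) (e : ⦋0⦌ ⟶ ⦋1⦌) : X ⟶ cyl X where
  app n := Sigma.ι (fun _ : (n.unop ⟶ ⦋1⦌) => X.obj n) (SimplexCategory.const n.unop ⦋0⦌ 0 ≫ e)
  naturality n m f := by
    have h : f.unop ≫ SimplexCategory.const n.unop ⦋0⦌ 0 ≫ e =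
        SimplexCategory.const m.unop ⦋0⦌ 0 ≫ e := rfl
    dsimp only [cyl]
    rw [colimit.ι_desc]
    dsimp only [Cofan.mk_ι_app]
    rw [h]

/-- `C` is (a model of) the double mapping cylinder `Cyl(f, g)` of `f : X ⟶ Y` and `g : X ⟶ Z`:
the pushout of `d₀ ⊔ d₁ : X ⊔ X ⟶ Cyl X` and `f ⊔ g : X ⊔ X ⟶ Y ⊔ Z`. -/
def IsDoubleMappingCylinder {X Y Z : SimplicialObject D} (f : X ⟶ Y) (g : X ⟶ Z)
    (C : SimplicialObject D) : Prop :=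
  ∃ (j : cyl X ⟶ C) (i : Y ⨿ Z ⟶ C),
    IsPushout
      (coprod.desc (toCyl X (SimplexCategory.δ 0)) (toCyl X (SimplexCategory.δ 1)))
      (coprod.map f g) j i

/-- `C` is (a model of) the simplicial cone of `f`: the double mapping cylinder of `f` and of
the map from `X` to the final object. -/
def IsSimplicialCone [HasTerminal D] {X Y : SimplicialObject D} (f : X ⟶ Y)
    (C : SimplicialObject D) : Prop :=
  IsDoubleMappingCylinder f
    ((terminal.from X : X ⟶ ⊤_ (SimplicialObject D))) C

end Cone

/-! ### Localized functor categories -/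

/-- `Fun(J, D)[E⁻¹]`, where a natural transformation is in `E` when all its components are. -/
abbrev FunLoc (E : MorphismProperty D) (J : Type u'') [Category.{v''} J] :=
  (E.functorCategory J).Localization

/-- The localization functor `Fun(J, D) ⥤ Fun(J, D)[E⁻¹]`. -/
abbrev funQ (E : MorphismProperty D) (J : Type u'') [Category.{v''} J] :
    (J ⥤ D) ⥤ FunLoc E J :=
  (E.functorCategory J).Q

/-- Precomposition with `G : J ⥤ J'` induces `Fun(J', D)[E⁻¹] ⥤ Fun(J, D)[E⁻¹]`. -/
def precomp (E : MorphismProperty D) {J : Type u'} [Category.{v'} J] {J' : Type u''}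
    [Category.{v''} J'] (G : J ⥤ J') : FunLoc E J' ⥤ FunLoc E J :=
  Localization.Construction.lift ((whiskeringLeft J J' D).obj G ⋙ funQ E J)
    (fun _ _ _ hf => MorphismProperty.Q_inverts _ _ (fun j => hf (G.obj j)))

/-- Postcomposition with a functor `ψ` that preserves equivalences induces
`Fun(J, D)[E⁻¹] ⥤ Fun(J, D')[E'⁻¹]`. -/
def postcomp {E : MorphismProperty D} {E' : MorphismProperty D'} (J : Type u'') [Category.{v''} J]
    (ψ : D ⥤ D') (hψ : ∀ ⦃X Y : D⦄ (f : X ⟶ Y), E f → E' (ψ.map f)) :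
    FunLoc E J ⥤ FunLoc E' J :=
  Localization.Construction.lift ((whiskeringRight J D D').obj ψ ⋙ funQ E' J)
    (fun _ _ _ hf => MorphismProperty.Q_inverts _ _ (fun j => hψ _ (hf j)))

/-- If `s` sends levelwise equivalences to equivalences, then `F ↦ s ∘ (levelwise F)` induces
`Fun(J, D)[E⁻¹] ⥤ Fun(Δᵒᵖ J, D)[E⁻¹]`. -/
def levelwiseSimple {E : MorphismProperty D} (J : Type u'') [Category.{v''} J]
    (s : SimplicialObject D ⥤ D)
    (hs : ∀ ⦃X Y : SimplicialObject D⦄ (f : X ⟶ Y), (∀ n, E (f.app n)) → E (s.map f)) :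
    FunLoc E J ⥤ FunLoc E (SimplicialObject J) :=
  Localization.Construction.lift
    (SimplicialObject.whiskering J D ⋙ (whiskeringRight (SimplicialObject J) _ D).obj s ⋙
      funQ E (SimplicialObject J))
    (fun _ _ _ hf => MorphismProperty.Q_inverts _ _
      (fun X => hs _ (fun n => hf (X.obj n))))

/-- The class of morphisms of additive functors whose components are all in `E`. -/
abbrev adClass (E : MorphismProperty D) [Preadditive D] (J : Type u'') [Category.{v''} J]
    [Preadditive J] : MorphismProperty (J ⥤+ D) :=
  (E.functorCategory J).inverseImage (AdditiveFunctor.forget J D)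

/-- The functor `Fun_ad(J, D)[E⁻¹] ⥤ Fun(J, D)[E⁻¹]` induced by the inclusion. -/
def adForget (E : MorphismProperty D) [Preadditive D] (J : Type u'') [Category.{v''} J]
    [Preadditive J] : (adClass E J).Localization ⥤ FunLoc E J :=
  Localization.Construction.lift (AdditiveFunctor.forget J D ⋙ funQ E J)
    (fun _ _ _ hf => MorphismProperty.Q_inverts _ _ hf)

/-! ### Simplicial descent categories -/

/-- The data `(E, s, μ, λ)` of a simplicial descent category structure on `D`. -/
structure DescentData (D : Type u) [Category.{v} D] where
  /-- the class of equivalences -/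
  E : MorphismProperty D
  /-- the simple functor -/
  s : SimplicialObject D ⥤ D
  /-- the morphism `μ : s D ⟶ s s` of `Fun(ΔᵒᵖΔᵒᵖD, D)[E⁻¹]` -/
  μ : (funQ E (SimplicialObject (SimplicialObject D))).obj (diag D ⋙ s) ⟶
    (funQ E (SimplicialObject (SimplicialObject D))).obj (iterated s)
  /-- the natural transformation `λ : s (- × Δ) ⟶ Id` -/
  lam : SimplicialObject.const D ⋙ s ⟶ 𝟭 D

namespace DescentData

variable (S : DescentData D) (S' : DescentData D')

/-- The natural transformation `s (λ_X) : s s (X × Δ) = s (n ↦ R X_n) ⟶ s X`. -/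
def simpleLam : constInner D ⋙ iterated S.s ⟶ S.s where
  app X := S.s.map
    (X := (levelwise S.s).obj ((constInner D).obj X))
    { app := fun n => S.lam.app (X.obj n)
      naturality := fun _ _ f => S.lam.naturality (X.map f) }
  naturality X Y f := by
    dsimp
    rw [← S.s.map_comp, ← S.s.map_comp]
    congr 1
    ext n
    exact S.lam.naturality (f.app n)

/-- The natural transformation `λ_{s X} : s s (Δ × X) = R (s X) ⟶ s X`. -/
def lamSimple : constOuter D ⋙ iterated S.s ⟶ S.s :=
  whiskerRight (constLevelwise S.s).hom S.s ≫ whiskerLeft S.s S.lam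

/-- The composition of `μ_{Δ × X} : s X ⟶ R (s X)` and `λ_{s X} : R (s X) ⟶ s X`, a morphism
in `Fun(ΔᵒᵖD, D)[E⁻¹]`. -/
def muLamOuter : (funQ S.E (SimplicialObject D)).obj S.s ⟶ (funQ S.E (SimplicialObject D)).obj S.s :=
  (funQ S.E (SimplicialObject D)).map (whiskerRight (diagConstOuter D).inv S.s) ≫
    (precomp S.E (constOuter D)).map S.μ ≫
    (funQ S.E (SimplicialObject D)).map S.lamSimple

/-- The composition of `μ_{X × Δ} : s X ⟶ s (R X)` and `s (λ_X) : s (R X) ⟶ s X`, a morphism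
in `Fun(ΔᵒᵖD, D)[E⁻¹]`. -/
def muLamInner : (funQ S.E (SimplicialObject D)).obj S.s ⟶ (funQ S.E (SimplicialObject D)).obj S.s :=
  (funQ S.E (SimplicialObject D)).map (whiskerRight (diagConstInner D).inv S.s) ≫
    (precomp S.E (constInner D)).map S.μ ≫
    (funQ S.E (SimplicialObject D)).map S.simpleLam

/-- An object is acyclic if its map to the final object is an equivalence. -/
def Acyclic [HasTerminal D] (A : D) : Prop := S.E (terminal.from A)

/-- The axioms of a simplicial descent category for the data `(E, s, μ, λ)` on a category `D`
with finite coproducts (in particular an initial object) and a final object. -/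
structure IsDescent [HasFiniteCoproducts D] [HasTerminal D] : Prop where
  /-- `E` is saturated: it consists of the morphisms that become invertible in `D[E⁻¹]` -/
  saturated : ∀ ⦃X Y : D⦄ (f : X ⟶ Y), S.E f ↔ IsIso (S.E.Q.map f)
  /-- `E` is stable by coproducts -/
  coprod_mem : ∀ ⦃X Y X' Y' : D⦄ (f : X ⟶ Y) (f' : X' ⟶ Y'), S.E f → S.E f' → S.E (coprod.map f f')
  /-- `s` commutes with coproducts up to equivalence -/
  simple_coprod : ∀ X Y : SimplicialObject D, S.E (coprodComparison S.s X Y)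
  /-- `μ` is an isomorphism of `Fun(ΔᵒᵖΔᵒᵖD, D)[E⁻¹]` -/
  isIso_mu : IsIso S.μ
  /-- every `λ_X` is an equivalence -/
  lam_mem : ∀ X : D, S.E (S.lam.app X)
  /-- `λ` has a natural section -/
  exists_rho : ∃ ρ : 𝟭 D ⟶ SimplicialObject.const D ⋙ S.s, ρ ≫ S.lam = 𝟙 (𝟭 D)
  /-- `λ` is compatible with `μ` (on `Δ × X`) -/
  compat_outer : S.muLamOuter = 𝟙 _
  /-- `λ` is compatible with `μ` (on `X × Δ`) -/
  compat_inner : S.muLamInner = 𝟙 _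
  /-- `s` is exact: it sends levelwise equivalences to equivalences -/
  exact : ∀ ⦃X Y : SimplicialObject D⦄ (f : X ⟶ Y), (∀ n, S.E (f.app n)) → S.E (S.s.map f)
  /-- the simplicial cone of a constant map exists -/
  exists_cone : ∀ ⦃A B : D⦄ (f : A ⟶ B),
    ∃ C, IsSimplicialCone ((SimplicialObject.const D).map f) C
  /-- `f` is an equivalence if and only if the simple of its simplicial cone is acyclic -/
  acyclicity : ∀ ⦃A B : D⦄ (f : A ⟶ B) (C : SimplicialObject D),
    IsSimplicialCone ((SimplicialObject.const D).map f) C → (S.E f ↔ S.Acyclic (S.s.obj C))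
  /-- invariance of the equivalences `s f` under the inverse order functor `Υ` -/
  symmetry : ∀ ⦃X Y : SimplicialObject D⦄ (f : X ⟶ Y),
    S.E (S.s.map (SimplicialObject.opFunctor.map f)) ↔ S.E (S.s.map f)

/-- The axioms of an additive simplicial descent category: `D` is additive, `s` is an additive
functor, and `μ` is (the image of) an isomorphism of `Fun_ad(ΔᵒᵖΔᵒᵖD, D)[E⁻¹]`. -/
structure IsAdditiveDescent [Preadditive D] [HasFiniteBiproducts D] : Prop extends
    S.IsDescent where
  simple_additive : S.s.Additive
  mu_additive : ∃ (_ : (diag D ⋙ S.s).Additive) (_ : (iterated S.s).Additive)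
    (μ' : (adClass S.E (SimplicialObject (SimplicialObject D))).Q.obj
        (AdditiveFunctor.of (diag D ⋙ S.s)) ⟶
      (adClass S.E (SimplicialObject (SimplicialObject D))).Q.obj
        (AdditiveFunctor.of (iterated S.s))),
    IsIso μ' ∧ (adForget S.E (SimplicialObject (SimplicialObject D))).map μ' = S.μ

/-! ### Descent functors -/

section DescentFunctor

variable {S S'}
variable [HasFiniteCoproducts D] [HasTerminal D] [HasFiniteCoproducts D'] [HasTerminal D']
variable (ψ : D ⥤ D')

/-- A morphism `Θ : ψ s ⟶ s' ψ` of `Fun(ΔᵒᵖD, D')[E'⁻¹]`. -/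
abbrev Comparison (S : DescentData D) (S' : DescentData D') (ψ : D ⥤ D') :=
  (funQ S'.E (SimplicialObject D)).obj (S.s ⋙ ψ) ⟶
    (funQ S'.E (SimplicialObject D)).obj (levelwise ψ ⋙ S'.s)

/-- Compatibility of `Θ` with `λ` and `λ'`: one has `λ'_{ψ X} ∘ Θ_{X × Δ} = ψ (λ_X)` in
`Fun(D, D')[E'⁻¹]`. -/
def LamCompatible (Θ : Comparison S S' ψ) : Prop :=
  (precomp S'.E (SimplicialObject.const D)).map Θ ≫
      (funQ S'.E D).map (whiskerRight (constLevelwise ψ).hom S'.s ≫ whiskerLeft ψ S'.lam) =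
    (funQ S'.E D).map (whiskerRight S.lam ψ)

/-- Compatibility of `Θ` with `μ` and `μ'`: in `Fun(ΔᵒᵖΔᵒᵖD, D')[E'⁻¹]`, the composition
`ψ s D Z ⟶ s' D (ψ Z) ⟶ s' s' (ψ Z)` of `Θ_{D Z}` and `μ'_{ψ Z}` is equal to the composition
`ψ s D Z ⟶ ψ s s Z ⟶ s' ψ (s Z) ⟶ s' s' (ψ Z)` of `ψ (μ_Z)`, `Θ_{s Z}` and `s' (Θ_Z)`. -/
def MuCompatible (hψ : ∀ ⦃X Y : D⦄ (f : X ⟶ Y), S.E f → S'.E (ψ.map f))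
    (hS' : S'.IsDescent) (Θ : Comparison S S' ψ) : Prop :=
  (precomp S'.E (diag D)).map Θ ≫
      (funQ S'.E (SimplicialObject (SimplicialObject D))).map
        (whiskerRight (diagLevelwise ψ).hom S'.s) ≫
      (precomp S'.E (levelwise (levelwise ψ))).map S'.μ =
    (postcomp (SimplicialObject (SimplicialObject D)) ψ hψ).map S.μ ≫
      (precomp S'.E (levelwise S.s)).map Θ ≫
      (levelwiseSimple (SimplicialObject D) S'.s hS'.exact).map Θ

/-- `ψ` is a descent functor between the simplicial descent categories `(D, S)` and `(D', S')`. -/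
structure IsDescentFunctor (hS : S.IsDescent) (hS' : S'.IsDescent) (ψ : D ⥤ D') : Prop where
  /-- `ψ` preserves equivalences -/
  map_mem : ∀ ⦃X Y : D⦄ (f : X ⟶ Y), S.E f → S'.E (ψ.map f)
  /-- `ψ` commutes with coproducts up to equivalence -/
  map_coprod : ∀ X Y : D, S'.E (coprodComparison ψ X Y)
  /-- `ψ` commutes with the simple functors, compatibly with `λ`, `λ'`, `μ` and `μ'` -/
  exists_comparison : ∃ Θ : Comparison S S' ψ,
    IsIso Θ ∧ LamCompatible ψ Θ ∧ MuCompatible ψ map_mem hS' Θ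

end DescentFunctor

end DescentData

end Generalities

section ChainComplexes

variable {A : Type u} [Category.{v} A] [Preadditive A]

open AlgebraicTopology

/-- The boundary map `∂ : X_{n,p} ⟶ X_{n-1,p}`, the alternating sum of the face maps. -/
def bdry (X : SimplicialObject (ChainComplex A ℕ)) (n p : ℕ) :
    (X _⦋n⦌).X p ⟶ (X _⦋n - 1⦌).X p :=
  (((alternatingFaceMapComplex _).obj X).d n (n - 1)).f p

lemma bdry_zero (X : SimplicialObject (ChainComplex A ℕ)) (p : ℕ) : bdry X 0 p = 0 := by
  unfold bdry
  rw [HomologicalComplex.shape _ _ _ (by simp)]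
  rfl

lemma bdry_succ (X : SimplicialObject (ChainComplex A ℕ)) (n p : ℕ) :
    bdry X (n + 1) p = ∑ i : Fin (n + 2), ((-1 : ℤ) ^ (i : ℕ)) • (X.δ i).f p := by
  have h : ((alternatingFaceMapComplex _).obj X).d (n + 1) n =
      ∑ i : Fin (n + 2), ((-1 : ℤ) ^ (i : ℕ)) • X.δ i := alternatingFaceMapComplex_obj_d X n
  have h2 : bdry X (n + 1) p = (((alternatingFaceMapComplex _).obj X).d (n + 1) n).f p := rfl
  rw [h2, h]
  exact (HomologicalComplex.eval _ _ p).map_sum _ _ |>.trans (by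
    refine Finset.sum_congr rfl fun i _ => ?_
    exact (HomologicalComplex.eval _ _ p).map_zsmul)

variable [HasFiniteBiproducts A]

/-- The total complex of a first quadrant double complex only involves finite coproducts. -/
instance hasTotal (K : HomologicalComplex₂ A (ComplexShape.down ℕ) (ComplexShape.down ℕ)) :
    K.HasTotal (ComplexShape.down ℕ) := by
  intro q
  have : Finite ((fun x : ℕ × ℕ => ComplexShape.π (ComplexShape.down ℕ) (ComplexShape.down ℕ)
      (ComplexShape.down ℕ) x) ⁻¹' {q}) :=
    Set.Finite.to_subtype ((Set.finite_Iic (q, q)).subset (by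
      rintro ⟨a, b⟩ (h : a + b = q)
      simp only [Set.mem_Iic, Prod.mk_le_mk]
      omega))
  exact hasColimitsOfShape_discrete A _ |>.has_colimit _

/-- The double complex `K X` of a simplicial chain complex `X`, with `(K X)_{p,n} = X_{n,p}`:
the internal degree `p` is the first one. -/
abbrev doubleComplex (A : Type u) [Category.{v} A] [Preadditive A] :
    SimplicialObject (ChainComplex A ℕ) ⥤
      HomologicalComplex₂ A (ComplexShape.down ℕ) (ComplexShape.down ℕ) :=
  alternatingFaceMapComplex (ChainComplex A ℕ) ⋙ HomologicalComplex₂.flipFunctor A _ _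

/-- The simple functor of (positive) chain complexes: `(s X)_q` is the coproduct of the
`X_{n,p}` for `p + n = q`, and the differential is `d_{X_n} + (-1)^p ∂` on `X_{n,p}`, where
`∂` is the alternating sum of the face maps. -/
def simple (A : Type u) [Category.{v} A] [Preadditive A] [HasFiniteBiproducts A] :
    SimplicialObject (ChainComplex A ℕ) ⥤ ChainComplex A ℕ :=
  doubleComplex A ⋙ HomologicalComplex₂.totalFunctor A _ _ (ComplexShape.down ℕ)

/-- The inclusion `X_{n,p} ⟶ (s X)_q` for `p + n = q`. -/
def simpleι (X : SimplicialObject (ChainComplex A ℕ)) (n p q : ℕ) (h : p + n = q) :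
    (X _⦋n⦌).X p ⟶ ((simple A).obj X).X q :=
  ((doubleComplex A).obj X).ιTotal (ComplexShape.down ℕ) p n q h

/-- The inclusion `X_{n,p} ⟶ (s X)_q` if `p + n = q`, and `0` otherwise. -/
def simpleι₀ (X : SimplicialObject (ChainComplex A ℕ)) (n p q : ℕ) :
    (X _⦋n⦌).X p ⟶ ((simple A).obj X).X q :=
  if h : p + n = q then simpleι X n p q h else 0

/-- The morphism from `(s X)_q` with given restrictions to the summands `X_{n,p}`. -/
def simpleDesc {X : SimplicialObject (ChainComplex A ℕ)} {q : ℕ} {B : A}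
    (f : ∀ n p : ℕ, p + n = q → ((X _⦋n⦌).X p ⟶ B)) : ((simple A).obj X).X q ⟶ B :=
  ((doubleComplex A).obj X).totalDesc (fun p n h => f n p h)

lemma simpleι_desc {X : SimplicialObject (ChainComplex A ℕ)} {q : ℕ} {B : A}
    (f : ∀ n p : ℕ, p + n = q → ((X _⦋n⦌).X p ⟶ B)) (n p : ℕ) (h : p + n = q) :
    simpleι X n p q h ≫ simpleDesc f = f n p h :=
  ((doubleComplex A).obj X).ι_totalDesc _ p n h

lemma simple_hom_ext {X : SimplicialObject (ChainComplex A ℕ)} {q : ℕ} {B : A}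
    {f g : ((simple A).obj X).X q ⟶ B}
    (h : ∀ (n p : ℕ) (h : p + n = q), simpleι X n p q h ≫ f = simpleι X n p q h ≫ g) : f = g :=
  HomologicalComplex₂.total.hom_ext (K := (doubleComplex A).obj X) (ComplexShape.down ℕ)
    (fun p n hpn => h n p hpn)

lemma simpleι_map {X Y : SimplicialObject (ChainComplex A ℕ)} (f : X ⟶ Y) (n p q : ℕ)
    (h : p + n = q) :
    simpleι X n p q h ≫ ((simple A).map f).f q = (f.app (op ⦋n⦌)).f p ≫ simpleι Y n p q h :=
  HomologicalComplex₂.ιTotal_map (c₁₂ := ComplexShape.down ℕ) (φ := (doubleComplex A).map f)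
    (i₁ := p) (i₂ := n) (i₁₂ := q) (h := h)

lemma simpleι₀_eq (X : SimplicialObject (ChainComplex A ℕ)) (n p q : ℕ) (h : p + n = q) :
    simpleι₀ X n p q = simpleι X n p q h := dif_pos h

lemma simpleι₀_map {X Y : SimplicialObject (ChainComplex A ℕ)} (f : X ⟶ Y) (n p q : ℕ) :
    simpleι₀ X n p q ≫ ((simple A).map f).f q = (f.app (op ⦋n⦌)).f p ≫ simpleι₀ Y n p q := by
  unfold simpleι₀
  split_ifs
  · apply simpleι_map
  · simp

lemma simpleι_d (X : SimplicialObject (ChainComplex A ℕ)) (n p q q' : ℕ) (h : p + n = q)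
    (hq : q' + 1 = q) :
    simpleι X n p q h ≫ ((simple A).obj X).d q q' =
      (X _⦋n⦌).d p (p - 1) ≫ simpleι₀ X n (p - 1) q' +
      ((-1 : ℤ) ^ p) • (bdry X n p ≫ simpleι₀ X (n - 1) p q') := by
  let K := (doubleComplex A).obj X
  have h0 : simpleι X n p q h ≫ ((simple A).obj X).d q q' =
      K.d₁ (ComplexShape.down ℕ) p n q' + K.d₂ (ComplexShape.down ℕ) p n q' := by
    have h1 := K.ι_D₁ (ComplexShape.down ℕ) q q' p n h
    have h2 := K.ι_D₂ (ComplexShape.down ℕ) q q' p n h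
    rw [← h1, ← h2, ← Preadditive.comp_add]
    rfl
  rw [h0]
  congr 1
  · cases p with
    | zero =>
      rw [HomologicalComplex₂.d₁_eq_zero, HomologicalComplex.shape _ _ _ (by simp)]
      · exact zero_comp.symm
      · simp
    | succ p =>
      rw [HomologicalComplex₂.d₁_eq K (ComplexShape.down ℕ) (i₁' := p) (by simp) n q'
        (show p + n = q' by omega), show simpleι₀ X n (p + 1 - 1) q' = simpleι X n p q' (show p + n = q' by omega) from
          simpleι₀_eq _ _ _ _ (show p + n = q' by omega)]
      exact one_smul _ _
  · cases n with
    | zero =>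
      rw [HomologicalComplex₂.d₂_eq_zero, bdry_zero, zero_comp, smul_zero]
      · rfl
      · simp
    | succ n =>
      rw [HomologicalComplex₂.d₂_eq K (ComplexShape.down ℕ) p (i₂' := n) (by simp) q'
        (show p + n = q' by omega)]
      have h3 : simpleι₀ X (n + 1 - 1) p q' = simpleι X n p q' (show p + n = q' by omega) :=
        simpleι₀_eq X n p q' (show p + n = q' by omega)
      rw [h3]
      have h4 : ComplexShape.ε₂ (ComplexShape.down ℕ) (ComplexShape.down ℕ)
        (ComplexShape.down ℕ) (p, n + 1) = (-1 : ℤˣ) ^ p := rfl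
      rw [h4, Units.smul_def, Units.val_pow_eq_pow_val]
      rfl

/-! ### The Alexander-Whitney map -/

/-- The front face `[j] ⟶ [n]`, `x ↦ x` (for `j ≤ n`). -/
def front (n j : ℕ) : ⦋j⦌ ⟶ ⦋n⦌ :=
  SimplexCategory.mkHom ⟨fun x => ⟨min x.1 n, by omega⟩, fun x y h => by
    have : x.1 ≤ y.1 := h
    simp only [Fin.mk_le_mk]
    omega⟩

/-- The back face `[i] ⟶ [n]`, `x ↦ x + (n - i)` (for `i ≤ n`). -/
def back (n i : ℕ) : ⦋i⦌ ⟶ ⦋n⦌ :=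
  SimplexCategory.mkHom ⟨fun x => ⟨n - (i - x.1), by omega⟩, fun x y h => by
    have : x.1 ≤ y.1 := h
    simp only [Fin.mk_le_mk]
    omega⟩

/-- The map `Z_{n,m} ⟶ Z_{i,j}` induced by `f : [i] ⟶ [n]` and `g : [j] ⟶ [m]`. -/
def biMap {C : Type u'} [Category.{v'} C] (Z : SimplicialObject (SimplicialObject C))
    {n m i j : ℕ} (f : ⦋i⦌ ⟶ ⦋n⦌) (g : ⦋j⦌ ⟶ ⦋m⦌) :
    (Z.obj (op ⦋n⦌)).obj (op ⦋m⦌) ⟶ (Z.obj (op ⦋i⦌)).obj (op ⦋j⦌) :=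
  (Z.obj (op ⦋n⦌)).map g.op ≫ (Z.map f.op).app (op ⦋j⦌)

lemma biMap_comp {C : Type u'} [Category.{v'} C] (Z : SimplicialObject (SimplicialObject C))
    {n m i j k l : ℕ} (f : ⦋i⦌ ⟶ ⦋n⦌) (g : ⦋j⦌ ⟶ ⦋m⦌) (f' : ⦋k⦌ ⟶ ⦋i⦌) (g' : ⦋l⦌ ⟶ ⦋j⦌) :
    biMap Z f g ≫ biMap Z f' g' = biMap Z (f' ≫ f) (g' ≫ g) := by
  unfold biMap
  rw [op_comp, op_comp, Functor.map_comp, Functor.map_comp, NatTrans.comp_app]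
  simp only [Category.assoc, NatTrans.naturality_assoc]

lemma biMap_naturality {C : Type u'} [Category.{v'} C] {Z Z' : SimplicialObject (SimplicialObject C)}
    (α : Z ⟶ Z') {n m i j : ℕ} (f : ⦋i⦌ ⟶ ⦋n⦌) (g : ⦋j⦌ ⟶ ⦋m⦌) :
    (α.app (op ⦋n⦌)).app (op ⦋m⦌) ≫ biMap Z' f g =
      biMap Z f g ≫ (α.app (op ⦋i⦌)).app (op ⦋j⦌) := by
  unfold biMap
  have h := congr_arg (fun φ => NatTrans.app φ (op ⦋j⦌)) (α.naturality f.op)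
  dsimp only [NatTrans.comp_app] at h
  rw [Category.assoc, h, NatTrans.naturality_assoc]

/-- The inclusion `(s Z_{i,*})_r ⟶ (s s Z)_q` if `r + i = q`, and `0` otherwise. -/
def outerι (Z : SimplicialObject (SimplicialObject (ChainComplex A ℕ))) (i r q : ℕ) :
    ((simple A).obj (Z.obj (op ⦋i⦌))).X r ⟶ ((iterated (simple A)).obj Z).X q :=
  simpleι₀ ((levelwise (simple A)).obj Z) i r q

lemma outerι_map {Z Z' : SimplicialObject (SimplicialObject (ChainComplex A ℕ))} (α : Z ⟶ Z')
    (i r q : ℕ) :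
    outerι Z i r q ≫ ((iterated (simple A)).map α).f q =
      ((simple A).map (α.app (op ⦋i⦌))).f r ≫ outerι Z' i r q :=
  simpleι₀_map ((levelwise (simple A)).map α) i r q

/-- The boundary map `(s Z_{i,*})_r ⟶ (s Z_{i-1,*})_r` in the first simplicial direction. -/
def bdrySimple (Z : SimplicialObject (SimplicialObject (ChainComplex A ℕ))) (i r : ℕ) :
    ((simple A).obj (Z.obj (op ⦋i⦌))).X r ⟶ ((simple A).obj (Z.obj (op ⦋i - 1⦌))).X r :=
  bdry ((levelwise (simple A)).obj Z) i r

lemma bdrySimple_zero (Z : SimplicialObject (SimplicialObject (ChainComplex A ℕ))) (r : ℕ) :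
    bdrySimple Z 0 r = 0 := bdry_zero _ _

lemma bdrySimple_succ (Z : SimplicialObject (SimplicialObject (ChainComplex A ℕ))) (i r : ℕ) :
    bdrySimple Z (i + 1) r =
      ∑ l : Fin (i + 2), ((-1 : ℤ) ^ (l : ℕ)) • ((simple A).map (Z.δ l)).f r := bdry_succ _ _ _

lemma outerι_d (Z : SimplicialObject (SimplicialObject (ChainComplex A ℕ))) (i r q q' : ℕ)
    (h : r + i = q) (hq : q' + 1 = q) :
    outerι Z i r q ≫ ((iterated (simple A)).obj Z).d q q' =
      ((simple A).obj (Z.obj (op ⦋i⦌))).d r (r - 1) ≫ outerι Z i (r - 1) q' +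
      ((-1 : ℤ) ^ r) • (bdrySimple Z i r ≫ outerι Z (i - 1) r q') := by
  have h1 := simpleι_d ((levelwise (simple A)).obj Z) i r q q' h hq
  rw [← simpleι₀_eq] at h1
  exact h1

/-- The inclusion `Z_{i,j,p} ⟶ (s s Z)_q` if `p + j + i = q`, and `0` otherwise. -/
def iteratedι (Z : SimplicialObject (SimplicialObject (ChainComplex A ℕ))) (i j p q : ℕ) :
    ((Z.obj (op ⦋i⦌)).obj (op ⦋j⦌)).X p ⟶ ((iterated (simple A)).obj Z).X q :=
  simpleι (Z.obj (op ⦋i⦌)) j p (p + j) rfl ≫ outerι Z i (p + j) q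

lemma simpleι_outerι (Z : SimplicialObject (SimplicialObject (ChainComplex A ℕ)))
    (i j p r q : ℕ) (h : p + j = r) :
    simpleι (Z.obj (op ⦋i⦌)) j p r h ≫ outerι Z i r q = iteratedι Z i j p q := by
  subst h
  rfl

lemma iteratedι_map {Z Z' : SimplicialObject (SimplicialObject (ChainComplex A ℕ))} (α : Z ⟶ Z')
    (i j p q : ℕ) :
    iteratedι Z i j p q ≫ ((iterated (simple A)).map α).f q =
      ((α.app (op ⦋i⦌)).app (op ⦋j⦌)).f p ≫ iteratedι Z' i j p q := by
  unfold iteratedι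
  rw [Category.assoc, outerι_map, ← Category.assoc, simpleι_map, Category.assoc]

/-- The boundary map `Z_{i,j,p} ⟶ Z_{i-1,j,p}` in the first simplicial direction. -/
def bdryOuter (Z : SimplicialObject (SimplicialObject (ChainComplex A ℕ))) (i j p : ℕ) :
    ((Z.obj (op ⦋i⦌)).obj (op ⦋j⦌)).X p ⟶ ((Z.obj (op ⦋i - 1⦌)).obj (op ⦋j⦌)).X p :=
  bdry ((levelwise ((evaluation _ _).obj (op ⦋j⦌))).obj Z) i p

lemma bdryOuter_zero (Z : SimplicialObject (SimplicialObject (ChainComplex A ℕ))) (j p : ℕ) :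
    bdryOuter Z 0 j p = 0 := bdry_zero _ _

lemma bdryOuter_succ (Z : SimplicialObject (SimplicialObject (ChainComplex A ℕ))) (i j p : ℕ) :
    bdryOuter Z (i + 1) j p =
      ∑ l : Fin (i + 2), ((-1 : ℤ) ^ (l : ℕ)) • ((Z.δ l).app (op ⦋j⦌)).f p := bdry_succ _ _ _

lemma simpleι_bdrySimple (Z : SimplicialObject (SimplicialObject (ChainComplex A ℕ)))
    (i j p r : ℕ) (h : p + j = r) :
    simpleι (Z.obj (op ⦋i⦌)) j p r h ≫ bdrySimple Z i r =
      bdryOuter Z i j p ≫ simpleι (Z.obj (op ⦋i - 1⦌)) j p r h := by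
  cases i with
  | zero => rw [bdrySimple_zero, bdryOuter_zero, comp_zero, zero_comp]
  | succ i =>
    rw [bdrySimple_succ, bdryOuter_succ, Preadditive.comp_sum, Preadditive.sum_comp]
    refine Finset.sum_congr rfl fun l _ => ?_
    rw [Preadditive.comp_zsmul, Preadditive.zsmul_comp, simpleι_map]
    rfl

lemma iteratedι_d (Z : SimplicialObject (SimplicialObject (ChainComplex A ℕ))) (i j p q q' : ℕ)
    (h : p + j + i = q) (hq : q' + 1 = q) :
    iteratedι Z i j p q ≫ ((iterated (simple A)).obj Z).d q q' =
      ((Z.obj (op ⦋i⦌)).obj (op ⦋j⦌)).d p (p - 1) ≫ iteratedι Z i j (p - 1) q' +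
      ((-1 : ℤ) ^ p) • (bdry (Z.obj (op ⦋i⦌)) j p ≫ iteratedι Z i (j - 1) p q') +
      ((-1 : ℤ) ^ (p + j)) • (bdryOuter Z i j p ≫ iteratedι Z (i - 1) j p q') := by
  unfold iteratedι
  rw [Category.assoc, outerι_d Z i (p + j) q q' h hq, Preadditive.comp_add,
    Preadditive.comp_zsmul, ← Category.assoc _ (bdrySimple Z i (p + j)), simpleι_bdrySimple,
    Category.assoc]
  congr 1
  rcases Nat.eq_zero_or_pos (p + j) with h0 | h0
  · obtain ⟨rfl, rfl⟩ : p = 0 ∧ j = 0 := by omega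
    have h1 : ((simple A).obj (Z.obj (op ⦋i⦌))).d (0 + 0) (0 + 0 - 1) = 0 :=
      HomologicalComplex.shape _ _ _ (by simp)
    have h2 : ((Z.obj (op ⦋i⦌)).obj (op ⦋0⦌)).d 0 (0 - 1) = 0 :=
      HomologicalComplex.shape _ _ _ (by simp)
    rw [bdry_zero, zero_comp, smul_zero, h1, h2, zero_comp, comp_zero, zero_comp, zero_add]
  · rw [← Category.assoc, simpleι_d _ _ _ _ (p + j - 1) rfl (by omega), Preadditive.add_comp,
      Preadditive.zsmul_comp, Category.assoc, Category.assoc]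
    congr 1
    · cases p with
      | zero => rw [HomologicalComplex.shape _ 0 (0 - 1) (by simp), zero_comp, zero_comp]
      | succ p =>
        rw [show simpleι₀ (Z.obj (op ⦋i⦌)) j (p + 1 - 1) (p + 1 + j - 1) =
          simpleι (Z.obj (op ⦋i⦌)) j p (p + 1 + j - 1) (by omega) from simpleι₀_eq _ _ _ _ _]
        exact congr_arg _ (simpleι_outerι Z i j p _ q' _)
    · cases j with
      | zero => rw [bdry_zero, zero_comp, zero_comp]
      | succ j =>
        rw [show simpleι₀ (Z.obj (op ⦋i⦌)) (j + 1 - 1) p (p + (j + 1) - 1) =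
          simpleι (Z.obj (op ⦋i⦌)) j p (p + (j + 1) - 1) (by omega) from simpleι₀_eq _ _ _ _ _]
        exact congr_arg (fun φ => ((-1 : ℤ) ^ p) • (bdry (Z.obj (op ⦋i⦌)) (j + 1) p ≫ φ))
          (simpleι_outerι Z i j p _ q' _)

/-- The composition `Z_{n,n,p} ⟶ Z_{i,j,p} ⟶ (s s Z)_q` of the map induced by `f : [i] ⟶ [n]`
and `g : [j] ⟶ [n]` and of the inclusion of the summand `Z_{i,j,p}` (if `p + j + i = q`). -/
def awTerm (Z : SimplicialObject (SimplicialObject (ChainComplex A ℕ))) {n i j : ℕ}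
    (f : ⦋i⦌ ⟶ ⦋n⦌) (g : ⦋j⦌ ⟶ ⦋n⦌) (p q : ℕ) :
    ((Z.obj (op ⦋n⦌)).obj (op ⦋n⦌)).X p ⟶ ((iterated (simple A)).obj Z).X q :=
  (biMap Z f g).f p ≫ iteratedι Z i j p q

lemma biMap_awTerm (Z : SimplicialObject (SimplicialObject (ChainComplex A ℕ))) {m n i j : ℕ}
    (θ : ⦋n⦌ ⟶ ⦋m⦌) (f : ⦋i⦌ ⟶ ⦋n⦌) (g : ⦋j⦌ ⟶ ⦋n⦌) (p q : ℕ) :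
    (biMap Z θ θ).f p ≫ awTerm Z f g p q = awTerm Z (f ≫ θ) (g ≫ θ) p q := by
  unfold awTerm
  rw [← Category.assoc, ← HomologicalComplex.comp_f, biMap_comp]

/-- The component of degree `q` of the Alexander-Whitney map: on the summand `Z_{n,n,p}`, it is
the sum over `j + i = n` of the maps `Z_{n,n,p} ⟶ Z_{i,j,p}` given by the back face of
dimension `i` in the first direction and by the front face of dimension `j` in the second. -/
def awHom (Z : SimplicialObject (SimplicialObject (ChainComplex A ℕ))) (q : ℕ) :
    ((diag _ ⋙ simple A).obj Z).X q ⟶ ((iterated (simple A)).obj Z).X q :=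
  simpleDesc (X := (diag _).obj Z) fun n p _ =>
    ∑ x ∈ Finset.HasAntidiagonal.antidiagonal n, awTerm Z (back n x.2) (front n x.1) p q

/-- The inclusion `Z_{n,n,p} ⟶ (s D Z)_q` if `p + n = q`, and `0` otherwise. -/
def diagι (Z : SimplicialObject (SimplicialObject (ChainComplex A ℕ))) (n p q : ℕ) :
    ((Z.obj (op ⦋n⦌)).obj (op ⦋n⦌)).X p ⟶ ((diag _ ⋙ simple A).obj Z).X q :=
  simpleι₀ ((diag _).obj Z) n p q

/-- The boundary map `Z_{n,n,p} ⟶ Z_{n-1,n-1,p}` of the diagonal. -/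
def diagBdry (Z : SimplicialObject (SimplicialObject (ChainComplex A ℕ))) (n p : ℕ) :
    ((Z.obj (op ⦋n⦌)).obj (op ⦋n⦌)).X p ⟶ ((Z.obj (op ⦋n - 1⦌)).obj (op ⦋n - 1⦌)).X p :=
  bdry ((diag _).obj Z) n p

lemma diagBdry_zero (Z : SimplicialObject (SimplicialObject (ChainComplex A ℕ))) (p : ℕ) :
    diagBdry Z 0 p = 0 := bdry_zero _ _

lemma diagBdry_succ (Z : SimplicialObject (SimplicialObject (ChainComplex A ℕ))) (n p : ℕ) :
    diagBdry Z (n + 1) p = ∑ k : Fin (n + 2),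
      ((-1 : ℤ) ^ (k : ℕ)) • (biMap Z (SimplexCategory.δ k) (SimplexCategory.δ k)).f p :=
  bdry_succ _ _ _

lemma diagι_d (Z : SimplicialObject (SimplicialObject (ChainComplex A ℕ))) (n p q q' : ℕ)
    (h : p + n = q) (hq : q' + 1 = q) :
    diagι Z n p q ≫ ((diag _ ⋙ simple A).obj Z).d q q' =
      ((Z.obj (op ⦋n⦌)).obj (op ⦋n⦌)).d p (p - 1) ≫ diagι Z n (p - 1) q' +
      ((-1 : ℤ) ^ p) • (diagBdry Z n p ≫ diagι Z (n - 1) p q') := by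
  have h1 := simpleι_d ((diag _).obj Z) n p q q' h hq
  rw [← simpleι₀_eq] at h1
  exact h1

lemma diagι_map {Z Z' : SimplicialObject (SimplicialObject (ChainComplex A ℕ))} (α : Z ⟶ Z')
    (n p q : ℕ) :
    diagι Z n p q ≫ ((diag _ ⋙ simple A).map α).f q =
      ((α.app (op ⦋n⦌)).app (op ⦋n⦌)).f p ≫ diagι Z' n p q :=
  simpleι₀_map ((diag _).map α) n p q

lemma diag_hom_ext {Z : SimplicialObject (SimplicialObject (ChainComplex A ℕ))} {q : ℕ} {B : A}
    {f g : ((diag _ ⋙ simple A).obj Z).X q ⟶ B}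
    (h : ∀ n p : ℕ, p + n = q → diagι Z n p q ≫ f = diagι Z n p q ≫ g) : f = g := by
  refine simple_hom_ext (X := (diag _).obj Z) fun n p hn => ?_
  have h1 := h n p hn
  unfold diagι at h1
  rw [simpleι₀_eq _ _ _ _ hn] at h1
  exact h1

lemma awTerm_d (Z : SimplicialObject (SimplicialObject (ChainComplex A ℕ))) {n i j : ℕ}
    (f : ⦋i⦌ ⟶ ⦋n⦌) (g : ⦋j⦌ ⟶ ⦋n⦌) (p q q' : ℕ) (h : p + j + i = q) (hq : q' + 1 = q) :
    awTerm Z f g p q ≫ ((iterated (simple A)).obj Z).d q q' =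
      ((Z.obj (op ⦋n⦌)).obj (op ⦋n⦌)).d p (p - 1) ≫ awTerm Z f g (p - 1) q' +
      ((-1 : ℤ) ^ p) • ((biMap Z f g).f p ≫ bdry (Z.obj (op ⦋i⦌)) j p ≫ iteratedι Z i (j - 1) p q')
      + ((-1 : ℤ) ^ (p + j)) • ((biMap Z f g).f p ≫ bdryOuter Z i j p ≫
        iteratedι Z (i - 1) j p q') := by
  unfold awTerm
  rw [Category.assoc, iteratedι_d Z i j p q q' h hq, Preadditive.comp_add, Preadditive.comp_add,
    Preadditive.comp_zsmul, Preadditive.comp_zsmul, HomologicalComplex.Hom.comm_assoc]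

/-- The part of the boundary of `awTerm` in the second simplicial direction. -/
lemma awTerm_bdry (Z : SimplicialObject (SimplicialObject (ChainComplex A ℕ))) {n i j : ℕ}
    (f : ⦋i⦌ ⟶ ⦋n⦌) (g : ⦋j + 1⦌ ⟶ ⦋n⦌) (p q : ℕ) :
    (biMap Z f g).f p ≫ bdry (Z.obj (op ⦋i⦌)) (j + 1) p ≫ iteratedι Z i j p q =
      ∑ l : Fin (j + 2), ((-1 : ℤ) ^ (l : ℕ)) • awTerm Z f (SimplexCategory.δ l ≫ g) p q := by
  have h : bdry (Z.obj (op ⦋i⦌)) (j + 1) p = ∑ l : Fin (j + 2), ((-1 : ℤ) ^ (l : ℕ)) •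
      (biMap Z (𝟙 ⦋i⦌) (SimplexCategory.δ l)).f p := by
    rw [bdry_succ]
    refine Finset.sum_congr rfl fun l _ => ?_
    congr 2
    unfold biMap
    rw [op_id, Z.map_id, NatTrans.id_app, Category.comp_id]
    rfl
  rw [h, Preadditive.sum_comp, Preadditive.comp_sum]
  refine Finset.sum_congr rfl fun l _ => ?_
  rw [Preadditive.zsmul_comp, Preadditive.comp_zsmul, ← Category.assoc,
    ← HomologicalComplex.comp_f, biMap_comp, Category.id_comp]
  rfl

/-- The part of the boundary of `awTerm` in the first simplicial direction. -/
lemma awTerm_bdryOuter (Z : SimplicialObject (SimplicialObject (ChainComplex A ℕ))) {n i j : ℕ}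
    (f : ⦋i + 1⦌ ⟶ ⦋n⦌) (g : ⦋j⦌ ⟶ ⦋n⦌) (p q : ℕ) :
    (biMap Z f g).f p ≫ bdryOuter Z (i + 1) j p ≫ iteratedι Z i j p q =
      ∑ l : Fin (i + 2), ((-1 : ℤ) ^ (l : ℕ)) • awTerm Z (SimplexCategory.δ l ≫ f) g p q := by
  have h : bdryOuter Z (i + 1) j p = ∑ l : Fin (i + 2), ((-1 : ℤ) ^ (l : ℕ)) •
      (biMap Z (SimplexCategory.δ l) (𝟙 ⦋j⦌)).f p := by
    rw [bdryOuter_succ]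
    refine Finset.sum_congr rfl fun l _ => ?_
    congr 2
    unfold biMap
    rw [op_id, CategoryTheory.Functor.map_id, Category.id_comp]
    rfl
  rw [h, Preadditive.sum_comp, Preadditive.comp_sum]
  refine Finset.sum_congr rfl fun l _ => ?_
  rw [Preadditive.zsmul_comp, Preadditive.comp_zsmul, ← Category.assoc,
    ← HomologicalComplex.comp_f, biMap_comp, Category.id_comp]
  rfl

lemma front_apply (n j : ℕ) (x : Fin (j + 1)) :
    ((SimplexCategory.Hom.toOrderHom (front n j) x : Fin (n + 1)) : ℕ) = min x.1 n := rfl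

lemma back_apply (n i : ℕ) (x : Fin (i + 1)) :
    ((SimplexCategory.Hom.toOrderHom (back n i) x : Fin (n + 1)) : ℕ) = n - (i - x.1) := rfl

lemma δ_apply (n : ℕ) (k : Fin (n + 2)) (x : Fin (n + 1)) :
    ((SimplexCategory.Hom.toOrderHom (SimplexCategory.δ k) x : Fin (n + 2)) : ℕ) =
      if x.1 < k.1 then x.1 else x.1 + 1 := by
  change ((k.succAbove x : Fin (n + 2)) : ℕ) = _
  rw [Fin.succAbove]
  split_ifs with h1 h2 h2
  · rfl
  · exact absurd h1 h2
  · exact absurd h2 h1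
  · rfl

lemma hom_ext_val {n m : ℕ} {f g : ⦋n⦌ ⟶ ⦋m⦌}
    (h : ∀ x : Fin (n + 1), ((SimplexCategory.Hom.toOrderHom f x : Fin (m + 1)) : ℕ) =
      ((SimplexCategory.Hom.toOrderHom g x : Fin (m + 1)) : ℕ)) : f = g := by
  ext x : 3
  exact Fin.ext (h x)

lemma comp_apply {n m l : ℕ} (f : ⦋n⦌ ⟶ ⦋m⦌) (g : ⦋m⦌ ⟶ ⦋l⦌) (x : Fin (n + 1)) :
    SimplexCategory.Hom.toOrderHom (f ≫ g) x =
      SimplexCategory.Hom.toOrderHom g (SimplexCategory.Hom.toOrderHom f x) := rfl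

lemma δ_last_front (j i : ℕ) :
    SimplexCategory.δ (Fin.last (j + 1)) ≫ front (j + i + 1) (j + 1) = front (j + i + 1) j := by
  refine hom_ext_val fun x => ?_
  have hx := x.2
  simp only [comp_apply, δ_apply, front_apply, back_apply, Fin.val_last, Fin.val_zero,
    Fin.val_castSucc, Fin.val_succ]
  grind

lemma δ_zero_back (j i : ℕ) :
    SimplexCategory.δ 0 ≫ back (j + i + 1) (i + 1) = back (j + i + 1) i := by
  refine hom_ext_val fun x => ?_
  have hx := x.2
  simp only [comp_apply, δ_apply, front_apply, back_apply, Fin.val_last, Fin.val_zero,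
    Fin.val_castSucc, Fin.val_succ]
  grind

lemma front_δ_low (j i : ℕ) (l : Fin (j + 1)) (k : Fin (j + i + 2)) (hk : (k : ℕ) = l) :
    front (j + i) j ≫ SimplexCategory.δ k =
      SimplexCategory.δ l.castSucc ≫ front (j + i + 1) (j + 1) := by
  refine hom_ext_val fun x => ?_
  have hx := x.2
  simp only [comp_apply, δ_apply, front_apply, back_apply, Fin.val_last, Fin.val_zero,
    Fin.val_castSucc, Fin.val_succ]
  grind

lemma back_δ_low (j i : ℕ) (l : Fin (j + 1)) (k : Fin (j + i + 2)) (hk : (k : ℕ) = l) :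
    back (j + i) i ≫ SimplexCategory.δ k = back (j + i + 1) i := by
  refine hom_ext_val fun x => ?_
  have hx := x.2
  simp only [comp_apply, δ_apply, front_apply, back_apply, Fin.val_last, Fin.val_zero,
    Fin.val_castSucc, Fin.val_succ]
  grind

lemma front_δ_high (j i : ℕ) (l : Fin (i + 1)) (k : Fin (j + i + 2)) (hk : (k : ℕ) = j + 1 + l) :
    front (j + i) j ≫ SimplexCategory.δ k = front (j + i + 1) j := by
  refine hom_ext_val fun x => ?_
  have hx := x.2
  simp only [comp_apply, δ_apply, front_apply, back_apply, Fin.val_last, Fin.val_zero,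
    Fin.val_castSucc, Fin.val_succ]
  grind

lemma back_δ_high (j i : ℕ) (l : Fin (i + 1)) (k : Fin (j + i + 2)) (hk : (k : ℕ) = j + 1 + l) :
    back (j + i) i ≫ SimplexCategory.δ k =
      SimplexCategory.δ l.succ ≫ back (j + i + 1) (i + 1) := by
  refine hom_ext_val fun x => ?_
  have hx := x.2
  simp only [comp_apply, δ_apply, front_apply, back_apply, Fin.val_last, Fin.val_zero,
    Fin.val_castSucc, Fin.val_succ]
  grind

/-- The cancellation which shows that the Alexander-Whitney map is compatible with the
differentials. -/
lemma aw_cancel (Z : SimplicialObject (SimplicialObject (ChainComplex A ℕ))) (j i p q : ℕ) :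
    ∑ k : Fin (j + i + 2), ((-1 : ℤ) ^ (k : ℕ)) •
        awTerm Z (back (j + i) i ≫ SimplexCategory.δ k) (front (j + i) j ≫ SimplexCategory.δ k) p q =
      ∑ l : Fin (j + 2), ((-1 : ℤ) ^ (l : ℕ)) •
        awTerm Z (back (j + i + 1) i) (SimplexCategory.δ l ≫ front (j + i + 1) (j + 1)) p q +
      ((-1 : ℤ) ^ j) • ∑ l : Fin (i + 2), ((-1 : ℤ) ^ (l : ℕ)) •
        awTerm Z (SimplexCategory.δ l ≫ back (j + i + 1) (i + 1)) (front (j + i + 1) j) p q := by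
  have e : (j + 1) + (i + 1) = j + i + 2 := by omega
  rw [Fin.sum_univ_castSucc (n := j + 1), Fin.sum_univ_succ (n := i + 1), δ_last_front, δ_zero_back,
    ← (finCongr e).sum_comp, Fin.sum_univ_add, smul_add, Finset.smul_sum]
  have h1 : ∀ l : Fin (j + 1), ((-1 : ℤ) ^ ((finCongr e (Fin.castAdd (i + 1) l) : _) : ℕ)) •
      awTerm Z (back (j + i) i ≫ SimplexCategory.δ (finCongr e (Fin.castAdd (i + 1) l)))
        (front (j + i) j ≫ SimplexCategory.δ (finCongr e (Fin.castAdd (i + 1) l))) p q =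
      ((-1 : ℤ) ^ (l.castSucc : ℕ)) • awTerm Z (back (j + i + 1) i)
        (SimplexCategory.δ l.castSucc ≫ front (j + i + 1) (j + 1)) p q := by
    intro l
    rw [back_δ_low j i l _ (by simp), front_δ_low j i l _ (by simp)]
    simp
  have h2 : ∀ l : Fin (i + 1), ((-1 : ℤ) ^ ((finCongr e (Fin.natAdd (j + 1) l) : _) : ℕ)) •
      awTerm Z (back (j + i) i ≫ SimplexCategory.δ (finCongr e (Fin.natAdd (j + 1) l)))
        (front (j + i) j ≫ SimplexCategory.δ (finCongr e (Fin.natAdd (j + 1) l))) p q =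
      ((-1 : ℤ) ^ j) • ((-1 : ℤ) ^ (l.succ : ℕ)) • awTerm Z
        (SimplexCategory.δ l.succ ≫ back (j + i + 1) (i + 1)) (front (j + i + 1) j) p q := by
    intro l
    rw [back_δ_high j i l _ (by simp), front_δ_high j i l _ (by simp), smul_smul, ← pow_add]
    congr 2
    simp
    omega
  rw [Finset.sum_congr rfl (fun l _ => h1 l), Finset.sum_congr rfl (fun l _ => h2 l)]
  simp only [Fin.val_last, Fin.val_zero, pow_zero, one_smul, pow_succ, mul_neg, mul_one, neg_smul]
  abel

lemma diagι_awHom (Z : SimplicialObject (SimplicialObject (ChainComplex A ℕ))) (n p q : ℕ)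
    (h : p + n = q) :
    diagι Z n p q ≫ awHom Z q =
      ∑ x ∈ Finset.HasAntidiagonal.antidiagonal n, awTerm Z (back n x.2) (front n x.1) p q := by
  unfold diagι
  rw [simpleι₀_eq _ _ _ _ h]
  exact simpleι_desc _ n p h

lemma diagι_awHom_assoc (Z : SimplicialObject (SimplicialObject (ChainComplex A ℕ))) (n p q : ℕ)
    (h : p + n = q) {M : A} (φ : ((iterated (simple A)).obj Z).X q ⟶ M) :
    diagι Z n p q ≫ awHom Z q ≫ φ =
      (∑ x ∈ Finset.HasAntidiagonal.antidiagonal n,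
        awTerm Z (back n x.2) (front n x.1) p q) ≫ φ := by
  rw [← Category.assoc, diagι_awHom Z n p q h]

lemma awHom_comm (Z : SimplicialObject (SimplicialObject (ChainComplex A ℕ))) (q q' : ℕ)
    (hq : q' + 1 = q) :
    awHom Z q ≫ ((iterated (simple A)).obj Z).d q q' =
      ((diag _ ⋙ simple A).obj Z).d q q' ≫ awHom Z q' := by
  refine diag_hom_ext fun n p h => ?_
  rw [← Category.assoc (f := diagι Z n p q) (g := ((diag _ ⋙ simple A).obj Z).d q q'),
    diagι_d Z n p q q' h hq, diagι_awHom_assoc Z n p q h, Preadditive.sum_comp,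
    Preadditive.add_comp, Preadditive.zsmul_comp, Category.assoc, Category.assoc]
  have h3 : ∀ x ∈ Finset.HasAntidiagonal.antidiagonal n, _ := fun x hx =>
    awTerm_d Z (back n x.2) (front n x.1) p q q'
      (by rw [Finset.HasAntidiagonal.mem_antidiagonal] at hx; omega) hq
  rw [Finset.sum_congr rfl h3, Finset.sum_add_distrib, Finset.sum_add_distrib, add_assoc]
  congr 1
  · cases p with
    | zero =>
      rw [HomologicalComplex.shape _ 0 (0 - 1) (by simp), zero_comp]
      exact Finset.sum_eq_zero fun x _ => zero_comp
    | succ p =>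
      rw [diagι_awHom _ _ _ _ (by omega), Preadditive.comp_sum]
  · cases n with
    | zero =>
      rw [Finset.Nat.antidiagonal_zero, Finset.sum_singleton, Finset.sum_singleton, bdry_zero,
        diagBdry_zero, bdryOuter_zero]
      simp
    | succ m =>
      rw [Finset.Nat.sum_antidiagonal_succ, Finset.Nat.sum_antidiagonal_succ', bdry_zero,
        bdryOuter_zero, zero_comp, comp_zero, smul_zero, zero_add, zero_comp, comp_zero, smul_zero,
        zero_add, show diagι Z (m + 1 - 1) p q' ≫ awHom Z q' = _ from
          diagι_awHom Z m p q' (by omega), diagBdry_succ, Preadditive.comp_sum, Finset.smul_sum,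
        ← Finset.sum_add_distrib]
      refine Finset.sum_congr rfl fun x hx => ?_
      obtain ⟨j, i⟩ := x
      obtain rfl : j + i = m := by simpa using hx
      have h4 := aw_cancel Z j i p q'
      have h5 := awTerm_bdry Z (back (j + i + 1) i) (front (j + i + 1) (j + 1)) p q'
      have h6 := awTerm_bdryOuter Z (back (j + i + 1) (i + 1)) (front (j + i + 1) j) p q'
      rw [← h5, ← h6] at h4
      rw [Preadditive.sum_comp]
      simp only [Preadditive.zsmul_comp]
      have h7 : ∀ k ∈ (Finset.univ : Finset (Fin (j + i + 2))), ((-1 : ℤ) ^ (k : ℕ)) •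
          ((biMap Z (SimplexCategory.δ k) (SimplexCategory.δ k)).f p ≫
            awTerm Z (back (j + i) i) (front (j + i) j) p q') = _ := fun k _ =>
        congr_arg (fun φ => ((-1 : ℤ) ^ (k : ℕ)) • φ) (biMap_awTerm Z (SimplexCategory.δ k)
          (back (j + i) i) (front (j + i) j) p q')
      have h8 := (Finset.sum_congr rfl h7).trans h4
      refine Eq.trans ?_ (congr_arg (fun φ => ((-1 : ℤ) ^ p) • φ) h8.symm)
      rw [smul_add, smul_smul, ← pow_add]
      rfl

/-- The Alexander-Whitney map `μ_Z : s D Z ⟶ s s Z`, as a natural transformation. -/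
def alexanderWhitney (A : Type u) [Category.{v} A] [Preadditive A] [HasFiniteBiproducts A] :
    diag (ChainComplex A ℕ) ⋙ simple A ⟶ iterated (simple A) where
  app Z :=
    { f := awHom Z
      comm' := fun q q' hq => awHom_comm Z q q' hq }
  naturality Z Z' α := by
    ext q
    refine diag_hom_ext fun n p h => ?_
    have h1 := diagι_map α n p q
    change diagι Z n p q ≫ ((diag _ ⋙ simple A).map α).f q ≫ awHom Z' q =
      diagι Z n p q ≫ awHom Z q ≫ ((iterated (simple A)).map α).f q
    rw [diagι_awHom_assoc _ _ _ _ h, ← Category.assoc, h1, Category.assoc, diagι_awHom _ _ _ _ h,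
      Preadditive.sum_comp, Preadditive.comp_sum]
    refine Finset.sum_congr rfl fun x _ => ?_
    have h2 := biMap_naturality α (back n x.2) (front n x.1)
    have h3 := congr_arg (fun φ => HomologicalComplex.Hom.f φ p) h2
    dsimp only [HomologicalComplex.comp_f] at h3
    unfold awTerm
    rw [Category.assoc, iteratedι_map, ← Category.assoc, h3, Category.assoc]

/-- The inclusion of the summand `B_p` of simplicial degree `n` of `s (B × Δ)_q` if `p + n = q`,
and `0` otherwise. -/
def constι (B : ChainComplex A ℕ) (n p q : ℕ) :
    B.X p ⟶ ((SimplicialObject.const _ ⋙ simple A).obj B).X q :=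
  simpleι₀ ((SimplicialObject.const _).obj B) n p q

/-- The boundary map `∂` of `B × Δ`. -/
def constBdry (B : ChainComplex A ℕ) (n p : ℕ) : B.X p ⟶ B.X p :=
  bdry ((SimplicialObject.const _).obj B) n p

lemma constBdry_zero (B : ChainComplex A ℕ) (p : ℕ) : constBdry B 0 p = 0 := bdry_zero _ _

lemma constBdry_one (B : ChainComplex A ℕ) (p : ℕ) : constBdry B 1 p = 0 := by
  have h : constBdry B 1 p = ∑ i : Fin (0 + 2), ((-1 : ℤ) ^ (i : ℕ)) • 𝟙 (B.X p) :=
    bdry_succ ((SimplicialObject.const _).obj B) 0 p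
  rw [h]
  simp [Fin.sum_univ_two]

lemma constι_d (B : ChainComplex A ℕ) (n p q q' : ℕ)
    (h : p + n = q) (hq : q' + 1 = q) :
    constι B n p q ≫ ((SimplicialObject.const _ ⋙ simple A).obj B).d q q' =
      B.d p (p - 1) ≫ constι B n (p - 1) q' +
      ((-1 : ℤ) ^ p) • (constBdry B n p ≫ constι B (n - 1) p q') := by
  have h1 := simpleι_d ((SimplicialObject.const _).obj B) n p q q' h hq
  rw [← simpleι₀_eq] at h1
  exact h1

lemma constι_map {B B' : ChainComplex A ℕ} (f : B ⟶ B') (n p q : ℕ) :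
    constι B n p q ≫ ((SimplicialObject.const _ ⋙ simple A).map f).f q =
      f.f p ≫ constι B' n p q :=
  simpleι₀_map ((SimplicialObject.const _).map f) n p q

lemma const_hom_ext {B : ChainComplex A ℕ} {q : ℕ} {M : A}
    {f g : ((SimplicialObject.const _ ⋙ simple A).obj B).X q ⟶ M}
    (h : ∀ n p : ℕ, p + n = q → constι B n p q ≫ f = constι B n p q ≫ g) : f = g := by
  refine simple_hom_ext (X := (SimplicialObject.const _).obj B) fun n p hn => ?_
  have h1 := h n p hn
  unfold constι at h1
  rw [simpleι₀_eq _ _ _ _ hn] at h1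
  exact h1

/-- The component of degree `q` of `λ_B`: the projection of `s (B × Δ)_q` onto its summand `B_q`
of simplicial degree `0`. -/
def lamHom (B : ChainComplex A ℕ) (q : ℕ) :
    ((SimplicialObject.const _ ⋙ simple A).obj B).X q ⟶ B.X q :=
  simpleDesc (X := (SimplicialObject.const _).obj B) fun n p h =>
    if hn : n = 0 then (B.XIsoOfEq (show p = q by omega)).hom else 0

lemma constι_lamHom_zero (B : ChainComplex A ℕ) (q : ℕ) :
    constι B 0 q q ≫ lamHom B q = 𝟙 _ := by
  unfold constι
  rw [simpleι₀_eq _ _ _ _ (by omega)]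
  exact (simpleι_desc _ 0 q (by omega)).trans (by simp)

lemma constι_lamHom_pos (B : ChainComplex A ℕ) (n p q : ℕ) (hn : n ≠ 0) :
    constι B n p q ≫ lamHom B q = 0 := by
  unfold constι simpleι₀
  split_ifs with h
  · exact (simpleι_desc _ n p h).trans (dif_neg hn)
  · exact zero_comp

lemma lamHom_comm (B : ChainComplex A ℕ) (q q' : ℕ) (hq : q' + 1 = q) :
    lamHom B q ≫ B.d q q' =
      ((SimplicialObject.const _ ⋙ simple A).obj B).d q q' ≫ lamHom B q' := by
  refine const_hom_ext fun n p h => ?_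
  rw [← Category.assoc, ← Category.assoc, constι_d B n p q q' h hq, Preadditive.add_comp,
    Preadditive.zsmul_comp, Category.assoc, Category.assoc]
  rcases n with _ | _ | n
  · obtain rfl : p = q := by omega
    obtain rfl : q' = p - 1 := by omega
    rw [constι_lamHom_zero, constBdry_zero, zero_comp, zero_comp, smul_zero, add_zero,
      Category.comp_id, ← Category.assoc, constι_lamHom_zero, Category.id_comp]
  · rw [← Category.assoc, constι_lamHom_pos B (0 + 1) p q (by omega),
      constι_lamHom_pos B (0 + 1) (p - 1) q' (by omega), constBdry_one]
    simp
  · rw [← Category.assoc, constι_lamHom_pos B (n + 1 + 1) p q (by omega),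
      constι_lamHom_pos B (n + 1 + 1) (p - 1) q' (by omega), Category.assoc,
      constι_lamHom_pos B (n + 1 + 1 - 1) p q' (by omega)]
    simp

/-- The natural transformation `λ : s (- × Δ) ⟶ Id` of chain complexes. -/
def lamChain (A : Type u) [Category.{v} A] [Preadditive A] [HasFiniteBiproducts A] :
    SimplicialObject.const (ChainComplex A ℕ) ⋙ simple A ⟶ 𝟭 (ChainComplex A ℕ) where
  app B :=
    { f := lamHom B
      comm' := fun q q' hq => lamHom_comm B q q' hq }
  naturality B B' f := by
    ext q
    refine const_hom_ext fun n p h => ?_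
    change constι B n p q ≫ ((SimplicialObject.const _ ⋙ simple A).map f).f q ≫ lamHom B' q =
      constι B n p q ≫ lamHom B q ≫ f.f q
    rw [← Category.assoc, ← Category.assoc, constι_map, Category.assoc]
    by_cases hn : n = 0
    · subst hn
      obtain rfl : p = q := by omega
      rw [constι_lamHom_zero, constι_lamHom_zero, Category.comp_id, Category.id_comp]
    · rw [constι_lamHom_pos _ _ _ _ hn, constι_lamHom_pos _ _ _ _ hn, comp_zero, zero_comp]

/-- The data `(E, s, μ, λ)` on the category `Ch₊(A)` of positive chain complexes, for a class of
equivalences `E`: `s` is the total complex, `μ` is given by the Alexander-Whitney map. -/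
def chainData (A : Type u) [Category.{v} A] [Preadditive A] [HasFiniteBiproducts A]
    (E : MorphismProperty (ChainComplex A ℕ)) : DescentData (ChainComplex A ℕ) where
  E := E
  s := simple A
  μ := (funQ E _).map (alexanderWhitney A)
  lam := lamChain A

/-- `_H Ch₊(A)`: the equivalences are the homotopy equivalences. -/
def chainH (A : Type u) [Category.{v} A] [Preadditive A] [HasFiniteBiproducts A] :
    DescentData (ChainComplex A ℕ) :=
  chainData A (HomologicalComplex.homotopyEquivalences A (ComplexShape.down ℕ))

instance instHasFiniteBiproductsAbelian (A : Type u) [Category.{v} A] [Abelian A] :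
    HasFiniteBiproducts A :=
  Abelian.hasFiniteBiproducts

instance instHasFiniteCoproductsChainComplex : HasFiniteCoproducts (ChainComplex A ℕ) :=
  ⟨fun n => inferInstanceAs (HasColimitsOfShape (Discrete (Fin n))
    (HomologicalComplex A (ComplexShape.down ℕ)))⟩

instance instHasTerminalChainComplex : HasTerminal (ChainComplex A ℕ) :=
  inferInstanceAs (HasLimitsOfShape (Discrete PEmpty) (HomologicalComplex A (ComplexShape.down ℕ)))

/-- `_Q Ch₊(A)`: the equivalences are the quasi-isomorphisms. -/
def chainQ (A : Type u) [Category.{v} A] [Abelian A] : DescentData (ChainComplex A ℕ) :=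
  chainData A (HomologicalComplex.quasiIso A (ComplexShape.down ℕ))

end ChainComplexes

/-! ### Simplicial objects in additive and abelian categories -/

section SimplicialObjects

/-- The identity transformation `s D ⟶ s s` for `s = D`: both functors send a trisimplicial
object `Z` to the simplicial object `n ↦ Z_{n,n,n}`. -/
def muDiag (A : Type u) [Category.{v} A] :
    diag (SimplicialObject A) ⋙ diag A ⟶ iterated (diag A) where
  app Z :=
    { app := fun n => 𝟙 (((Z.obj n).obj n).obj n)
      naturality := fun n m f => by
        have h := (Z.map f).naturality f
        have h1 := congr_arg (fun φ => NatTrans.app φ m) h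
        dsimp only [NatTrans.comp_app] at h1
        change (((Z.obj n).obj n).map f ≫ ((Z.obj n).map f ≫ (Z.map f).app m).app m) ≫ 𝟙 _ =
          𝟙 _ ≫ (((Z.obj n).obj n).map f ≫ ((Z.obj n).map f).app m) ≫ ((Z.map f).app m).app m
        simp only [Category.comp_id, Category.id_comp, Category.assoc, NatTrans.comp_app] }
  naturality Z Z' α := by
    ext n
    change ((α.app n).app n).app n ≫ 𝟙 _ = 𝟙 _ ≫ ((α.app n).app n).app n
    simp only [Category.comp_id, Category.id_comp]

/-- The data `(E, D, μ, λ)` on the category of simplicial objects of `A`, for a class of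
equivalences `E`: the simple functor is the diagonal, and `μ` and `λ` are the identities. -/
def simplicialData (A : Type u) [Category.{v} A] (E : MorphismProperty (SimplicialObject A)) :
    DescentData (SimplicialObject A) where
  E := E
  s := diag A
  μ := (funQ E _).map (muDiag A)
  lam := (diagConstOuter A).hom

/-- The class of simplicial homotopy equivalences. -/
def simplicialHomotopyEquivalences (A : Type u) [Category.{v} A] :
    MorphismProperty (SimplicialObject A) := fun X Y f =>
  ∃ g : Y ⟶ X, Nonempty (SimplicialObject.Homotopy (f ≫ g) (𝟙 X)) ∧
    Nonempty (SimplicialObject.Homotopy (g ≫ f) (𝟙 Y))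

/-- The class of quasi-isomorphisms: the morphisms of simplicial objects that induce isomorphisms
on the homology of the associated chain complexes. -/
def simplicialQuasiIso (A : Type u) [Category.{v} A] [Abelian A] :
    MorphismProperty (SimplicialObject A) :=
  (HomologicalComplex.quasiIso A (ComplexShape.down ℕ)).inverseImage
    (AlgebraicTopology.alternatingFaceMapComplex A)

/-- `_H ΔᵒᵖA`: the equivalences are the simplicial homotopy equivalences. -/
def simplicialH (A : Type u) [Category.{v} A] : DescentData (SimplicialObject A) :=
  simplicialData A (simplicialHomotopyEquivalences A)

/-- `_Q ΔᵒᵖA`: the equivalences are the quasi-isomorphisms. -/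
def simplicialQ (A : Type u) [Category.{v} A] [Abelian A] : DescentData (SimplicialObject A) :=
  simplicialData A (simplicialQuasiIso A)

end SimplicialObjects

end SimplicialDescent

end

/-! Both halves are one theorem with a parameter `J`, a class of morphisms of `A` along which test
objects may be refined. `localQis J f` says that every cycle of the mapping cone of `f` with values
in an object `T` becomes a boundary after pulling back along some `T' ⟶ T` in `J`. For the
epimorphisms of an abelian category these are the quasi-isomorphisms (`quasiIso_iff_localQis`). For
the isomorphisms of an additive category they are the chain homotopy equivalences
(`homotopyEquivalences_iff_localQis`), because the condition can be applied to identity maps. The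
rest of the argument only uses that `J` contains identities and is closed under composition.

The homological tool is `SplitFiltration.localQis`: a filtered map between degreewise split filtered
complexes is an equivalence if it is one on graded pieces. Applied to the columns and to the rows of
a total complex, it shows that `simple` preserves levelwise equivalences and simplicial homotopy
equivalences.

The Alexander–Whitney map and the comparison `cmp : K D ⟶ s K` are equivalences by
`localQis_of_const`, a form of acyclic models. An object `Z` is resolved by the bisimplicial object
`(k, n) ↦ Z ([k] * [n])`. For fixed `k` this contracts simplicially onto the constant object `Z_k`,
so a transformation which is an equivalence on constant objects is one on every column. In the
direction of `k` it contracts onto `Z` by maps that are not natural in `n`; they still act on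
functors whose components only see the underlying graded object, which is the role of
`LevelwiseFunctoriality`. On constant objects, the composition of the transformation with `λ` is an
isomorphism, and `λ` has an explicit homotopy inverse. A natural transformation with components in
`E` becomes invertible in the localized functor category, which gives `μ` and `Θ`.

For the cone axiom, `X ⊔ X ⟶ Cyl X ⊕ (Y ⊔ *)` has the cone as cokernel, and the sequence splits in
each simplicial degree. A shear and the homotopy equivalence `Cyl X ⟶ X` turn the first map into `𝟙
⊕ f`. Symmetry comes from an isomorphism `s Υ X ≅ s X` given by signs.

The axioms for simplicial objects reduce to chain complexes through `cmp`. In the additive case it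
remains to see that `K` detects simplicial homotopy equivalences
(`simplicialHomotopyEquivalences_iff`): a chain homotopy defines a chain map `K (Cyl X) ⟶ K Y`,
which the Dold–Kan correspondence replaces by a simplicial map. -/

noncomputable section

namespace SimplicialDescent

/-! ### Quasi-isomorphisms and homotopy equivalences as one notion -/

section LocalQuasiIso

variable {A : Type u} [Category.{v} A] [Preadditive A]

/-- A chain map `f : C ⟶ D` such that the mapping cone of `f` has no generalized homology
classes: every cycle `(x, y)` of the cone with values in `T` is, up to a refinement `T' ⟶ T`
in `J`, the boundary of some `(x', y')`. -/
def localQis (J : MorphismProperty A) : MorphismProperty (ChainComplex A ℕ) := fun C D f =>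
  -- For `m = 0` the truncated `m - 1` is again `0`, although the cone has no component from `C`
  -- there; the condition `m = 0 → x = 0` restores this.
  ∀ (m : ℕ) ⦃T : A⦄ (x : T ⟶ C.X (m - 1)) (y : T ⟶ D.X m), (m = 0 → x = 0) →
    x ≫ C.d (m - 1) (m - 1 - 1) = 0 → x ≫ f.f (m - 1) = y ≫ D.d m (m - 1) →
    ∃ (T' : A) (π : T' ⟶ T) (_ : J π) (x' : T' ⟶ C.X m) (y' : T' ⟶ D.X (m + 1)),
      x' ≫ C.d m (m - 1) = π ≫ x ∧ x' ≫ f.f m = π ≫ y + y' ≫ D.d (m + 1) m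

/-- Injectivity on generalized homology classes, up to refinements in `J`. -/
def localInj (J : MorphismProperty A) : MorphismProperty (ChainComplex A ℕ) := fun C D f =>
  ∀ (m : ℕ) ⦃T : A⦄ (x : T ⟶ C.X m) (y : T ⟶ D.X (m + 1)),
    x ≫ C.d m (m - 1) = 0 → x ≫ f.f m = y ≫ D.d (m + 1) m →
    ∃ (T' : A) (π : T' ⟶ T) (_ : J π) (x' : T' ⟶ C.X (m + 1)), x' ≫ C.d (m + 1) m = π ≫ x

/-- Surjectivity on generalized homology classes, up to refinements in `J`. -/
def localSurj (J : MorphismProperty A) : MorphismProperty (ChainComplex A ℕ) := fun C D f =>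
  ∀ (m : ℕ) ⦃T : A⦄ (y : T ⟶ D.X m), y ≫ D.d m (m - 1) = 0 →
    ∃ (T' : A) (π : T' ⟶ T) (_ : J π) (x : T' ⟶ C.X m) (y' : T' ⟶ D.X (m + 1)),
      x ≫ C.d m (m - 1) = 0 ∧ x ≫ f.f m = π ≫ y + y' ≫ D.d (m + 1) m

variable (J : MorphismProperty A)

lemma localQis.localInj {J : MorphismProperty A} {C D : ChainComplex A ℕ} {f : C ⟶ D}
    (hf : localQis J f) : localInj J f := fun m T x y hx hxy => by
  obtain ⟨T', π, hπ, x', y', h, -⟩ := hf (m + 1) x y (by simp) hx hxy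
  exact ⟨T', π, hπ, x', h⟩

lemma localQis.localSurj {J : MorphismProperty A} {C D : ChainComplex A ℕ} {f : C ⟶ D}
    (hf : localQis J f) : localSurj J f := fun m T y hy => by
  obtain ⟨T', π, hπ, x', y', h, h'⟩ := hf m 0 y (by simp) (by simp) (by simp [hy])
  exact ⟨T', π, hπ, x', y', by simpa using h, h'⟩

/-- Injectivity makes `x` the boundary of some `x₁`; then `y - x₁ ≫ f` is a cycle, to which
surjectivity applies. The two refinements are made in succession and composed. -/
lemma localQis_of_inj_of_surj [J.IsMultiplicative] {C D : ChainComplex A ℕ} {f : C ⟶ D}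
    (hi : localInj J f) (hs : localSurj J f) : localQis J f := fun m T x y h0 hx hxy => by
  have h1 : ∃ (T' : A) (π : T' ⟶ T) (_ : J π) (x' : T' ⟶ C.X m), x' ≫ C.d m (m - 1) = π ≫ x := by
    cases m with
    | zero => exact ⟨T, 𝟙 T, J.id_mem T, 0, by simp [h0]⟩
    | succ m => exact hi m x y hx hxy
  obtain ⟨T₁, π₁, hπ₁, x₁, hx₁⟩ := h1
  obtain ⟨T₂, π₂, hπ₂, x₂, y₂, hx₂, hxy₂⟩ := hs m (π₁ ≫ y - x₁ ≫ f.f m) (by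
    rw [Preadditive.sub_comp, Category.assoc, Category.assoc, ← hxy, f.comm, reassoc_of% hx₁,
      sub_self])
  refine ⟨T₂, π₂ ≫ π₁, J.comp_mem _ _ hπ₂ hπ₁, π₂ ≫ x₁ + x₂, y₂, ?_, ?_⟩
  · simp [hx₁, hx₂]
  · rw [Preadditive.add_comp, hxy₂]
    simp only [Category.assoc, Preadditive.comp_sub]
    abel

/-- Local quasi-isomorphisms compose. -/
lemma localQis.comp [J.IsMultiplicative] {C D E : ChainComplex A ℕ} {f : C ⟶ D} {g : D ⟶ E}
    (hf : localQis J f) (hg : localQis J g) : localQis J (f ≫ g) := by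
  refine localQis_of_inj_of_surj J (fun m T x y hx hxy => ?_) (fun m T y hy => ?_)
  · obtain ⟨T₁, π₁, hπ₁, x₁, hx₁⟩ := hg.localInj m (x ≫ f.f m) y
      (by rw [Category.assoc, f.comm, reassoc_of% hx, zero_comp]) (by simpa using hxy)
    obtain ⟨T₂, π₂, hπ₂, x₂, hx₂⟩ := hf.localInj m (π₁ ≫ x) x₁
      (by rw [Category.assoc, hx, comp_zero]) (by simp [hx₁])
    exact ⟨T₂, π₂ ≫ π₁, J.comp_mem _ _ hπ₂ hπ₁, x₂, by simp [hx₂]⟩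
  · obtain ⟨T₁, π₁, hπ₁, x₁, y₁, hx₁, hy₁⟩ := hg.localSurj m y hy
    obtain ⟨T₂, π₂, hπ₂, x₂, y₂, hx₂, hy₂⟩ := hf.localSurj m x₁ hx₁
    refine ⟨T₂, π₂ ≫ π₁, J.comp_mem _ _ hπ₂ hπ₁, x₂, π₂ ≫ y₁ + y₂ ≫ g.f (m + 1), hx₂, ?_⟩
    rw [HomologicalComplex.comp_f, reassoc_of% hy₂]
    simp [hy₁, add_assoc]

/-- In an abelian category, whether a map on homology is mono or epi is tested on generalized
elements up to epimorphic refinement. `localInj` and `localSurj` are these two tests. -/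
lemma quasiIso_iff_localQis {B : Type u} [Category.{v} B] [Abelian B] {C D : ChainComplex B ℕ}
    (f : C ⟶ D) : QuasiIso f ↔ localQis (MorphismProperty.epimorphisms B) f := by
  have hnext : ∀ m : ℕ, (ComplexShape.down ℕ).next m = m - 1 := fun m => by
    cases m <;> simp
  have hprev : ∀ m : ℕ, (ComplexShape.down ℕ).prev m = m + 1 := fun m => by simp
  constructor
  · intro hf
    refine localQis_of_inj_of_surj _ (fun m T x y hx hxy => ?_) (fun m T y hy => ?_)
    · have : IsIso (HomologicalComplex.homologyMap f m) := inferInstance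
      obtain ⟨T', π, hπ, x', hx'⟩ := (HomologicalComplex.mono_homologyMap_iff_up_to_refinements f
        (m + 1) m (m - 1) (hprev m) (hnext m)).1 inferInstance x hx y hxy
      exact ⟨T', π, hπ, x', hx'.symm⟩
    · have : IsIso (HomologicalComplex.homologyMap f m) := inferInstance
      obtain ⟨T', π, hπ, x', hx', y', h⟩ :=
        (HomologicalComplex.epi_homologyMap_iff_up_to_refinements f
        (m + 1) m (m - 1) (hprev m) (hnext m)).1 inferInstance y hy
      exact ⟨T', π, hπ, x', -y', hx', by simp [h]⟩
  · intro hf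
    refine ⟨fun m => ?_⟩
    rw [quasiIsoAt_iff_isIso_homologyMap]
    have h1 : Mono (HomologicalComplex.homologyMap f m) :=
      (HomologicalComplex.mono_homologyMap_iff_up_to_refinements f
        (m + 1) m (m - 1) (hprev m) (hnext m)).2 fun T x hx y hxy => by
          obtain ⟨T', π, hπ, x', hx'⟩ := hf.localInj m x y hx hxy
          exact ⟨T', π, hπ, x', hx'.symm⟩
    have h2 : Epi (HomologicalComplex.homologyMap f m) :=
      (HomologicalComplex.epi_homologyMap_iff_up_to_refinements f
        (m + 1) m (m - 1) (hprev m) (hnext m)).2 fun T y hy => by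
          obtain ⟨T', π, hπ, x', y', hx', h⟩ := hf.localSurj m y hy
          exact ⟨T', π, hπ, x', hx', -y', by simp [h]⟩
    exact isIso_of_mono_of_epi _

/-- Homotopic chain maps agree on cycles up to boundaries. -/
lemma homotopy_apply_cycle {C D : ChainComplex A ℕ} {f g : C ⟶ D} (h : Homotopy f g) {m : ℕ}
    {T : A} (x : T ⟶ C.X m) (hx : x ≫ C.d m (m - 1) = 0) :
    x ≫ f.f m = x ≫ g.f m + (x ≫ h.hom m (m + 1)) ≫ D.d (m + 1) m := by
  have h1 : x ≫ dNext m h.hom = 0 := by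
    cases m with
    | zero => rw [dNext_eq_zero _ _ (by simp), comp_zero]
    | succ m => rw [dNext_eq (w := show (ComplexShape.down ℕ).Rel (m + 1) m by simp),
        reassoc_of% (show x ≫ C.d (m + 1) m = 0 from hx), zero_comp]
  rw [h.comm m, prevD_eq (w := show (ComplexShape.down ℕ).Rel (m + 1) m by simp),
    Preadditive.comp_add, Preadditive.comp_add, h1]
  simp [add_comm]

/-- The homotopies provide the bounding chains explicitly, so the identity refinement suffices. -/
lemma localQis_of_homotopyEquiv [J.IsMultiplicative] {C D : ChainComplex A ℕ}
    (e : HomotopyEquiv C D) : localQis J e.hom := by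
  refine localQis_of_inj_of_surj J (fun m T x y hx hxy => ?_) (fun m T y hy => ?_)
  · have h := homotopy_apply_cycle e.homotopyHomInvId x hx
    refine ⟨T, 𝟙 T, J.id_mem T, y ≫ e.inv.f (m + 1) - x ≫ e.homotopyHomInvId.hom m (m + 1), ?_⟩
    rw [HomologicalComplex.comp_f, reassoc_of% hxy] at h
    simp [h]
  · have h := homotopy_apply_cycle e.homotopyInvHomId y hy
    refine ⟨T, 𝟙 T, J.id_mem T, y ≫ e.inv.f m, y ≫ e.homotopyInvHomId.hom m (m + 1), ?_, ?_⟩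
    · rw [Category.assoc, e.inv.comm, reassoc_of% hy, zero_comp]
    · simpa using h

section RightInverse

variable {C D : ChainComplex A ℕ} {f : C ⟶ D}
  (hf : localQis (MorphismProperty.isomorphisms A) f)

-- A refinement along an isomorphism can be undone, so the solution is defined on `T` itself. Taking
-- `T` to be a component of `D` then produces components of a right inverse.
include hf in
lemma localQis.exists_of_isomorphisms (m : ℕ) {T : A} (x : T ⟶ C.X (m - 1)) (y : T ⟶ D.X m)
    (h0 : m = 0 → x = 0) (hx : x ≫ C.d (m - 1) (m - 1 - 1) = 0)
    (hxy : x ≫ f.f (m - 1) = y ≫ D.d m (m - 1)) :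
    ∃ (x' : T ⟶ C.X m) (y' : T ⟶ D.X (m + 1)),
      x' ≫ C.d m (m - 1) = x ∧ x' ≫ f.f m = y + y' ≫ D.d (m + 1) m := by
  obtain ⟨T', π, hπ, x', y', h1, h2⟩ := hf m x y h0 hx hxy
  have : IsIso π := hπ
  refine ⟨inv π ≫ x', inv π ≫ y', ?_, ?_⟩
  · rw [Category.assoc, h1, IsIso.inv_hom_id_assoc]
  · rw [Category.assoc, h2, Preadditive.comp_add, IsIso.inv_hom_id_assoc, Category.assoc]

/-- The possible components in degree `m` of a right inverse of `f` up to homotopy. -/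
abbrev RightInverseStage (f : C ⟶ D) (m : ℕ) :=
  { gk : (D.X m ⟶ C.X m) × (D.X m ⟶ D.X (m + 1)) //
    D.d (m + 1) m ≫ gk.1 ≫ C.d m (m - 1) = 0 ∧
    D.d (m + 1) m ≫ gk.1 ≫ f.f m = D.d (m + 1) m ≫ (𝟙 _ + gk.2 ≫ D.d (m + 1) m) }

-- The recursion starts from the tautological cycle `(0, 𝟙)` of the cone in degree `0`.
include hf in
lemma exists_rightInverseStage_zero :
    ∃ s : RightInverseStage f 0, s.1.1 ≫ f.f 0 = 𝟙 _ + s.1.2 ≫ D.d 1 0 := by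
  obtain ⟨x, y, -, h⟩ := hf.exists_of_isomorphisms 0 0 (𝟙 (D.X 0)) (by simp) (by simp) (by simp)
  exact ⟨⟨(x, y), by simp, by rw [h]⟩, h⟩

-- The two conditions stored in a stage say that `(d ≫ g, 𝟙 + d ≫ k)` is a cycle of the cone of `f`
-- in degree `m + 1`. A chain bounding it consists of the next components of the inverse and of the
-- homotopy.
include hf in
lemma exists_rightInverseStage_succ (m : ℕ) (s : RightInverseStage f m) :
    ∃ s' : RightInverseStage f (m + 1), s'.1.1 ≫ C.d (m + 1) m = D.d (m + 1) m ≫ s.1.1 ∧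
      s'.1.1 ≫ f.f (m + 1) = 𝟙 _ + D.d (m + 1) m ≫ s.1.2 + s'.1.2 ≫ D.d (m + 2) (m + 1) := by
  obtain ⟨⟨g, k⟩, h1, h2⟩ := s
  obtain ⟨x, y, h3, h4⟩ := hf.exists_of_isomorphisms (m + 1) (D.d (m + 1) m ≫ g)
    (𝟙 _ + D.d (m + 1) m ≫ k) (by simp) (by simpa using h1) (by
      change (_ ≫ _) ≫ f.f m = _ ≫ D.d (m + 1) m
      rw [Category.assoc, h2]
      simp)
  refine ⟨⟨(x, y), ?_, ?_⟩, h3, h4⟩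
  · change _ ≫ x ≫ C.d (m + 1) m = 0
    rw [show x ≫ C.d (m + 1) m = _ from h3]
    simp
  · change _ ≫ x ≫ f.f (m + 1) = _
    rw [h4]
    simp

/-- A compatible sequence of components of a right inverse of `f` up to homotopy. -/
def rightInverseStage (m : ℕ) : RightInverseStage f m :=
  Nat.rec (exists_rightInverseStage_zero hf).choose
    (fun m s => (exists_rightInverseStage_succ hf m s).choose) m

include hf in
lemma exists_rightInverse : ∃ g : D ⟶ C, Nonempty (Homotopy (g ≫ f) (𝟙 D)) := by
  have h0 := (exists_rightInverseStage_zero hf).choose_spec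
  have hs := fun m => (exists_rightInverseStage_succ hf m (rightInverseStage hf m)).choose_spec
  let g : D ⟶ C :=
    { f := fun m => (rightInverseStage hf m).1.1
      comm' := by
        rintro _ m rfl
        exact (hs m).1 }
  refine ⟨g, ⟨{
    hom := fun i j => if h : i + 1 = j then
      (rightInverseStage hf i).1.2 ≫ eqToHom (by rw [h]) else 0
    zero := fun i j hij => dif_neg hij
    comm := fun m => ?_ }⟩⟩
  rw [prevD_eq (w := show (ComplexShape.down ℕ).Rel (m + 1) m by simp)]
  cases m with
  | zero =>
    rw [dNext_eq_zero _ _ (by simp)]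
    refine h0.trans ?_
    simp [rightInverseStage, add_comm]
  | succ m =>
    rw [dNext_eq (w := show (ComplexShape.down ℕ).Rel (m + 1) m by simp)]
    refine (hs m).2.trans ?_
    simp [rightInverseStage]
    abel

end RightInverse

/-- A local quasi-isomorphism `f` has a right inverse `g` up to homotopy. Then `g` is a local
quasi-isomorphism too, so it has a right inverse `f'`. Since `f ∼ f' ≫ g ≫ f ∼ f'`, the map `g` is a
two-sided inverse of `f`. -/
lemma homotopyEquivalences_iff_localQis {C D : ChainComplex A ℕ} (f : C ⟶ D) :
    HomologicalComplex.homotopyEquivalences A (ComplexShape.down ℕ) f ↔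
      localQis (MorphismProperty.isomorphisms A) f := by
  constructor
  · rintro ⟨e, rfl⟩
    exact localQis_of_homotopyEquiv _ e
  · intro hf
    obtain ⟨g, ⟨h⟩⟩ := exists_rightInverse hf
    have hg : localQis (MorphismProperty.isomorphisms A) g := by
      refine localQis_of_inj_of_surj _ (fun m T x y hx hxy => ?_) (fun m T y hy => ?_)
      · have h1 := homotopy_apply_cycle h x hx
        refine ⟨T, 𝟙 T, MorphismProperty.id_mem _ T,
          y ≫ f.f (m + 1) - x ≫ h.hom m (m + 1), ?_⟩
        rw [HomologicalComplex.comp_f, reassoc_of% hxy] at h1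
        simp [h1]
      · have h1 := homotopy_apply_cycle h (y ≫ f.f m)
          (by rw [Category.assoc, f.comm, reassoc_of% hy, zero_comp])
        -- The cycles `y` and `y ≫ f ≫ g` have homologous images under `f`, hence are homologous
        -- after refinement. So the class of `y` is the image under `g` of that of `y ≫ f`.
        obtain ⟨T', π, hπ, x', hx'⟩ := hf.localInj m (y ≫ f.f m ≫ g.f m - y)
          ((y ≫ f.f m) ≫ h.hom m (m + 1)) (by
            simp only [Preadditive.sub_comp, Category.assoc, g.comm, f.comm_assoc, hy,
              reassoc_of% hy, zero_comp, sub_self]) (by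
            rw [HomologicalComplex.comp_f, ← Category.assoc] at h1
            simp only [Preadditive.sub_comp, Category.assoc] at h1 ⊢
            rw [h1]
            simp)
        refine ⟨T', π, hπ, π ≫ y ≫ f.f m, x', ?_, ?_⟩
        · simp only [Category.assoc, f.comm, reassoc_of% hy, zero_comp, comp_zero]
        · rw [hx']
          simp
    obtain ⟨f', ⟨h'⟩⟩ := exists_rightInverse hg
    let k : Homotopy f f' :=
      ((Homotopy.ofEq (Category.id_comp f).symm).trans (h'.symm.compRight f)).trans
        ((Homotopy.ofEq (Category.assoc f' g f)).trans
          ((h.compLeft f').trans (Homotopy.ofEq (Category.comp_id f'))))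
    exact ⟨⟨f, g, (k.compRight g).trans h', h⟩, rfl⟩

end LocalQuasiIso

/-! ### Filtrations, split exact sequences and coproducts -/

section LocalQuasiIsoConstructions

variable {A : Type u} [Category.{v} A] [Preadditive A]

/-- A filtration of a chain complex `C` which is split in every degree; the graded pieces are
chain complexes `G k`, and `(G k)_l` is a direct summand of `C_{k + l}`. -/
structure SplitFiltration (C : ChainComplex A ℕ) where
  /-- the graded pieces -/
  G : ℕ → ChainComplex A ℕ
  /-- the inclusions of the graded pieces, in every degree -/
  incl (k l q : ℕ) : (G k).X l ⟶ C.X q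
  /-- the projections to the graded pieces, in every degree -/
  pr (k l q : ℕ) : C.X q ⟶ (G k).X l
  pr_zero (k l q : ℕ) (h : k + l ≠ q) : pr k l q = 0
  incl_pr (k l q : ℕ) (h : k + l = q) : incl k l q ≫ pr k l q = 𝟙 _
  incl_pr_ne (k l k' l' q : ℕ) (h : k < k') : incl k l q ≫ pr k' l' q = 0
  eq_zero {q : ℕ} {T : A} (z : T ⟶ C.X q) (h : ∀ k l, k + l = q → z ≫ pr k l q = 0) : z = 0
  d_pr {k l q : ℕ} {T : A} (z : T ⟶ C.X (q + 1)) (h : k + l = q)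
    (hz : ∀ k' l', k < k' → z ≫ pr k' l' (q + 1) = 0) :
    z ≫ C.d (q + 1) q ≫ pr k l q = z ≫ pr k (l + 1) (q + 1) ≫ (G k).d (l + 1) l

namespace SplitFiltration

variable {C D : ChainComplex A ℕ} (F : SplitFiltration C) (F' : SplitFiltration D)

lemma incl_d_pr_self (k l q : ℕ) (h : k + l = q) :
    F.incl k (l + 1) (q + 1) ≫ C.d (q + 1) q ≫ F.pr k l q = (F.G k).d (l + 1) l := by
  rw [F.d_pr _ h (fun k' l' hk => F.incl_pr_ne _ _ _ _ _ hk), ← Category.assoc,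
    F.incl_pr k (l + 1) (q + 1) (by omega), Category.id_comp]

lemma incl_d_pr_ne (k l k' l' q : ℕ) (hk : k < k') :
    F.incl k l (q + 1) ≫ C.d (q + 1) q ≫ F.pr k' l' q = 0 := by
  by_cases h : k' + l' = q
  · rw [F.d_pr _ h (fun k'' l'' hk'' => F.incl_pr_ne _ _ _ _ _ (by omega)), ← Category.assoc,
      F.incl_pr_ne _ _ _ _ _ hk, zero_comp]
  · rw [F.pr_zero _ _ _ h, comp_zero, comp_zero]

/-- A filtered chain map which is a local quasi-isomorphism on the graded pieces is a local
quasi-isomorphism. -/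
lemma localQis {J : MorphismProperty A} [J.IsMultiplicative] {f : C ⟶ D}
    (φ : ∀ k, F.G k ⟶ F'.G k)
    (hφ : ∀ k l q, F.pr k l q ≫ (φ k).f l = f.f q ≫ F'.pr k l q)
    (h : ∀ k, localQis J (φ k)) : localQis J f := by
  -- Induction on a strict bound `N` for the filtration indices of the components of the cone cycle
  -- `(x, y)`.
  have key : ∀ (N m : ℕ) ⦃T : A⦄ (x : T ⟶ C.X (m - 1)) (y : T ⟶ D.X m), (m = 0 → x = 0) →
      x ≫ C.d (m - 1) (m - 1 - 1) = 0 → x ≫ f.f (m - 1) = y ≫ D.d m (m - 1) →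
      (∀ k l, N ≤ k → x ≫ F.pr k l (m - 1) = 0) → (∀ k l, N ≤ k → y ≫ F'.pr k l m = 0) →
      ∃ (T' : A) (π : T' ⟶ T) (_ : J π) (x' : T' ⟶ C.X m) (y' : T' ⟶ D.X (m + 1)),
        x' ≫ C.d m (m - 1) = π ≫ x ∧ x' ≫ f.f m = π ≫ y + y' ≫ D.d (m + 1) m := by
    intro N
    induction N with
    | zero =>
      intro m T x y _ _ _ hx hy
      obtain rfl : x = 0 := F.eq_zero _ fun k l _ => hx k l (by omega)
      obtain rfl : y = 0 := F'.eq_zero _ fun k l _ => hy k l (by omega)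
      exact ⟨T, 𝟙 T, J.id_mem T, 0, 0, by simp, by simp⟩
    | succ N ih =>
      intro m T x y h0 hx hxy hxN hyN
      -- For `m < N` the components of index `N` vanish for degree reasons, so the smaller bound
      -- already holds.
      by_cases hNm : m < N
      · refine ih m x y h0 hx hxy (fun k l hk => ?_) (fun k l hk => ?_)
        · rw [F.pr_zero _ _ _ (by omega), comp_zero]
        · rw [F'.pr_zero _ _ _ (by omega), comp_zero]
      -- The components of index `N` form a cycle of the cone of `φ N` in degree `l`. For `l = 0`
      -- its first component vanishes, as the side condition of `localQis` demands.
      obtain ⟨l, rfl⟩ : ∃ l, m = N + l := ⟨m - N, by omega⟩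
      obtain ⟨T', π, hπ, x', y', h1, h2⟩ := h N l (x ≫ F.pr N (l - 1) (N + l - 1))
        (y ≫ F'.pr N l (N + l)) (by
          rintro rfl
          by_cases hN : N = 0
          · rw [h0 (by omega), zero_comp]
          · rw [F.pr_zero _ _ _ (by omega), comp_zero]) (by
          obtain _ | _ | l := l
          · rw [HomologicalComplex.shape _ _ _ (by simp), comp_zero]
          · rw [HomologicalComplex.shape _ _ _ (by simp), comp_zero]
          · have := F.d_pr (k := N) (l := l) (q := N + l) x rfl fun k' l' hk => hxN k' l' (by omega)
            rw [← Category.assoc, show x ≫ C.d (N + l + 1) (N + l) = 0 from hx, zero_comp] at this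
            simpa using! this.symm) (by
          obtain _ | l := l
          · have h3 : x ≫ F.pr N (0 - 1) (N + 0 - 1) = 0 := by
              by_cases hN : N = 0
              · rw [h0 (by omega), zero_comp]
              · rw [F.pr_zero _ _ _ (by omega), comp_zero]
            rw [h3, HomologicalComplex.shape (F'.G N) 0 (0 - 1) (by simp), comp_zero, zero_comp]
          · have h3 := F'.d_pr (k := N) (l := l) (q := N + l) y rfl
              fun k' l' hk => hyN k' l' (by omega)
            have h4 : x ≫ f.f (N + l) = y ≫ D.d (N + l + 1) (N + l) := hxy
            change (x ≫ F.pr N l (N + l)) ≫ (φ N).f l =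
              (y ≫ F'.pr N (l + 1) (N + l + 1)) ≫ (F'.G N).d (l + 1) l
            rw [Category.assoc, hφ, ← Category.assoc, h4, Category.assoc, h3, Category.assoc])
      -- Subtracting the boundary of the solution found in the graded piece kills the components of
      -- index `N` and creates none of higher index, so the induction hypothesis applies to the
      -- remainder.
      obtain ⟨T'', π', hπ', x'', y'', h3, h4⟩ := ih (N + l)
        (π ≫ x - (x' ≫ F.incl N l (N + l)) ≫ C.d (N + l) (N + l - 1))
        (π ≫ y + (y' ≫ F'.incl N (l + 1) (N + l + 1)) ≫ D.d (N + l + 1) (N + l) -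
          (x' ≫ F.incl N l (N + l)) ≫ f.f (N + l)) (fun hl => by
          rw [h0 hl, HomologicalComplex.shape _ _ _ (by simp [hl])]
          simp) (by simp [hx]) (by simp [hxy]) (fun k' l' hk => by
          rcases Nat.eq_zero_or_pos (N + l) with hNl | hNl
          · rw [h0 hNl, HomologicalComplex.shape _ _ _ (by simp [hNl])]
            simp
          · obtain ⟨q, hq⟩ : ∃ q, N + l = q + 1 := ⟨N + l - 1, by omega⟩
            by_cases hl' : k' + l' = N + l - 1
            · rcases hk.lt_or_eq with hk | rfl
              · rw [Preadditive.sub_comp, Category.assoc, hxN k' l' (by omega), Category.assoc,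
                  Category.assoc]
                have := F.incl_d_pr_ne N l k' l' q hk
                rw [← hq, show q = N + l - 1 by omega] at this
                rw [this, comp_zero, comp_zero, sub_zero]
              · obtain rfl : l = l' + 1 := by omega
                have := F.incl_d_pr_self N l' (N + l') rfl
                rw [Preadditive.sub_comp, Category.assoc, Category.assoc, Category.assoc, sub_eq_zero]
                refine h1.symm.trans ?_
                congr 1
                exact this.symm
            · rw [F.pr_zero _ _ _ (Ne.symm (Ne.symm hl')), comp_zero]) (fun k' l' hk => by
          simp only [Preadditive.sub_comp, Preadditive.add_comp, Category.assoc, ← hφ]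
          by_cases hl' : k' + l' = N + l
          · rcases hk.lt_or_eq with hk | rfl
            · rw [hyN k' l' (by omega), F'.incl_d_pr_ne _ _ _ _ _ hk,
                reassoc_of% F.incl_pr_ne N l k' l' (N + l) hk]
              simp
            · obtain rfl : l = l' := by omega
              rw [F'.incl_d_pr_self _ _ _ rfl, reassoc_of% F.incl_pr N l (N + l) rfl, h2]
              simp
          · rw [F.pr_zero _ _ _ hl', F'.pr_zero _ _ _ hl']
            simp)
      refine ⟨T'', π' ≫ π, J.comp_mem _ _ hπ' hπ, x'' + π' ≫ x' ≫ F.incl N l (N + l),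
        y'' + π' ≫ y' ≫ F'.incl N (l + 1) (N + l + 1), ?_, ?_⟩
      · rw [Preadditive.add_comp, h3]
        simp
      · rw [Preadditive.add_comp, h4]
        simp
        abel
  -- A component of index `k` in degree `q` needs `k ≤ q`, so `m + 1` is a bound.
  intro m T x y h0 hx hxy
  exact key (m + 1) m x y h0 hx hxy
    (fun k l hk => by rw [F.pr_zero _ _ _ (by omega), comp_zero])
    (fun k l hk => by rw [F'.pr_zero _ _ _ (by omega), comp_zero])

end SplitFiltration

/-- Every generalized cycle is a boundary, up to refinements in `J`. -/
def LocallyAcyclic (J : MorphismProperty A) (C : ChainComplex A ℕ) : Prop :=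
  ∀ (m : ℕ) ⦃T : A⦄ (z : T ⟶ C.X m), z ≫ C.d m (m - 1) = 0 →
    ∃ (T' : A) (π : T' ⟶ T) (_ : J π) (y : T' ⟶ C.X (m + 1)), y ≫ C.d (m + 1) m = π ≫ z

lemma localQis_iff_locallyAcyclic {J : MorphismProperty A} [J.IsMultiplicative]
    {C Z : ChainComplex A ℕ} (f : C ⟶ Z) (hZ : ∀ q, IsZero (Z.X q)) :
    localQis J f ↔ LocallyAcyclic J C := by
  constructor
  · intro hf m T z hz
    exact hf.localInj m z 0 hz ((hZ m).eq_of_tgt _ _)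
  · intro hC
    refine localQis_of_inj_of_surj J (fun m T x y hx hxy => hC m x hx) (fun m T y hy => ?_)
    exact ⟨T, 𝟙 T, J.id_mem T, 0, 0, by simp, (hZ m).eq_of_tgt _ _⟩

/-- In a degreewise split short exact sequence `0 ⟶ U ⟶ V ⟶ C ⟶ 0`, the complex `C` is acyclic
if and only if `U ⟶ V` is a local quasi-isomorphism. -/
lemma locallyAcyclic_iff_of_split {J : MorphismProperty A} {U V C : ChainComplex A ℕ}
    (a : U ⟶ V) (b : V ⟶ C) (r : ∀ q, V.X q ⟶ U.X q) (t : ∀ q, C.X q ⟶ V.X q)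
    (har : ∀ q, a.f q ≫ r q = 𝟙 _) (htb : ∀ q, t q ≫ b.f q = 𝟙 _)
    (hab : ∀ q, a.f q ≫ b.f q = 0) (hrt : ∀ q, r q ≫ a.f q + b.f q ≫ t q = 𝟙 _) :
    LocallyAcyclic J C ↔ localQis J a := by
  have hra : ∀ q, r q ≫ a.f q = 𝟙 _ - b.f q ≫ t q := fun q => eq_sub_of_add_eq (hrt q)
  have ha : ∀ q {T : A} (x x' : T ⟶ U.X q), x ≫ a.f q = x' ≫ a.f q → x = x' := by
    intro q T x x' h
    simpa [har] using congr_arg (fun φ => φ ≫ r q) h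
  constructor
  · intro hC m T x y h0 hx hxy
    -- The image of `y` in `C` is a cycle. A chain `c` bounding it, lifted by `t`, corrects `y` to a
    -- morphism that factors through `U`.
    obtain ⟨T', π, hπ, c, hc⟩ := hC m (y ≫ b.f m) (by
      rw [Category.assoc, b.comm, ← Category.assoc, ← hxy, Category.assoc, hab, comp_zero])
    have h1 : ((π ≫ y - (c ≫ t (m + 1)) ≫ V.d (m + 1) m) ≫ r m) ≫ a.f m =
        π ≫ y - (c ≫ t (m + 1)) ≫ V.d (m + 1) m := by
      rw [Category.assoc, hra, Preadditive.comp_sub, Category.comp_id, sub_eq_self,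
        ← Category.assoc, Preadditive.sub_comp, Category.assoc, Category.assoc, Category.assoc,
        ← b.comm, reassoc_of% htb (m + 1), hc, sub_self, zero_comp]
    refine ⟨T', π, hπ, (π ≫ y - (c ≫ t (m + 1)) ≫ V.d (m + 1) m) ≫ r m, -(c ≫ t (m + 1)), ?_, ?_⟩
    · apply ha
      rw [Category.assoc, ← a.comm, ← Category.assoc, h1]
      simp [hxy]
    · rw [h1]
      simp [sub_eq_add_neg]
  · intro h m T z hz
    -- The connecting morphism: the boundary of the lift `z ≫ t` comes from `U`, and together with
    -- `z ≫ t` it forms a cycle of the cone of `a`.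
    have h1 : ((z ≫ t m ≫ V.d m (m - 1)) ≫ r (m - 1)) ≫ a.f (m - 1) =
        z ≫ t m ≫ V.d m (m - 1) := by
      rw [Category.assoc, hra, Preadditive.comp_sub, Category.comp_id, sub_eq_self, Category.assoc,
        Category.assoc, ← b.comm_assoc, reassoc_of% htb m, reassoc_of% hz, zero_comp]
    obtain ⟨T', π, hπ, x, y, hx, hy⟩ := h m ((z ≫ t m ≫ V.d m (m - 1)) ≫ r (m - 1)) (z ≫ t m)
      (fun hm => by
        rw [HomologicalComplex.shape _ _ _ (by simp [hm])]
        simp) (by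
        apply ha
        rw [Category.assoc, ← a.comm, ← Category.assoc, h1]
        simp) (by rw [h1, Category.assoc])
    refine ⟨T', π, hπ, -(y ≫ b.f (m + 1)), ?_⟩
    have h2 := congr_arg (fun φ => φ ≫ b.f m) hy
    simp only [Category.assoc, hab, comp_zero, Preadditive.add_comp, htb, Category.comp_id,
      ← b.comm] at h2
    rw [Preadditive.neg_comp, Category.assoc, neg_eq_iff_add_eq_zero, add_comm, ← h2]

/-- Coproducts of complexes are biproducts, with projections `coprod.desc (𝟙 _) 0` and `coprod.desc
0 (𝟙 _)`. The cone problem is solved on the first summand, then on the second after that refinement,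
and the solutions are added. -/
lemma localQis_coprodMap {J : MorphismProperty A} [J.IsMultiplicative]
    [HasBinaryCoproducts (ChainComplex A ℕ)] {C D C' D' : ChainComplex A ℕ} {f : C ⟶ D}
    {f' : C' ⟶ D'} (hf : localQis J f) (hf' : localQis J f') :
    localQis J (coprod.map f f') := by
  have h1 : ∀ X Y : ChainComplex A ℕ, coprod.desc (𝟙 X) (0 : Y ⟶ X) ≫ coprod.inl +
      coprod.desc (0 : X ⟶ Y) (𝟙 Y) ≫ coprod.inr = 𝟙 (X ⨿ Y) := fun X Y => by
    apply coprod.hom_ext <;> simp only [Preadditive.comp_add, coprod.inl_desc_assoc,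
      coprod.inr_desc_assoc, Category.id_comp, zero_comp, add_zero, zero_add, Category.comp_id]
  have h2 : coprod.map f f' ≫ coprod.desc (𝟙 D) 0 = coprod.desc (𝟙 C) 0 ≫ f := by
    apply coprod.hom_ext <;> simp
  have h3 : coprod.map f f' ≫ coprod.desc 0 (𝟙 D') = coprod.desc 0 (𝟙 C') ≫ f' := by
    apply coprod.hom_ext <;> simp
  have h1' := fun (X Y : ChainComplex A ℕ) (q : ℕ) =>
    congr_arg (fun φ => HomologicalComplex.Hom.f φ q) (h1 X Y)
  have h2' := fun q => congr_arg (fun φ => HomologicalComplex.Hom.f φ q) h2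
  have h3' := fun q => congr_arg (fun φ => HomologicalComplex.Hom.f φ q) h3
  have h4 : ∀ q, (coprod.inl : C ⟶ C ⨿ C').f q ≫ (coprod.map f f').f q = f.f q ≫ (coprod.inl : D ⟶ D ⨿ D').f q := fun q => by
    simp [← HomologicalComplex.comp_f]
  have h5 : ∀ q, (coprod.inr : C' ⟶ C ⨿ C').f q ≫ (coprod.map f f').f q = f'.f q ≫ (coprod.inr : D' ⟶ D ⨿ D').f q := fun q => by
    simp [← HomologicalComplex.comp_f]
  simp only [HomologicalComplex.comp_f, HomologicalComplex.add_f_apply,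
    HomologicalComplex.id_f] at h1' h2' h3'
  intro m T x y h0 hx hxy
  obtain ⟨T₁, π₁, hπ₁, x₁, y₁, hx₁, hy₁⟩ := hf m (x ≫ (coprod.desc (𝟙 C) 0).f (m - 1))
    (y ≫ (coprod.desc (𝟙 D) 0).f m) (fun hm => by rw [h0 hm, zero_comp])
    (by rw [Category.assoc, HomologicalComplex.Hom.comm, reassoc_of% hx, zero_comp])
    (by rw [Category.assoc, ← h2', reassoc_of% hxy, Category.assoc, HomologicalComplex.Hom.comm])
  obtain ⟨T₂, π₂, hπ₂, x₂, y₂, hx₂, hy₂⟩ := hf' m (π₁ ≫ x ≫ (coprod.desc 0 (𝟙 C')).f (m - 1))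
    (π₁ ≫ y ≫ (coprod.desc 0 (𝟙 D')).f m) (fun hm => by rw [h0 hm, zero_comp, comp_zero])
    (by simp only [Category.assoc]
        rw [HomologicalComplex.Hom.comm, reassoc_of% hx, zero_comp, comp_zero])
    (by simp only [Category.assoc]
        rw [← h3', reassoc_of% hxy, HomologicalComplex.Hom.comm])
  refine ⟨T₂, π₂ ≫ π₁, J.comp_mem _ _ hπ₂ hπ₁,
    π₂ ≫ x₁ ≫ (coprod.inl : C ⟶ C ⨿ C').f m + x₂ ≫ (coprod.inr : C' ⟶ C ⨿ C').f m,
    π₂ ≫ y₁ ≫ (coprod.inl : D ⟶ D ⨿ D').f (m + 1) + y₂ ≫ (coprod.inr : D' ⟶ D ⨿ D').f (m + 1), ?_, ?_⟩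
  · rw [← Category.comp_id ((π₂ ≫ π₁) ≫ x), ← h1']
    simp only [Preadditive.add_comp, Preadditive.comp_add, Category.assoc,
      HomologicalComplex.Hom.comm, reassoc_of% hx₁, reassoc_of% hx₂]
  · rw [← Category.comp_id ((π₂ ≫ π₁) ≫ y), ← h1']
    simp only [Preadditive.add_comp, Preadditive.comp_add, Category.assoc, h4, h5,
      HomologicalComplex.Hom.comm, reassoc_of% hy₁, reassoc_of% hy₂]
    abel

end LocalQuasiIsoConstructions

/-! ### Columns and rows of the total complex -/

section TotalComplex

variable {A : Type u} [Category.{v} A] [Preadditive A]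

open AlgebraicTopology

lemma neg_one_pow_smul_smul {M : Type*} [AddCommGroup M] (n : ℕ) (x : M) :
    ((-1 : ℤ) ^ n) • ((-1 : ℤ) ^ n) • x = x := by
  rw [smul_smul, ← pow_add, Even.neg_one_pow ⟨n, rfl⟩, one_smul]

/-- The simplicial object formed by the components of degree `p`. -/
abbrev row (X : SimplicialObject (ChainComplex A ℕ)) (p : ℕ) : SimplicialObject A :=
  (levelwise (HomologicalComplex.eval A (ComplexShape.down ℕ) p)).obj X

/-- The boundary map `∂ : X_{n+1,p} ⟶ X_{n,p}`. -/
def bdrySucc (X : SimplicialObject (ChainComplex A ℕ)) (n p : ℕ) :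
    (X _⦋n + 1⦌).X p ⟶ (X _⦋n⦌).X p := bdry X (n + 1) p

lemma row_d (X : SimplicialObject (ChainComplex A ℕ)) (n p : ℕ) :
    ((alternatingFaceMapComplex A).obj (row X p)).d (n + 1) n = bdrySucc X n p := by
  unfold bdrySucc
  rw [bdry_succ]
  exact alternatingFaceMapComplex_obj_d (row X p) n

variable [HasFiniteBiproducts A]

/-- The projection of `(s X)_q` to the summand `X_{n,p}` if `p + n = q`, and `0` otherwise. -/
def simplePr (X : SimplicialObject (ChainComplex A ℕ)) (n p q : ℕ) :
    ((simple A).obj X).X q ⟶ (X _⦋n⦌).X p :=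
  simpleDesc fun n' p' _ => if e : n' = n ∧ p' = p then eqToHom (by rw [e.1, e.2]) else 0

lemma simpleι_pr (X : SimplicialObject (ChainComplex A ℕ)) (n p q : ℕ) (h : p + n = q) :
    simpleι X n p q h ≫ simplePr X n p q = 𝟙 _ := by
  unfold simplePr
  rw [simpleι_desc, dif_pos ⟨rfl, rfl⟩]
  rfl

lemma simpleι_pr_ne (X : SimplicialObject (ChainComplex A ℕ)) (n p n' p' q : ℕ) (h : p + n = q)
    (hn : ¬ (n = n' ∧ p = p')) : simpleι X n p q h ≫ simplePr X n' p' q = 0 := by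
  unfold simplePr
  rw [simpleι_desc, dif_neg hn]

lemma simplePr_eq_zero (X : SimplicialObject (ChainComplex A ℕ)) (n p q : ℕ) (h : p + n ≠ q) :
    simplePr X n p q = 0 := by
  refine simple_hom_ext fun n' p' h' => ?_
  rw [simpleι_pr_ne _ _ _ _ _ _ _ (by rintro ⟨rfl, rfl⟩; exact h h'), comp_zero]

lemma simpleι₀_pr (X : SimplicialObject (ChainComplex A ℕ)) (n p q : ℕ) (h : p + n = q) :
    simpleι₀ X n p q ≫ simplePr X n p q = 𝟙 _ := by
  rw [simpleι₀_eq _ _ _ _ h, simpleι_pr]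

lemma simpleι₀_pr_ne (X : SimplicialObject (ChainComplex A ℕ)) (n p n' p' q : ℕ)
    (hn : ¬ (n = n' ∧ p = p')) : simpleι₀ X n p q ≫ simplePr X n' p' q = 0 := by
  unfold simpleι₀
  split_ifs
  · exact simpleι_pr_ne _ _ _ _ _ _ _ hn
  · exact zero_comp

lemma simple_id_eq_sum (X : SimplicialObject (ChainComplex A ℕ)) (q : ℕ) :
    𝟙 (((simple A).obj X).X q) = ∑ x ∈ Finset.HasAntidiagonal.antidiagonal q,
      simplePr X x.1 x.2 q ≫ simpleι₀ X x.1 x.2 q := by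
  refine simple_hom_ext fun n p h => ?_
  rw [Category.comp_id, Preadditive.comp_sum, Finset.sum_eq_single (n, p)]
  · rw [← Category.assoc, simpleι_pr, Category.id_comp, simpleι₀_eq _ _ _ _ h]
  · rintro ⟨n', p'⟩ - hne
    rw [← Category.assoc, simpleι_pr_ne _ _ _ _ _ _ _ (by rintro ⟨rfl, rfl⟩; exact hne rfl),
      zero_comp]
  · intro h'
    exact absurd (Finset.HasAntidiagonal.mem_antidiagonal.2 (by omega)) h'

lemma simple_eq_zero {X : SimplicialObject (ChainComplex A ℕ)} {q : ℕ} {T : A}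
    (z : T ⟶ ((simple A).obj X).X q) (h : ∀ n p, p + n = q → z ≫ simplePr X n p q = 0) :
    z = 0 := by
  rw [← Category.comp_id z, simple_id_eq_sum, Preadditive.comp_sum]
  refine Finset.sum_eq_zero fun x hx => ?_
  rw [Finset.HasAntidiagonal.mem_antidiagonal] at hx
  rw [← Category.assoc, h _ _ (by omega), zero_comp]

lemma simpleMap_pr {X Y : SimplicialObject (ChainComplex A ℕ)} (f : X ⟶ Y) (n p q : ℕ) :
    ((simple A).map f).f q ≫ simplePr Y n p q = simplePr X n p q ≫ (f.app (op ⦋n⦌)).f p := by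
  refine simple_hom_ext fun n' p' h => ?_
  rw [← Category.assoc, simpleι_map, Category.assoc]
  by_cases hn : n' = n ∧ p' = p
  · obtain ⟨rfl, rfl⟩ := hn
    rw [simpleι_pr, ← Category.assoc, simpleι_pr, Category.comp_id, Category.id_comp]
  · rw [simpleι_pr_ne _ _ _ _ _ _ _ hn, ← Category.assoc, simpleι_pr_ne _ _ _ _ _ _ _ hn,
      comp_zero, zero_comp]

lemma simple_d_pr (X : SimplicialObject (ChainComplex A ℕ)) (n p q : ℕ) (h : p + n = q) :
    ((simple A).obj X).d (q + 1) q ≫ simplePr X n p q =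
      simplePr X n (p + 1) (q + 1) ≫ (X _⦋n⦌).d (p + 1) p +
      ((-1 : ℤ) ^ p) • (simplePr X (n + 1) p (q + 1) ≫ bdrySucc X n p) := by
  refine simple_hom_ext fun n' p' h' => ?_
  rw [← Category.assoc, simpleι_d _ _ _ _ _ h' rfl, Preadditive.comp_add, Preadditive.add_comp,
    Preadditive.comp_zsmul, Preadditive.zsmul_comp, Category.assoc, Category.assoc,
    ← Category.assoc (simpleι X n' p' (q + 1) h'), ← Category.assoc (simpleι X n' p' (q + 1) h')]
  congr 1
  · by_cases hn : n' = n
    · obtain rfl := hn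
      obtain rfl : p' = p + 1 := by omega
      rw [simpleι_pr]
      change _ ≫ simpleι₀ X n' p q ≫ simplePr X n' p q = _
      rw [simpleι₀_pr _ _ _ _ h, Category.comp_id, Category.id_comp]
      rfl
    · rw [simpleι_pr_ne _ _ _ _ _ _ _ (fun hn' => hn hn'.1),
        simpleι₀_pr_ne _ _ _ _ _ _ (fun hn' => hn hn'.1), comp_zero, zero_comp]
  · by_cases hn : n' = n + 1
    · obtain rfl := hn
      obtain rfl : p' = p := by omega
      rw [simpleι_pr]
      change _ • (bdrySucc X n p' ≫ simpleι₀ X n p' q ≫ simplePr X n p' q) = _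
      rw [simpleι₀_pr _ _ _ _ h, Category.comp_id, Category.id_comp]
    · rw [simpleι_pr_ne _ _ _ _ _ _ _ (fun hn' => hn hn'.1), zero_comp, smul_zero]
      by_cases hn' : n' - 1 = n ∧ p' = p
      · obtain rfl : n' = 0 := by omega
        rw [bdry_zero, zero_comp, smul_zero]
      · rw [simpleι₀_pr_ne _ _ _ _ _ _ hn', comp_zero, smul_zero]

/-- The filtration of `s X` by the simplicial degree. -/
def columnFiltration (X : SimplicialObject (ChainComplex A ℕ)) :
    SplitFiltration ((simple A).obj X) where
  G n := X _⦋n⦌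
  incl n p q := simpleι₀ X n p q
  pr n p q := simplePr X n p q
  pr_zero n p q h := simplePr_eq_zero X n p q (by omega)
  incl_pr n p q h := simpleι₀_pr X n p q (by omega)
  incl_pr_ne n p n' p' q h := simpleι₀_pr_ne X n p n' p' q (by omega)
  eq_zero z h := simple_eq_zero z fun n p hn => h n p (by omega)
  d_pr {n p q T} z h hz := by
    rw [simple_d_pr X n p q (by omega), Preadditive.comp_add, Preadditive.comp_zsmul,
      ← Category.assoc z (simplePr X (n + 1) p (q + 1)), hz (n + 1) p (by omega)]
    simp

/-- The inclusion of the summand `X_{n,p}`, with the sign that makes the `p`-th row a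
subquotient of `s X`. -/
def signedι (X : SimplicialObject (ChainComplex A ℕ)) (p n q : ℕ) :
    (X _⦋n⦌).X p ⟶ ((simple A).obj X).X q := ((-1 : ℤ) ^ (p * n)) • simpleι₀ X n p q

/-- The projection to the summand `X_{n,p}`, with the sign that makes the `p`-th row a
subquotient of `s X`. -/
def signedPr (X : SimplicialObject (ChainComplex A ℕ)) (p n q : ℕ) :
    ((simple A).obj X).X q ⟶ (X _⦋n⦌).X p := ((-1 : ℤ) ^ (p * n)) • simplePr X n p q

lemma comp_signedPr_eq_zero_iff {X : SimplicialObject (ChainComplex A ℕ)} {p n q : ℕ} {T : A}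
    (z : T ⟶ ((simple A).obj X).X q) : z ≫ signedPr X p n q = 0 ↔ z ≫ simplePr X n p q = 0 := by
  unfold signedPr
  rw [Preadditive.comp_zsmul]
  refine ⟨fun h => ?_, fun h => by rw [h, smul_zero]⟩
  rw [← neg_one_pow_smul_smul (p * n) (z ≫ _), h, smul_zero]

lemma signedι_signedPr (X : SimplicialObject (ChainComplex A ℕ)) (p n q : ℕ) (h : p + n = q) :
    signedι X p n q ≫ signedPr X p n q = 𝟙 _ := by
  unfold signedι signedPr
  rw [Preadditive.zsmul_comp, Preadditive.comp_zsmul, neg_one_pow_smul_smul,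
    simpleι₀_pr X n p q h]

lemma signedι_signedPr_ne (X : SimplicialObject (ChainComplex A ℕ)) (p n p' n' q : ℕ)
    (h : p < p') : signedι X p n q ≫ signedPr X p' n' q = 0 := by
  unfold signedι signedPr
  rw [Preadditive.zsmul_comp, Preadditive.comp_zsmul,
    simpleι₀_pr_ne X n p n' p' q (by omega), smul_zero, smul_zero]

/-- The hypothesis `hz` removes the component of chain degree `p + 1`, hence the contribution of the
internal differential. The sign in `signedPr` absorbs the `(-1)^p` in front of `∂`, because `(-1)^(p
* n) * (-1)^p = (-1)^(p * (n + 1))`. -/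
lemma d_signedPr {X : SimplicialObject (ChainComplex A ℕ)} {p n q : ℕ} {T : A}
    (z : T ⟶ ((simple A).obj X).X (q + 1)) (h : p + n = q)
    (hz : ∀ p' n', p < p' → z ≫ signedPr X p' n' (q + 1) = 0) :
    z ≫ ((simple A).obj X).d (q + 1) q ≫ signedPr X p n q =
      z ≫ signedPr X p (n + 1) (q + 1) ≫ bdrySucc X n p := by
  have h1 := (comp_signedPr_eq_zero_iff z).1 (hz (p + 1) n (by omega))
  unfold signedPr
  rw [Preadditive.comp_zsmul, simple_d_pr X n p q (by omega), smul_add,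
    Preadditive.comp_add, Preadditive.comp_zsmul, ← Category.assoc z, h1, zero_comp, smul_zero,
    zero_add, smul_smul, ← pow_add, Preadditive.comp_zsmul, Preadditive.zsmul_comp,
    Preadditive.comp_zsmul]
  rfl

/-- The filtration of `s X` by the chain degree. -/
def rowFiltration (X : SimplicialObject (ChainComplex A ℕ)) :
    SplitFiltration ((simple A).obj X) where
  G p := (alternatingFaceMapComplex A).obj (row X p)
  incl p n q := signedι X p n q
  pr p n q := signedPr X p n q
  pr_zero p n q h := by
    change ((-1 : ℤ) ^ (p * n)) • simplePr X n p q = 0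
    rw [simplePr_eq_zero X n p q h, smul_zero]
  incl_pr p n q h := signedι_signedPr X p n q h
  incl_pr_ne p n p' n' q h := signedι_signedPr_ne X p n p' n' q h
  eq_zero z h := simple_eq_zero z fun n p hn => (comp_signedPr_eq_zero_iff z).1 (h p n hn)
  d_pr {p n q T} z h hz := by
    rw [row_d]
    exact d_signedPr z h hz

variable {J : MorphismProperty A} [J.IsMultiplicative]

/-- The simple functor sends levelwise local quasi-isomorphisms to local quasi-isomorphisms. -/
lemma localQis_simple_of_levels {X Y : SimplicialObject (ChainComplex A ℕ)} (f : X ⟶ Y)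
    (hf : ∀ n : ℕ, localQis J (f.app (op ⦋n⦌))) : localQis J ((simple A).map f) :=
  (columnFiltration X).localQis (columnFiltration Y) (fun n => f.app (op ⦋n⦌))
    (fun n p q => (simpleMap_pr f n p q).symm) hf

/-- If `f` induces a local quasi-isomorphism between the chain complexes of the simplicial objects
of components of degree `p`, for all `p`, then `s f` is a local quasi-isomorphism. -/
lemma localQis_simple_of_rows {X Y : SimplicialObject (ChainComplex A ℕ)} (f : X ⟶ Y)
    (hf : ∀ p : ℕ, localQis J ((alternatingFaceMapComplex A).map
      ((levelwise (HomologicalComplex.eval A (ComplexShape.down ℕ) p)).map f))) :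
    localQis J ((simple A).map f) :=
  (rowFiltration X).localQis (rowFiltration Y) _ (fun p n q => by
    change signedPr X p n q ≫ (f.app (op ⦋n⦌)).f p = _ ≫ signedPr Y p n q
    unfold signedPr
    rw [Preadditive.zsmul_comp, Preadditive.comp_zsmul, simpleMap_pr]) hf

omit [HasFiniteBiproducts A] in
lemma localQis_alternatingFaceMapComplex_map {X Y : SimplicialObject A} {f : X ⟶ Y}
    (hf : simplicialHomotopyEquivalences A f) :
    localQis J ((alternatingFaceMapComplex A).map f) := by
  obtain ⟨g, ⟨h⟩, ⟨h'⟩⟩ := hf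
  exact localQis_of_homotopyEquiv J
    { hom := (alternatingFaceMapComplex A).map f
      inv := (alternatingFaceMapComplex A).map g
      homotopyHomInvId := (Homotopy.ofEq (by rw [CategoryTheory.Functor.map_comp])).trans
        (h.toChainHomotopy.trans (Homotopy.ofEq (by rw [CategoryTheory.Functor.map_id])))
      homotopyInvHomId := (Homotopy.ofEq (by rw [CategoryTheory.Functor.map_comp])).trans
        (h'.toChainHomotopy.trans (Homotopy.ofEq (by rw [CategoryTheory.Functor.map_id]))) }

end TotalComplex

/-! ### Simplicial homotopy equivalences and the diagonal -/

section HomotopyEquivalences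

variable {C : Type u} [Category.{v} C] {D : Type u'} [Category.{v'} D]

lemma simplicialHomotopyEquivalences_levelwise_map (F : C ⥤ D) {X Y : SimplicialObject C}
    {f : X ⟶ Y} (hf : simplicialHomotopyEquivalences C f) :
    simplicialHomotopyEquivalences D ((levelwise F).map f) := by
  obtain ⟨g, ⟨h⟩, ⟨h'⟩⟩ := hf
  refine ⟨(levelwise F).map g, ⟨?_⟩, ⟨?_⟩⟩
  · rw [← CategoryTheory.Functor.map_comp, ← CategoryTheory.Functor.map_id]
    exact h.whiskerRight F
  · rw [← CategoryTheory.Functor.map_comp, ← CategoryTheory.Functor.map_id]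
    exact h'.whiskerRight F

section DiagHomotopy

variable {X Y : SimplicialObject (SimplicialObject C)} {f g : X ⟶ Y}
  (H : SimplicialObject.Homotopy f g)

/-- The components of the diagonal of a simplicial homotopy in the outer direction. -/
def diagHomotopyHom {n : ℕ} (i : Fin (n + 1)) :
    ((diag C).obj X) _⦋n⦌ ⟶ ((diag C).obj Y) _⦋n + 1⦌ :=
  (H.h i).app (op ⦋n⦌) ≫ (Y _⦋n + 1⦌).σ i

/-- A diagonal face acts in both directions. Naturality brings the outer face next to `H.h i`, where
the homotopy identities apply, and leaves a simplicial identity of `Y` in the inner direction. The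
same separation is made for degeneracies and for the operators of `X`. -/
lemma diagHomotopyHom_δ {n : ℕ} (i : Fin (n + 1)) (j : Fin (n + 2)) :
    diagHomotopyHom H i ≫ ((diag C).obj Y).δ j =
      (H.h i ≫ Y.δ j).app (op ⦋n⦌) ≫ (Y _⦋n⦌).σ i ≫ (Y _⦋n⦌).δ j := by
  change ((H.h i).app (op ⦋n⦌) ≫ (Y _⦋n + 1⦌).map _) ≫ (Y _⦋n + 1⦌).map _ ≫ (Y.δ j).app _ =
    ((H.h i).app (op ⦋n⦌) ≫ (Y.δ j).app (op ⦋n⦌)) ≫ (Y _⦋n⦌).map _ ≫ (Y _⦋n⦌).map _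
  simp only [Category.assoc, NatTrans.naturality, NatTrans.naturality_assoc]

lemma δ_diagHomotopyHom {n : ℕ} (i : Fin (n + 2)) (j : Fin (n + 1)) :
    ((diag C).obj X).δ i ≫ diagHomotopyHom H j =
      (X.δ i ≫ H.h j).app (op ⦋n + 1⦌) ≫ (Y _⦋n + 1⦌).δ i ≫ (Y _⦋n + 1⦌).σ j := by
  change ((X _⦋n + 1⦌).map _ ≫ (X.δ i).app _) ≫ (H.h j).app _ ≫ (Y _⦋n + 1⦌).map _ =
    ((X.δ i).app _ ≫ (H.h j).app _) ≫ (Y _⦋n + 1⦌).map _ ≫ (Y _⦋n + 1⦌).map _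
  simp only [Category.assoc, NatTrans.naturality, NatTrans.naturality_assoc]

lemma diagHomotopyHom_σ {n : ℕ} (i : Fin (n + 1)) (j : Fin (n + 2)) :
    diagHomotopyHom H i ≫ ((diag C).obj Y).σ j =
      (H.h i ≫ Y.σ j).app (op ⦋n⦌) ≫ (Y _⦋n + 2⦌).σ i ≫ (Y _⦋n + 2⦌).σ j := by
  change ((H.h i).app (op ⦋n⦌) ≫ (Y _⦋n + 1⦌).map _) ≫ (Y _⦋n + 1⦌).map _ ≫ (Y.σ j).app _ =
    ((H.h i).app (op ⦋n⦌) ≫ (Y.σ j).app (op ⦋n⦌)) ≫ (Y _⦋n + 2⦌).map _ ≫ (Y _⦋n + 2⦌).map _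
  simp only [Category.assoc, NatTrans.naturality, NatTrans.naturality_assoc]

lemma σ_diagHomotopyHom {n : ℕ} (i : Fin (n + 1)) (j : Fin (n + 2)) :
    ((diag C).obj X).σ i ≫ diagHomotopyHom H j =
      (X.σ i ≫ H.h j).app (op ⦋n⦌) ≫ (Y _⦋n + 2⦌).σ i ≫ (Y _⦋n + 2⦌).σ j := by
  change ((X _⦋n⦌).map _ ≫ (X.σ i).app _) ≫ (H.h j).app _ ≫ (Y _⦋n + 2⦌).map _ =
    ((X.σ i).app _ ≫ (H.h j).app _) ≫ (Y _⦋n + 2⦌).map _ ≫ (Y _⦋n + 2⦌).map _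
  simp only [Category.assoc, NatTrans.naturality, NatTrans.naturality_assoc]

/-- The diagonal of a simplicial homotopy in the outer direction. -/
def diagHomotopy : SimplicialObject.Homotopy ((diag C).map f) ((diag C).map g) where
  h i := diagHomotopyHom H i
  h_zero_comp_δ_zero n := by
    rw [diagHomotopyHom_δ, H.h_zero_comp_δ_zero]
    have := (Y _⦋n⦌).δ_comp_σ_self (n := n) (i := 0)
    dsimp at this ⊢
    rw [this, Category.comp_id]
    rfl
  h_last_comp_δ_last n := by
    rw [diagHomotopyHom_δ, H.h_last_comp_δ_last]
    have := (Y _⦋n⦌).δ_comp_σ_succ (i := Fin.last n)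
    dsimp at this ⊢
    rw [this, Category.comp_id]
    rfl
  h_succ_comp_δ_castSucc_of_lt i j hij := by
    rw [diagHomotopyHom_δ, δ_diagHomotopyHom, H.h_succ_comp_δ_castSucc_of_lt i j hij,
      SimplicialObject.δ_comp_σ_of_le _ hij]
  h_succ_comp_δ_castSucc_succ {n} j := by
    rw [diagHomotopyHom_δ, diagHomotopyHom_δ, H.h_succ_comp_δ_castSucc_succ]
    have h1 := (Y _⦋n + 1⦌).δ_comp_σ_self (i := j.succ)
    have h2 := (Y _⦋n + 1⦌).δ_comp_σ_succ (i := j.castSucc)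
    rw [Fin.castSucc_succ] at h1
    rw [h1, h2]
  h_castSucc_comp_δ_succ_of_lt i j hji := by
    rw [diagHomotopyHom_δ, δ_diagHomotopyHom, H.h_castSucc_comp_δ_succ_of_lt i j hji,
      SimplicialObject.δ_comp_σ_of_gt _ hji]
  h_comp_σ_castSucc_of_le i j hij := by
    rw [diagHomotopyHom_σ, σ_diagHomotopyHom, H.h_comp_σ_castSucc_of_le i j hij,
      SimplicialObject.σ_comp_σ _ hij]
  h_comp_σ_succ_of_lt i j hji := by
    rw [diagHomotopyHom_σ, σ_diagHomotopyHom, H.h_comp_σ_succ_of_lt i j hji,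
      SimplicialObject.σ_comp_σ _ hji]

end DiagHomotopy

lemma simplicialHomotopyEquivalences_diag_map {X Y : SimplicialObject (SimplicialObject C)}
    {f : X ⟶ Y} (hf : simplicialHomotopyEquivalences (SimplicialObject C) f) :
    simplicialHomotopyEquivalences C ((diag C).map f) := by
  obtain ⟨g, ⟨h⟩, ⟨h'⟩⟩ := hf
  refine ⟨(diag C).map g, ⟨?_⟩, ⟨?_⟩⟩
  · rw [← CategoryTheory.Functor.map_comp, ← CategoryTheory.Functor.map_id]
    exact diagHomotopy h
  · rw [← CategoryTheory.Functor.map_comp, ← CategoryTheory.Functor.map_id]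
    exact diagHomotopy h'

end HomotopyEquivalences

/-! ### The total complex of a simplicial homotopy equivalence -/

section TotalComplexHomotopy

variable {A : Type u} [Category.{v} A] [Preadditive A] [HasFiniteBiproducts A]
variable {J : MorphismProperty A} [J.IsMultiplicative]

/-- Evaluation in chain degree `p` keeps simplicial homotopies, so every row is an equivalence. -/
lemma localQis_simple_map {X Y : SimplicialObject (ChainComplex A ℕ)} {f : X ⟶ Y}
    (hf : simplicialHomotopyEquivalences (ChainComplex A ℕ) f) : localQis J ((simple A).map f) :=
  localQis_simple_of_rows f fun _ => localQis_alternatingFaceMapComplex_map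
    (simplicialHomotopyEquivalences_levelwise_map _ hf)

end TotalComplexHomotopy

/-! ### Functoriality in families that need not be simplicial -/

section LevelwiseFunctoriality

variable {A : Type u} [Category.{v} A] [Preadditive A] {D : Type u'} [Category.{v'} D]
  [Preadditive D]

open AlgebraicTopology

/-- The components of a functor `F` from simplicial objects to chain complexes are functorial with
respect to families of morphisms `X_n ⟶ Y_n` which are not necessarily compatible with the
simplicial structures. -/
structure LevelwiseFunctoriality (F : SimplicialObject D ⥤ ChainComplex A ℕ) where
  /-- the morphism induced by a family -/
  map {X Y : SimplicialObject D} (φ : ∀ n : ℕ, X _⦋n⦌ ⟶ Y _⦋n⦌) (q : ℕ) :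
    (F.obj X).X q ⟶ (F.obj Y).X q
  map_comp {X Y Z : SimplicialObject D} (φ : ∀ n : ℕ, X _⦋n⦌ ⟶ Y _⦋n⦌)
    (ψ : ∀ n : ℕ, Y _⦋n⦌ ⟶ Z _⦋n⦌) (q : ℕ) : map φ q ≫ map ψ q = map (fun n => φ n ≫ ψ n) q
  map_add {X Y : SimplicialObject D} (φ ψ : ∀ n : ℕ, X _⦋n⦌ ⟶ Y _⦋n⦌) (q : ℕ) :
    map (fun n => φ n + ψ n) q = map φ q + map ψ q
  map_app {X Y : SimplicialObject D} (f : X ⟶ Y) (q : ℕ) :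
    map (fun n => f.app (op ⦋n⦌)) q = (F.map f).f q

lemma LevelwiseFunctoriality.map_id {F : SimplicialObject D ⥤ ChainComplex A ℕ}
    (L : LevelwiseFunctoriality F) (X : SimplicialObject D) (q : ℕ) :
    L.map (fun n => 𝟙 (X _⦋n⦌)) q = 𝟙 _ := by
  have := L.map_app (𝟙 X) q
  simpa using this

/-- The functoriality of `K ∘ D` with respect to families of morphisms. -/
def diagFunctoriality (A : Type u) [Category.{v} A] [Preadditive A] :
    LevelwiseFunctoriality (diag A ⋙ alternatingFaceMapComplex A) where
  map φ q := (φ q).app (op ⦋q⦌)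
  map_comp _ _ _ := rfl
  map_add _ _ _ := rfl
  map_app _ _ := rfl

variable [HasFiniteBiproducts A]

/-- The morphism `(s X)_q ⟶ (s Y)_q` induced by a family of morphisms. -/
def simpleMapFamily {X Y : SimplicialObject (ChainComplex A ℕ)} (φ : ∀ n : ℕ, X _⦋n⦌ ⟶ Y _⦋n⦌)
    (q : ℕ) : ((simple A).obj X).X q ⟶ ((simple A).obj Y).X q :=
  simpleDesc fun n p h => (φ n).f p ≫ simpleι Y n p q h

lemma simpleι_mapFamily {X Y : SimplicialObject (ChainComplex A ℕ)}
    (φ : ∀ n : ℕ, X _⦋n⦌ ⟶ Y _⦋n⦌) (n p q : ℕ) (h : p + n = q) :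
    simpleι X n p q h ≫ simpleMapFamily φ q = (φ n).f p ≫ simpleι Y n p q h :=
  simpleι_desc _ _ _ _

lemma simpleMapFamily_comp {X Y Z : SimplicialObject (ChainComplex A ℕ)}
    (φ : ∀ n : ℕ, X _⦋n⦌ ⟶ Y _⦋n⦌) (ψ : ∀ n : ℕ, Y _⦋n⦌ ⟶ Z _⦋n⦌) (q : ℕ) :
    simpleMapFamily φ q ≫ simpleMapFamily ψ q = simpleMapFamily (fun n => φ n ≫ ψ n) q := by
  refine simple_hom_ext fun n p h => ?_
  rw [← Category.assoc, simpleι_mapFamily, Category.assoc, simpleι_mapFamily, simpleι_mapFamily]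
  simp

lemma simpleMapFamily_add {X Y : SimplicialObject (ChainComplex A ℕ)}
    (φ ψ : ∀ n : ℕ, X _⦋n⦌ ⟶ Y _⦋n⦌) (q : ℕ) :
    simpleMapFamily (fun n => φ n + ψ n) q = simpleMapFamily φ q + simpleMapFamily ψ q := by
  refine simple_hom_ext fun n p h => ?_
  rw [Preadditive.comp_add, simpleι_mapFamily, simpleι_mapFamily, simpleι_mapFamily]
  simp

lemma simpleMapFamily_app {X Y : SimplicialObject (ChainComplex A ℕ)} (f : X ⟶ Y) (q : ℕ) :
    simpleMapFamily (fun n => f.app (op ⦋n⦌)) q = ((simple A).map f).f q := by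
  refine simple_hom_ext fun n p h => ?_
  rw [simpleι_mapFamily, simpleι_map]

/-- The functoriality of the simple functor with respect to families of morphisms. -/
def simpleFunctoriality (A : Type u) [Category.{v} A] [Preadditive A] [HasFiniteBiproducts A] :
    LevelwiseFunctoriality (simple A) where
  map φ q := simpleMapFamily φ q
  map_comp := simpleMapFamily_comp
  map_add := simpleMapFamily_add
  map_app := simpleMapFamily_app

/-- The functoriality of `X ↦ s (n ↦ F X_n)` with respect to families of morphisms. -/
def levelwiseSimpleFunctoriality (F : D ⥤ ChainComplex A ℕ) [F.Additive] :
    LevelwiseFunctoriality (levelwise F ⋙ simple A) where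
  map {X Y} φ q := simpleMapFamily (X := (levelwise F).obj X) (Y := (levelwise F).obj Y)
    (fun n => F.map (φ n)) q
  map_comp {X Y Z} φ ψ q :=
    (simpleMapFamily_comp (X := (levelwise F).obj X) (Y := (levelwise F).obj Y)
      (Z := (levelwise F).obj Z) (fun n => F.map (φ n)) (fun n => F.map (ψ n)) q).trans (by
        congr 1
        funext n
        rw [F.map_comp]
        rfl)
  map_add {X Y} φ ψ q := by
    simp only [F.map_add]
    exact simpleMapFamily_add (X := (levelwise F).obj X) (Y := (levelwise F).obj Y)
      (fun n => F.map (φ n)) (fun n => F.map (ψ n)) q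
  map_app f q := simpleMapFamily_app ((levelwise F).map f) q

/-- The functoriality of `s ∘ D` with respect to families of morphisms. -/
def diagSimpleFunctoriality (A : Type u) [Category.{v} A] [Preadditive A]
    [HasFiniteBiproducts A] : LevelwiseFunctoriality (diag (ChainComplex A ℕ) ⋙ simple A) where
  map {X Y} φ q := simpleMapFamily (X := (diag _).obj X) (Y := (diag _).obj Y)
    (fun n => (φ n).app (op ⦋n⦌)) q
  map_comp {X Y Z} φ ψ q :=
    (simpleMapFamily_comp (X := (diag _).obj X) (Y := (diag _).obj Y) (Z := (diag _).obj Z)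
      (fun n => (φ n).app (op ⦋n⦌)) (fun n => (ψ n).app (op ⦋n⦌)) q)
  map_add {X Y} φ ψ q :=
    simpleMapFamily_add (X := (diag _).obj X) (Y := (diag _).obj Y)
      (fun n => (φ n).app (op ⦋n⦌)) (fun n => (ψ n).app (op ⦋n⦌)) q
  map_app f q := simpleMapFamily_app ((diag _).map f) q

instance simple_additive : (simple A).Additive where
  map_add {X Y f g} := by
    ext q
    rw [HomologicalComplex.add_f_apply, ← simpleMapFamily_app, ← simpleMapFamily_app,
      ← simpleMapFamily_app, ← simpleMapFamily_add]
    rfl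

instance alternatingFaceMapComplex_additive (A : Type u) [Category.{v} A] [Preadditive A] :
    (alternatingFaceMapComplex A).Additive where
  map_add := rfl

instance diag_additive (A : Type u) [Category.{v} A] [Preadditive A] : (diag A).Additive where
  map_add := rfl

instance levelwise_additive {D' : Type u''} [Category.{v''} D'] [Preadditive D'] (F : D ⥤ D')
    [F.Additive] : (levelwise F).Additive where
  map_add {X Y f g} := by
    ext n
    exact F.map_add

end LevelwiseFunctoriality

/-! ### Reversal of the simplicial order -/

section Symmetry

variable {A : Type u} [Category.{v} A] [Preadditive A] [HasFiniteBiproducts A]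

/-- The sign `(-1)^{n(n+1)/2}`. -/
def revSign (n : ℕ) : ℤ := ∏ i ∈ Finset.range n, (-1) ^ (i + 1)

lemma revSign_succ (n : ℕ) : revSign (n + 1) = revSign n * (-1) ^ (n + 1) := by
  rw [revSign, Finset.prod_range_succ, revSign]

lemma revSign_mul_self (n : ℕ) : revSign n * revSign n = 1 := by
  induction n with
  | zero => rfl
  | succ n ih =>
    rw [revSign_succ, mul_mul_mul_comm, ih, ← pow_add, Even.neg_one_pow ⟨n + 1, rfl⟩, one_mul]

-- Reversal exchanges the faces of indices `i` and `n + 1 - i`, whose signs differ by `(-1)^(n +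
-- 1)`.
omit [HasFiniteBiproducts A] in
lemma bdrySucc_opFunctor (X : SimplicialObject (ChainComplex A ℕ)) (n p : ℕ) :
    bdrySucc (SimplicialObject.opFunctor.obj X) n p = ((-1 : ℤ) ^ (n + 1)) • bdrySucc X n p := by
  have h1 : bdrySucc (SimplicialObject.opFunctor.obj X) n p =
      ∑ i : Fin (n + 2), ((-1 : ℤ) ^ (i : ℕ)) • (X.δ i.rev).f p := by
    refine (bdry_succ _ _ _).trans (Finset.sum_congr rfl fun i _ => ?_)
    rw [SimplicialObject.opFunctor_obj_δ]
    change _ • ((𝟙 (X _⦋n + 1⦌) ≫ X.δ i.rev ≫ 𝟙 (X _⦋n⦌)).f p) = _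
    rw [Category.id_comp, Category.comp_id]
    rfl
  have h2 : bdrySucc X n p = ∑ i : Fin (n + 2), ((-1 : ℤ) ^ (i : ℕ)) • (X.δ i).f p :=
    bdry_succ X n p
  rw [h1, h2, ← Equiv.sum_comp Fin.revPerm, Finset.smul_sum]
  refine Finset.sum_congr rfl fun i _ => ?_
  rw [Fin.revPerm_apply, Fin.rev_rev, smul_smul]
  congr 1
  have h3 : n + 1 = (i.rev : ℕ) + i := by
    rw [Fin.val_rev]
    omega
  rw [h3, pow_add, mul_assoc, ← pow_add _ (i : ℕ), Even.neg_one_pow ⟨_, rfl⟩, mul_one]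

/-- The isomorphism `s Υ X ⟶ s X`, in degree `q`. -/
def revHom (X : SimplicialObject (ChainComplex A ℕ)) (q : ℕ) :
    ((simple A).obj (SimplicialObject.opFunctor.obj X)).X q ⟶ ((simple A).obj X).X q :=
  simpleDesc (X := SimplicialObject.opFunctor.obj X)
    fun n p h => revSign n • simpleι X n p q h

/-- The inverse isomorphism `s X ⟶ s Υ X`, in degree `q`. -/
def revInv (X : SimplicialObject (ChainComplex A ℕ)) (q : ℕ) :
    ((simple A).obj X).X q ⟶ ((simple A).obj (SimplicialObject.opFunctor.obj X)).X q :=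
  simpleDesc (X := X)
    fun n p h => revSign n • simpleι (SimplicialObject.opFunctor.obj X) n p q h

/-- The inclusion of `X_{n,p}` as a summand of `s Υ X`. -/
def revι (X : SimplicialObject (ChainComplex A ℕ)) (n p q : ℕ) :
    (X _⦋n⦌).X p ⟶ ((simple A).obj (SimplicialObject.opFunctor.obj X)).X q :=
  simpleι₀ (SimplicialObject.opFunctor.obj X) n p q

lemma revι_hom (X : SimplicialObject (ChainComplex A ℕ)) (n p q : ℕ) :
    revι X n p q ≫ revHom X q = revSign n • simpleι₀ X n p q := by
  unfold revι simpleι₀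
  split_ifs with h
  · exact simpleι_desc (X := SimplicialObject.opFunctor.obj X) _ n p h
  · rw [smul_zero]
    exact zero_comp

lemma simpleι_revInv (X : SimplicialObject (ChainComplex A ℕ)) (n p q : ℕ) (h : p + n = q) :
    simpleι X n p q h ≫ revInv X q = revSign n • revι X n p q := by
  unfold revι
  rw [simpleι₀_eq _ _ _ _ h]
  exact simpleι_desc _ n p h

lemma rev_hom_ext {X : SimplicialObject (ChainComplex A ℕ)} {q : ℕ} {M : A}
    {f g : ((simple A).obj (SimplicialObject.opFunctor.obj X)).X q ⟶ M}
    (h : ∀ n p : ℕ, p + n = q → revι X n p q ≫ f = revι X n p q ≫ g) : f = g := by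
  refine simple_hom_ext (X := SimplicialObject.opFunctor.obj X) fun n p hn => ?_
  have h1 := h n p hn
  unfold revι at h1
  rw [simpleι₀_eq _ _ _ _ hn] at h1
  exact h1

lemma revι_d (X : SimplicialObject (ChainComplex A ℕ)) (n p q q' : ℕ) (h : p + n = q)
    (hq : q' + 1 = q) :
    revι X n p q ≫ ((simple A).obj (SimplicialObject.opFunctor.obj X)).d q q' =
      (X _⦋n⦌).d p (p - 1) ≫ revι X n (p - 1) q' +
      ((-1 : ℤ) ^ p) • ((-1 : ℤ) ^ n) • (bdry X n p ≫ revι X (n - 1) p q') := by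
  have h1 := simpleι_d (SimplicialObject.opFunctor.obj X) n p q q' h hq
  rw [← simpleι₀_eq] at h1
  refine h1.trans ?_
  congr 2
  cases n with
  | zero =>
    rw [bdry_zero, bdry_zero, zero_comp, zero_comp, smul_zero]
    rfl
  | succ n =>
    have h2 := bdrySucc_opFunctor X n p
    exact (congr_arg (fun φ => φ ≫ revι X n p q') h2).trans (Preadditive.zsmul_comp _ _ _)

/-- Reversal multiplies the simplicial boundary out of degree `n + 1` by `(-1)^(n + 1)`; the
recursion `revSign (n + 1) = revSign n * (-1)^(n + 1)` compensates for exactly this factor. -/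
lemma revHom_comm (X : SimplicialObject (ChainComplex A ℕ)) (q q' : ℕ) (hq : q' + 1 = q) :
    revHom X q ≫ ((simple A).obj X).d q q' =
      ((simple A).obj (SimplicialObject.opFunctor.obj X)).d q q' ≫ revHom X q' := by
  refine rev_hom_ext fun n p h => ?_
  rw [← Category.assoc, revι_hom, ← Category.assoc, revι_d X n p q q' h hq,
    simpleι₀_eq _ _ _ _ h, Preadditive.zsmul_comp, simpleι_d X n p q q' h hq,
    Preadditive.add_comp, Category.assoc, revι_hom, Preadditive.zsmul_comp,
    Preadditive.zsmul_comp, Category.assoc, revι_hom, Preadditive.comp_zsmul,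
    Preadditive.comp_zsmul, smul_add]
  congr 1
  cases n with
  | zero => rw [bdry_zero, zero_comp, smul_zero, smul_zero, smul_zero, smul_zero]
  | succ n =>
    rw [smul_smul, smul_smul, smul_smul, revSign_succ]
    congr 1
    rw [Nat.add_sub_cancel]
    ring

/-- The isomorphism `s Υ X ≅ s X`. -/
def revIso (X : SimplicialObject (ChainComplex A ℕ)) :
    (simple A).obj (SimplicialObject.opFunctor.obj X) ≅ (simple A).obj X :=
  HomologicalComplex.Hom.isoOfComponents
    (fun q =>
      { hom := revHom X q
        inv := revInv X q
        hom_inv_id := by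
          refine rev_hom_ext fun n p h => ?_
          rw [← Category.assoc, revι_hom, simpleι₀_eq _ _ _ _ h, Preadditive.zsmul_comp,
            simpleι_revInv, smul_smul, revSign_mul_self, one_smul, Category.comp_id]
        inv_hom_id := by
          refine simple_hom_ext fun n p h => ?_
          rw [← Category.assoc, simpleι_revInv, Preadditive.zsmul_comp, revι_hom,
            simpleι₀_eq _ _ _ _ h, smul_smul, revSign_mul_self, one_smul, Category.comp_id] })
    (fun q q' hq => revHom_comm X q q' hq)

lemma revIso_hom_naturality {X Y : SimplicialObject (ChainComplex A ℕ)} (f : X ⟶ Y) :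
    (simple A).map (SimplicialObject.opFunctor.map f) ≫ (revIso Y).hom =
      (revIso X).hom ≫ (simple A).map f := by
  ext q
  refine rev_hom_ext fun n p h => ?_
  have h1 : revι X n p q ≫ ((simple A).map (SimplicialObject.opFunctor.map f)).f q =
      (f.app (op ⦋n⦌)).f p ≫ revι Y n p q :=
    simpleι₀_map (SimplicialObject.opFunctor.map f) n p q
  change _ ≫ ((simple A).map (SimplicialObject.opFunctor.map f)).f q ≫ revHom Y q =
    _ ≫ revHom X q ≫ ((simple A).map f).f q
  rw [← Category.assoc, h1, Category.assoc, revι_hom, ← Category.assoc, revι_hom,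
    Preadditive.zsmul_comp, Preadditive.comp_zsmul, simpleι₀_map]

end Symmetry

/-! ### The augmentation `λ` and its homotopy inverse -/

section Augmentation

variable {A : Type u} [Category.{v} A] [Preadditive A] [HasFiniteBiproducts A]

/-- The natural section `ρ : Id ⟶ s (- × Δ)` of `λ`, the inclusion of the summand of simplicial
degree `0`. -/
def rhoChain (A : Type u) [Category.{v} A] [Preadditive A] [HasFiniteBiproducts A] :
    𝟭 (ChainComplex A ℕ) ⟶ SimplicialObject.const (ChainComplex A ℕ) ⋙ simple A where
  app B :=
    { f := fun q => constι B 0 q q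
      comm' := fun q q' hq => by
        obtain rfl : q' + 1 = q := hq
        refine (constι_d B 0 (q' + 1) (q' + 1) q' rfl rfl).trans ?_
        rw [constBdry_zero, zero_comp, smul_zero, add_zero]
        rfl }
  naturality B B' f := by
    ext q
    exact (constι_map f 0 q q).symm

lemma rhoChain_lamChain : rhoChain A ≫ lamChain A = 𝟙 _ := by
  ext B q
  exact constι_lamHom_zero B q

/-- All faces of `B × Δ` are identities, so in positive degree `∂` is an alternating sum of `n + 1`
copies of the identity. -/
lemma constBdry_eq (B : ChainComplex A ℕ) (n p : ℕ) :
    constBdry B n p = if n ≠ 0 ∧ Even n then 𝟙 _ else 0 := by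
  cases n with
  | zero => exact (constBdry_zero B p).trans (by simp)
  | succ n =>
    have h : constBdry B (n + 1) p = ∑ i : Fin (n + 2), ((-1 : ℤ) ^ (i : ℕ)) • 𝟙 (B.X p) :=
      bdry_succ ((SimplicialObject.const _).obj B) n p
    rw [h, ← Finset.sum_smul, Fin.sum_neg_one_pow]
    by_cases hn : Even n
    · rw [if_pos (by simpa [Nat.even_add_one] using hn),
        if_neg (by simpa [Nat.even_add_one] using hn), zero_smul]
    · rw [if_neg (by simpa [Nat.even_add_one] using hn),
        if_pos (by simpa [Nat.even_add_one] using hn), one_smul]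

/-- The contraction of the kernel of `λ`. -/
def lamHomotopyHom (B : ChainComplex A ℕ) (q : ℕ) :
    ((SimplicialObject.const _ ⋙ simple A).obj B).X q ⟶
      ((SimplicialObject.const _ ⋙ simple A).obj B).X (q + 1) :=
  simpleDesc (X := (SimplicialObject.const _).obj B) fun n p _ =>
    if Odd n then ((-1 : ℤ) ^ p) • constι B (n + 1) p (q + 1) else 0

lemma constι_lamHomotopyHom_odd (B : ChainComplex A ℕ) (n p q : ℕ) (hn : Odd n) (h : p + n = q) :
    constι B n p q ≫ lamHomotopyHom B q = ((-1 : ℤ) ^ p) • constι B (n + 1) p (q + 1) := by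
  unfold constι
  rw [simpleι₀_eq _ _ _ _ h]
  exact (simpleι_desc _ n p h).trans (if_pos hn)

lemma constι_lamHomotopyHom_even (B : ChainComplex A ℕ) (n p q : ℕ) (hn : Even n) :
    constι B n p q ≫ lamHomotopyHom B q = 0 := by
  unfold constι simpleι₀
  split_ifs with h
  · exact (simpleι_desc _ n p h).trans (if_neg (by simpa using hn))
  · exact zero_comp

/-- The boundary `∂` from an even positive degree to the odd degree below it is the identity, which
pairs off all summands of positive simplicial degree. On an even summand the identity arises from
`d` followed by the contraction. On an odd summand it arises in the other order, and the two terms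
with the internal differential cancel thanks to the sign `(-1)^p` of the contraction. -/
lemma constι_lamHomotopyHom_d_zero (B : ChainComplex A ℕ) (n p q : ℕ) (h : p + n = q + 1) :
    constι B n p (q + 1) ≫ (((SimplicialObject.const _ ⋙ simple A).obj B).d (q + 1) q ≫
        lamHomotopyHom B q + lamHomotopyHom B (q + 1) ≫
      ((SimplicialObject.const _ ⋙ simple A).obj B).d (q + 2) (q + 1)) =
      if n = 0 then 0 else constι B n p (q + 1) := by
  rw [Preadditive.comp_add, ← Category.assoc, ← Category.assoc,
    constι_d B n p (q + 1) q h rfl, Preadditive.add_comp, Preadditive.zsmul_comp,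
    Category.assoc, Category.assoc, constBdry_eq]
  rcases Nat.even_or_odd n with hn | hn
  · rw [constι_lamHomotopyHom_even _ _ _ _ hn, constι_lamHomotopyHom_even _ _ _ _ hn, zero_comp,
      add_zero]
    by_cases h0 : n = 0
    · subst h0
      simp
    · obtain ⟨m, rfl⟩ : ∃ m, n = m + 1 := ⟨n - 1, by omega⟩
      have hm : Odd m := by
        rw [Nat.even_add_one, Nat.not_even_iff_odd] at hn
        exact hn
      rw [if_pos ⟨h0, hn⟩, if_neg h0, Nat.add_sub_cancel,
        constι_lamHomotopyHom_odd _ _ _ _ hm (by omega), Category.id_comp, neg_one_pow_smul_smul,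
        comp_zero, zero_add]
  · have h0 : n ≠ 0 := by
      rintro rfl
      simp at hn
    rw [constι_lamHomotopyHom_odd _ _ _ _ hn h, if_neg (fun h' => by
      exact (Nat.not_even_iff_odd.2 hn) h'.2), if_neg h0, zero_comp, smul_zero, add_zero,
      Preadditive.zsmul_comp, constι_d B (n + 1) p (q + 2) (q + 1) (by omega) rfl,
      constBdry_eq, if_pos ⟨by omega, hn.add_one⟩, Nat.add_sub_cancel, Category.id_comp, smul_add,
      neg_one_pow_smul_smul, ← add_assoc, add_eq_right]
    cases p with
    | zero => rw [HomologicalComplex.shape _ 0 (0 - 1) (by simp), zero_comp, zero_comp, smul_zero,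
        add_zero]
    | succ p =>
      rw [Nat.add_sub_cancel, constι_lamHomotopyHom_odd _ _ _ _ hn (by omega),
        Preadditive.comp_zsmul, pow_succ, mul_neg, mul_one, neg_smul, add_neg_cancel]

lemma constι_lam_rho (B : ChainComplex A ℕ) (n p q : ℕ) (h : p + n = q) :
    constι B n p q ≫ ((lamChain A).app B ≫ (rhoChain A).app B).f q =
      if n = 0 then constι B n p q else 0 := by
  change _ ≫ lamHom B q ≫ constι B 0 q q = _
  split_ifs with hn
  · subst hn
    obtain rfl : p = q := h
    rw [← Category.assoc, constι_lamHom_zero, Category.id_comp]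
  · rw [← Category.assoc, constι_lamHom_pos _ _ _ _ hn, zero_comp]

/-- `ρ ∘ λ` is homotopic to the identity. -/
def lamHomotopy (B : ChainComplex A ℕ) :
    Homotopy (𝟙 _) ((lamChain A).app B ≫ (rhoChain A).app B) where
  hom i j := if h : i + 1 = j then lamHomotopyHom B i ≫ eqToHom (by rw [h]) else 0
  zero i j hij := dif_neg hij
  comm q := by
    rw [prevD_eq (w := show (ComplexShape.down ℕ).Rel (q + 1) q by simp)]
    refine const_hom_ext fun n p h => ?_
    rw [Preadditive.comp_add, constι_lam_rho B n p q h]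
    cases q with
    | zero =>
      obtain rfl : n = 0 := by omega
      rw [dNext_eq_zero _ _ (by simp), dif_pos rfl, eqToHom_refl, Category.comp_id, zero_add,
        ← Category.assoc, constι_lamHomotopyHom_even _ _ _ _ (by simp), zero_comp, zero_add,
        if_pos rfl]
      exact Category.comp_id _
    | succ q =>
      rw [dNext_eq (w := show (ComplexShape.down ℕ).Rel (q + 1) q by simp), dif_pos rfl,
        dif_pos rfl, eqToHom_refl, eqToHom_refl, Category.comp_id, Category.comp_id,
        constι_lamHomotopyHom_d_zero B n p q h]
      split_ifs
      · rw [zero_add]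
        exact Category.comp_id _
      · rw [add_zero]
        exact Category.comp_id _

lemma localQis_lamChain {J : MorphismProperty A} [J.IsMultiplicative] (B : ChainComplex A ℕ) :
    localQis J ((lamChain A).app B) :=
  localQis_of_homotopyEquiv J
    { hom := (lamChain A).app B
      inv := (rhoChain A).app B
      homotopyHomInvId := (lamHomotopy B).symm
      homotopyInvHomId := Homotopy.ofEq (congr_app rhoChain_lamChain B) }

end Augmentation

/-! ### Joins of ordinals -/

section Join

lemma σ_apply (n : ℕ) (k : Fin (n + 1)) (x : Fin (n + 2)) :
    ((SimplexCategory.Hom.toOrderHom (SimplexCategory.σ k) x : Fin (n + 1)) : ℕ) =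
      if x.1 ≤ k.1 then x.1 else x.1 - 1 := by
  change ((k.predAbove x : Fin (n + 1)) : ℕ) = _
  rw [Fin.predAbove]
  split_ifs with h1 h2 h2
  · exact absurd h2 (not_le.2 h1)
  · rfl
  · rfl
  · exact absurd (not_lt.1 h1) h2

/-- The join of two maps, as a map `[a] * [c] ⟶ [b] * [d]`. -/
def joinMap {a b c d : SimplexCategory} (f : a ⟶ b) (g : c ⟶ d) :
    ⦋a.len + c.len + 1⦌ ⟶ ⦋b.len + d.len + 1⦌ :=
  SimplexCategory.mkHom ⟨fun x =>
    if h : x.1 ≤ a.len then ⟨f.toOrderHom ⟨x.1, by omega⟩, by omega⟩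
    else ⟨b.len + 1 + g.toOrderHom ⟨x.1 - a.len - 1, by omega⟩, by omega⟩, fun x y hxy => by
    have hxy' : x.1 ≤ y.1 := hxy
    dsimp only
    split_ifs with hx hy hy
    · exact f.toOrderHom.monotone (show (⟨x.1, _⟩ : Fin (a.len + 1)) ≤ ⟨y.1, _⟩ from hxy')
    · simp only [Fin.mk_le_mk]
      omega
    · omega
    · have := g.toOrderHom.monotone (show (⟨x.1 - a.len - 1, by omega⟩ : Fin (c.len + 1)) ≤
        ⟨y.1 - a.len - 1, by omega⟩ from by simp only [Fin.mk_le_mk]; omega)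
      simp only [Fin.mk_le_mk]
      exact Nat.add_le_add_left this _⟩

lemma joinMap_apply_left {a b c d : SimplexCategory} (f : a ⟶ b) (g : c ⟶ d)
    (x : Fin (a.len + c.len + 2)) (h : x.1 ≤ a.len) :
    ((joinMap f g).toOrderHom x : ℕ) = f.toOrderHom ⟨x.1, by omega⟩ :=
  congr_arg Fin.val (dif_pos h)

lemma joinMap_apply_right {a b c d : SimplexCategory} (f : a ⟶ b) (g : c ⟶ d)
    (x : Fin (a.len + c.len + 2)) (h : ¬ x.1 ≤ a.len) :
    ((joinMap f g).toOrderHom x : ℕ) =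
      b.len + 1 + g.toOrderHom ⟨x.1 - a.len - 1, by omega⟩ :=
  congr_arg Fin.val (dif_neg h)

lemma joinMap_id (a c : SimplexCategory) : joinMap (𝟙 a) (𝟙 c) = 𝟙 _ := by
  refine hom_ext_val fun x => ?_
  by_cases h : x.1 ≤ a.len
  · exact joinMap_apply_left _ _ _ h
  · refine (joinMap_apply_right _ _ _ h).trans ?_
    change a.len + 1 + (x.1 - a.len - 1) = x.1
    omega

lemma joinMap_comp {a b a' c d c' : SimplexCategory} (f : a ⟶ b) (f' : b ⟶ a') (g : c ⟶ d)
    (g' : d ⟶ c') : joinMap (f ≫ f') (g ≫ g') = joinMap f g ≫ joinMap f' g' := by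
  refine hom_ext_val fun x => ?_
  rw [comp_apply]
  by_cases h : x.1 ≤ a.len
  · have h1 := joinMap_apply_left f g x h
    have h2 : ((joinMap f g).toOrderHom x).1 ≤ b.len := by omega
    refine (joinMap_apply_left _ _ _ h).trans (Eq.trans ?_ (joinMap_apply_left f' g' _ h2).symm)
    simp only [h1]
    rfl
  · have h1 := joinMap_apply_right f g x h
    have h2 : ¬ ((joinMap f g).toOrderHom x).1 ≤ b.len := by omega
    refine (joinMap_apply_right _ _ _ h).trans (Eq.trans ?_ (joinMap_apply_right f' g' _ h2).symm)
    have h3 : ((joinMap f g).toOrderHom x).1 - b.len - 1 =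
      g.toOrderHom ⟨x.1 - a.len - 1, by omega⟩ := by omega
    simp only [h3]
    rfl

/-- The inclusion `[a] ⟶ [a] * [c]`. -/
def joinInl (a c : SimplexCategory) : a ⟶ ⦋a.len + c.len + 1⦌ :=
  SimplexCategory.Hom.mk ⟨fun x => ⟨x.1, by change _ < a.len + c.len + 1 + 1; omega⟩, fun _ _ h => h⟩

/-- The inclusion `[c] ⟶ [a] * [c]`. -/
def joinInr (a c : SimplexCategory) : c ⟶ ⦋a.len + c.len + 1⦌ :=
  SimplexCategory.Hom.mk ⟨fun x => ⟨a.len + 1 + x.1, by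
      change _ < a.len + c.len + 1 + 1; omega⟩,
    fun _ _ h => Nat.add_le_add_left h _⟩

/-- The map `[a] * [c] ⟶ [a]` which sends `[c]` to the last element. -/
def joinFst (a c : SimplexCategory) : ⦋a.len + c.len + 1⦌ ⟶ a :=
  SimplexCategory.Hom.mk ⟨fun x => ⟨min x.1 a.len, by omega⟩,
    fun x y h => by
      have : x.1 ≤ y.1 := h
      simp only [Fin.mk_le_mk]
      omega⟩

/-- The map `[a] * [c] ⟶ [c]` which sends `[a]` to the first element. -/
def joinSnd (a c : SimplexCategory) : ⦋a.len + c.len + 1⦌ ⟶ c :=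
  SimplexCategory.Hom.mk ⟨fun x => ⟨x.1 - a.len - 1, by
      have := x.2; change x.1 < a.len + c.len + 1 + 1 at this; omega⟩,
    fun x y h => by
      have : x.1 ≤ y.1 := h
      simp only [Fin.mk_le_mk]
      omega⟩

lemma hom_ext_apply {a b : SimplexCategory} {f g : a ⟶ b}
    (h : ∀ x, (f.toOrderHom x : ℕ) = g.toOrderHom x) : f = g := by
  ext x : 3
  exact Fin.ext (h x)

lemma joinInl_fst (a c : SimplexCategory) : joinInl a c ≫ joinFst a c = 𝟙 a :=
  hom_ext_apply fun x => by
    change min x.1 a.len = x.1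
    omega

lemma joinInr_snd (a c : SimplexCategory) : joinInr a c ≫ joinSnd a c = 𝟙 c :=
  hom_ext_apply fun x => by
    change a.len + 1 + x.1 - a.len - 1 = x.1
    omega

lemma joinInl_map {a b c d : SimplexCategory} (f : a ⟶ b) (g : c ⟶ d) :
    joinInl a c ≫ joinMap f g = f ≫ joinInl b d :=
  hom_ext_apply fun x => joinMap_apply_left f g _ (by
    change x.1 ≤ a.len
    omega)

lemma joinInr_map {a b c d : SimplexCategory} (f : a ⟶ b) (g : c ⟶ d) :
    joinInr a c ≫ joinMap f g = g ≫ joinInr b d :=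
  hom_ext_apply fun x => by
    refine (joinMap_apply_right f g _ (by
      change ¬ (a.len + 1 + x.1 ≤ a.len)
      omega)).trans ?_
    change b.len + 1 + _ = b.len + 1 + _
    congr 3
    exact Fin.ext (by change a.len + 1 + x.1 - a.len - 1 = x.1; omega)

/-- `joinFst` is natural in the second factor only: a map of the first factor need not preserve the
last element. -/
lemma joinMap_fst {a c d : SimplexCategory} (g : c ⟶ d) :
    joinMap (𝟙 a) g ≫ joinFst a d = joinFst a c :=
  hom_ext_apply fun x => by
    change min ((joinMap (𝟙 a) g).toOrderHom x : ℕ) a.len = min x.1 a.len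
    by_cases h : x.1 ≤ a.len
    · rw [joinMap_apply_left _ _ _ h]
      rfl
    · rw [joinMap_apply_right _ _ _ h]
      omega

/-- `joinSnd` is natural in the first factor only, since a map of the second factor need not
preserve the first element. This is why the section of the augmentation of the resolution is not
simplicial in the second index. -/
lemma joinMap_snd {a b c : SimplexCategory} (f : a ⟶ b) :
    joinMap f (𝟙 c) ≫ joinSnd b c = joinSnd a c :=
  hom_ext_apply fun x => by
    change ((joinMap f (𝟙 c)).toOrderHom x : ℕ) - b.len - 1 = x.1 - a.len - 1
    by_cases h : x.1 ≤ a.len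
    · rw [joinMap_apply_left _ _ _ h]
      omega
    · rw [joinMap_apply_right _ _ _ h]
      change b.len + 1 + (x.1 - a.len - 1) - b.len - 1 = x.1 - a.len - 1
      omega

/-- Formulas of this kind turn the identities of the simplicial contractions of joins into
comparisons of natural numbers. -/
lemma joinMap_δ_id (a c : ℕ) (i : Fin (a + 2)) (x : Fin (a + c + 2)) :
    ((joinMap (SimplexCategory.δ i) (𝟙 ⦋c⦌)).toOrderHom x : ℕ) =
      if x.1 < i.1 then x.1 else x.1 + 1 := by
  by_cases h : x.1 ≤ a
  · exact (joinMap_apply_left (SimplexCategory.δ i) (𝟙 ⦋c⦌) x h).trans (δ_apply _ _ _)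
  · refine (joinMap_apply_right (SimplexCategory.δ i) (𝟙 ⦋c⦌) x h).trans ?_
    change a + 1 + 1 + (x.1 - a - 1) = _
    rw [if_neg (by omega)]
    omega

lemma joinMap_id_δ (a c : ℕ) (i : Fin (c + 2)) (x : Fin (a + c + 2)) :
    ((joinMap (𝟙 ⦋a⦌) (SimplexCategory.δ i)).toOrderHom x : ℕ) =
      if x.1 < a + 1 + i.1 then x.1 else x.1 + 1 := by
  by_cases h : x.1 ≤ a
  · refine (joinMap_apply_left (𝟙 ⦋a⦌) (SimplexCategory.δ i) x h).trans ?_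
    change x.1 = _
    rw [if_pos (by omega)]
  · refine (joinMap_apply_right (𝟙 ⦋a⦌) (SimplexCategory.δ i) x h).trans ?_
    rw [δ_apply]
    change a + 1 + (if x.1 - a - 1 < i.1 then x.1 - a - 1 else x.1 - a - 1 + 1) = _
    split_ifs <;> omega

lemma joinMap_σ_id (a c : ℕ) (i : Fin (a + 1)) (x : Fin (a + 1 + c + 2)) :
    ((joinMap (SimplexCategory.σ i) (𝟙 ⦋c⦌)).toOrderHom x : ℕ) =
      if x.1 ≤ i.1 then x.1 else x.1 - 1 := by
  by_cases h : x.1 ≤ a + 1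
  · exact (joinMap_apply_left (SimplexCategory.σ i) (𝟙 ⦋c⦌) x h).trans (σ_apply _ _ _)
  · refine (joinMap_apply_right (SimplexCategory.σ i) (𝟙 ⦋c⦌) x h).trans ?_
    change a + 1 + (x.1 - (a + 1) - 1) = _
    rw [if_neg (by omega)]
    omega

lemma joinMap_id_σ (a c : ℕ) (i : Fin (c + 1)) (x : Fin (a + (c + 1) + 2)) :
    ((joinMap (𝟙 ⦋a⦌) (SimplexCategory.σ i)).toOrderHom x : ℕ) =
      if x.1 ≤ a + 1 + i.1 then x.1 else x.1 - 1 := by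
  by_cases h : x.1 ≤ a
  · refine (joinMap_apply_left (𝟙 ⦋a⦌) (SimplexCategory.σ i) x h).trans ?_
    change x.1 = _
    rw [if_pos (by omega)]
  · refine (joinMap_apply_right (𝟙 ⦋a⦌) (SimplexCategory.σ i) x h).trans ?_
    rw [σ_apply]
    change a + 1 + (if x.1 - a - 1 ≤ i.1 then x.1 - a - 1 else x.1 - a - 1 - 1) = _
    split_ifs <;> omega

/-- The maps `[a] * [c + 1] ⟶ [a] * [c]` of the contraction of `[a] * [c]` to `[a]`: the elements
`0, …, i` of `[c + 1]` are sent to the last element of `[a]`. -/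
def contractRight (a c i : ℕ) : ⦋a + (c + 1) + 1⦌ ⟶ ⦋a + c + 1⦌ :=
  SimplexCategory.mkHom ⟨fun x => ⟨if x.1 ≤ a then x.1 else if x.1 ≤ a + 1 + i then a else x.1 - 1,
    by grind⟩, fun x y h => by
    have : x.1 ≤ y.1 := h
    simp only [Fin.mk_le_mk]
    grind⟩

lemma contractRight_apply (a c i : ℕ) (x : Fin (a + (c + 1) + 2)) :
    ((contractRight a c i).toOrderHom x : ℕ) =
      if x.1 ≤ a then x.1 else if x.1 ≤ a + 1 + i then a else x.1 - 1 := rfl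

/-- The maps `[a + 1] * [c] ⟶ [a] * [c]` of the contraction of `[a] * [c]` to `[c]`: the elements
`i + 1, …, a + 1` of `[a + 1]` are sent to the first element of `[c]`. -/
def contractLeft (a c i : ℕ) : ⦋a + 1 + c + 1⦌ ⟶ ⦋a + c + 1⦌ :=
  SimplexCategory.mkHom ⟨fun x => ⟨if x.1 ≤ i ∧ x.1 ≤ a then x.1 else if x.1 ≤ a + 1 then a + 1 else x.1 - 1,
    by grind⟩, fun x y h => by
    have : x.1 ≤ y.1 := h
    simp only [Fin.mk_le_mk]
    grind⟩

lemma contractLeft_apply (a c i : ℕ) (x : Fin (a + 1 + c + 2)) :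
    ((contractLeft a c i).toOrderHom x : ℕ) =
      if x.1 ≤ i ∧ x.1 ≤ a then x.1 else if x.1 ≤ a + 1 then a + 1 else x.1 - 1 := rfl

end Join

/-! ### The bisimplicial resolution by joins -/

section Resolution

variable {D : Type u'} [Category.{v'} D]

/-- The bisimplicial object `(k, n) ↦ Z ([k] * [n])`. -/
def joinObj (Z : SimplicialObject D) : SimplicialObject (SimplicialObject D) where
  obj k :=
    { obj := fun n => Z.obj (op ⦋k.unop.len + n.unop.len + 1⦌)
      map := fun g => Z.map (joinMap (𝟙 k.unop) g.unop).op
      map_id := fun n => by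
        rw [unop_id, joinMap_id, op_id, Z.map_id]
      map_comp := fun g g' => by
        rw [← Z.map_comp, ← op_comp, ← joinMap_comp, Category.comp_id, unop_comp] }
  map {k k'} f :=
    { app := fun n => Z.map (joinMap f.unop (𝟙 n.unop)).op
      naturality := fun n n' g => by
        rw [← Z.map_comp, ← op_comp, ← joinMap_comp, ← Z.map_comp, ← op_comp, ← joinMap_comp]
        simp only [Category.id_comp, Category.comp_id] }
  map_id k := by
    ext n
    change Z.map (joinMap (𝟙 _) (𝟙 _)).op = 𝟙 _
    rw [joinMap_id, op_id, Z.map_id]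
  map_comp f f' := by
    ext n
    change Z.map (joinMap (_ ≫ _) (𝟙 _)).op = Z.map _ ≫ Z.map _
    rw [← Z.map_comp, ← op_comp, ← joinMap_comp, Category.comp_id]

/-- The augmentation `Z ([k] * [n]) ⟶ Z_n`. -/
def joinObjSnd (Z : SimplicialObject D) : joinObj Z ⟶ (constOuter D).obj Z where
  app k :=
    { app := fun n => Z.map (joinInr k.unop n.unop).op
      naturality := fun n n' g => by
        change Z.map _ ≫ Z.map _ = Z.map _ ≫ Z.map g
        rw [← Z.map_comp, ← op_comp, joinInr_map, op_comp, Z.map_comp]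
        rfl }
  naturality k k' f := by
    ext n
    change Z.map _ ≫ Z.map _ = Z.map _ ≫ 𝟙 _
    rw [← Z.map_comp, ← op_comp, joinInr_map, Category.id_comp, Category.comp_id]

/-- The augmentation `Z ([k] * [n]) ⟶ Z_k`. -/
def joinObjFst (Z : SimplicialObject D) (k : SimplexCategoryᵒᵖ) :
    (joinObj Z).obj k ⟶ (SimplicialObject.const D).obj (Z.obj k) where
  app n := Z.map (joinInl k.unop n.unop).op
  naturality n n' g := by
    change Z.map _ ≫ Z.map _ = Z.map _ ≫ 𝟙 _
    rw [← Z.map_comp, ← op_comp, joinInl_map, Category.id_comp, Category.comp_id]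

/-- The section `Z_k ⟶ Z ([k] * [n])` of `joinObjFst`. -/
def joinObjFstSection (Z : SimplicialObject D) (k : SimplexCategoryᵒᵖ) :
    (SimplicialObject.const D).obj (Z.obj k) ⟶ (joinObj Z).obj k where
  app n := Z.map (joinFst k.unop n.unop).op
  naturality n n' g := by
    change 𝟙 _ ≫ Z.map _ = Z.map _ ≫ Z.map _
    rw [← Z.map_comp, ← op_comp, joinMap_fst, Category.id_comp]

lemma joinObjFstSection_fst (Z : SimplicialObject D) (k : SimplexCategoryᵒᵖ) :
    joinObjFstSection Z k ≫ joinObjFst Z k = 𝟙 _ := by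
  ext n
  change Z.map _ ≫ Z.map _ = 𝟙 _
  rw [← Z.map_comp, ← op_comp, joinInl_fst, op_id, Z.map_id]

lemma map_op_comp_eq {Z : SimplicialObject D} {a b b' c : SimplexCategory} {f : a ⟶ b}
    {g : b ⟶ c} {f' : a ⟶ b'} {g' : b' ⟶ c} (h : f ≫ g = f' ≫ g') :
    Z.map g.op ≫ Z.map f.op = Z.map g'.op ≫ Z.map f'.op := by
  rw [← Z.map_comp, ← Z.map_comp, ← op_comp, ← op_comp, h]

lemma map_op_comp_eq' {Z : SimplicialObject D} {a b c : SimplexCategory} {f : a ⟶ b}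
    {g : b ⟶ c} {f' : a ⟶ c} (h : f ≫ g = f') :
    Z.map g.op ≫ Z.map f.op = Z.map f'.op := by
  rw [← Z.map_comp, ← op_comp, h]

/-- The contraction of `n ↦ Z ([k] * [n])` to `Z_k`. -/
def joinObjFstHomotopy (Z : SimplicialObject D) (k : ℕ) :
    SimplicialObject.Homotopy (joinObjFst Z (op ⦋k⦌) ≫ joinObjFstSection Z (op ⦋k⦌)) (𝟙 _) where
  h {n} i := Z.map (contractRight k n i).op
  h_zero_comp_δ_zero n := by
    -- The omitted first element of `[n + 1]` is the only one of `[n + 1]` that `contractRight k n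
    -- 0` sends into `[k]`, so the composite is the identity.
    refine (map_op_comp_eq' (f' := 𝟙 _) (hom_ext_val fun x => ?_)).trans (Z.map_id _)
    rw [comp_apply, contractRight_apply]
    erw [joinMap_id_δ]
    change _ = x.1
    simp only [Fin.val_zero]
    grind
  h_last_comp_δ_last n := by
    -- Once the last element of `[n + 1]` is omitted, all the remaining ones go to the last element
    -- of `[k]`.
    refine map_op_comp_eq (Z := Z) (hom_ext_val fun x => ?_)
    rw [comp_apply, contractRight_apply]
    erw [joinMap_id_δ]
    change _ = min x.1 k
    simp only [Fin.val_last]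
    grind
  h_succ_comp_δ_castSucc_of_lt {n} i j hij := by
    refine map_op_comp_eq (Z := Z) (hom_ext_val fun x => ?_)
    have hij' : i.1 ≤ j.1 := hij
    have hx := x.2
    rw [comp_apply, comp_apply, contractRight_apply]
    erw [joinMap_id_δ, joinMap_id_δ, contractRight_apply]
    simp only [Fin.val_castSucc, Fin.val_succ]
    grind
  h_succ_comp_δ_castSucc_succ {n} j := by
    refine map_op_comp_eq (Z := Z) (hom_ext_val fun x => ?_)
    have hx := x.2
    rw [comp_apply, comp_apply, contractRight_apply, contractRight_apply]
    erw [joinMap_id_δ]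
    simp only [Fin.val_castSucc, Fin.val_succ]
    grind
  h_castSucc_comp_δ_succ_of_lt {n} i j hji := by
    refine map_op_comp_eq (Z := Z) (hom_ext_val fun x => ?_)
    have hij' : j.1 < i.1 := hji
    have hx := x.2
    rw [comp_apply, comp_apply, contractRight_apply]
    erw [joinMap_id_δ, joinMap_id_δ, contractRight_apply]
    simp only [Fin.val_castSucc, Fin.val_succ]
    grind
  h_comp_σ_castSucc_of_le {n} i j hij := by
    refine map_op_comp_eq (Z := Z) (hom_ext_val fun x => ?_)
    have hij' : i.1 ≤ j.1 := hij
    have hx := x.2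
    rw [comp_apply, comp_apply, contractRight_apply]
    erw [joinMap_id_σ, joinMap_id_σ, contractRight_apply]
    simp only [Fin.val_castSucc, Fin.val_succ]
    grind
  h_comp_σ_succ_of_lt {n} i j hji := by
    refine map_op_comp_eq (Z := Z) (hom_ext_val fun x => ?_)
    have hij' : j.1 ≤ i.1 := hji
    have hx := x.2
    rw [comp_apply, comp_apply, contractRight_apply]
    erw [joinMap_id_σ, joinMap_id_σ, contractRight_apply]
    simp only [Fin.val_castSucc, Fin.val_succ]
    grind

lemma simplicialHomotopyEquivalences_joinObjFst (Z : SimplicialObject D) (k : ℕ) :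
    simplicialHomotopyEquivalences D (joinObjFst Z (op ⦋k⦌)) := by
  refine ⟨joinObjFstSection Z (op ⦋k⦌), ⟨joinObjFstHomotopy Z k⟩, ⟨?_⟩⟩
  rw [joinObjFstSection_fst]
  exact SimplicialObject.Homotopy.refl _

end Resolution

/-! ### Two out of three -/

section TwoOutOfThree

variable {A : Type u} [Category.{v} A] [Preadditive A] {J : MorphismProperty A}
  [J.IsMultiplicative] {C D E : ChainComplex A ℕ} {f : C ⟶ D} {g : D ⟶ E}

/-- For surjectivity, the image of `y` in `E` is lifted through `f ≫ g`, and the image of the lift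
in `D` is compared with `y` by injectivity of `g`. -/
lemma localQis.of_comp_right (hfg : localQis J (f ≫ g)) (hg : localQis J g) : localQis J f := by
  refine localQis_of_inj_of_surj J (fun m T x y hx hxy => ?_) (fun m T y hy => ?_)
  · exact hfg.localInj m x (y ≫ g.f (m + 1)) hx (by
      rw [HomologicalComplex.comp_f, reassoc_of% hxy, Category.assoc, g.comm])
  · obtain ⟨T₁, π₁, hπ₁, x₁, y₁, hx₁, hy₁⟩ := hfg.localSurj m (y ≫ g.f m)
      (by rw [Category.assoc, g.comm, reassoc_of% hy, zero_comp])
    obtain ⟨T₂, π₂, hπ₂, x₂, hx₂⟩ := hg.localInj m (x₁ ≫ f.f m - π₁ ≫ y) y₁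
      (by rw [Preadditive.sub_comp, Category.assoc, Category.assoc, hy, f.comm, reassoc_of% hx₁,
        zero_comp, comp_zero, sub_zero])
      (by
        rw [HomologicalComplex.comp_f] at hy₁
        rw [Preadditive.sub_comp, Category.assoc, hy₁, Category.assoc, add_sub_cancel_left])
    refine ⟨T₂, π₂ ≫ π₁, J.comp_mem _ _ hπ₂ hπ₁, π₂ ≫ x₁, x₂, ?_, ?_⟩
    · rw [Category.assoc, hx₁, comp_zero]
    · rw [hx₂, Preadditive.comp_sub, Category.assoc, Category.assoc, add_sub_cancel]

/-- For injectivity, the cycle in `D` is replaced by one coming from `C`, using surjectivity of `f`,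
and then injectivity of `f ≫ g` applies. -/
lemma localQis.of_comp_left (hfg : localQis J (f ≫ g)) (hf : localQis J f) : localQis J g := by
  refine localQis_of_inj_of_surj J (fun m T y e hy hye => ?_) (fun m T y hy => ?_)
  · obtain ⟨T₁, π₁, hπ₁, x₁, y₁, hx₁, hy₁⟩ := hf.localSurj m y hy
    obtain ⟨T₂, π₂, hπ₂, x₂, hx₂⟩ := hfg.localInj m x₁ (π₁ ≫ e + y₁ ≫ g.f (m + 1)) hx₁ (by
      rw [HomologicalComplex.comp_f, reassoc_of% hy₁, Preadditive.add_comp, Preadditive.add_comp,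
        Category.assoc, hye, Category.assoc, Category.assoc, Category.assoc, g.comm])
    refine ⟨T₂, π₂ ≫ π₁, J.comp_mem _ _ hπ₂ hπ₁, x₂ ≫ f.f (m + 1) - π₂ ≫ y₁, ?_⟩
    rw [Preadditive.sub_comp, Category.assoc, f.comm, reassoc_of% hx₂, hy₁]
    simp
  · obtain ⟨T₁, π₁, hπ₁, x₁, y₁, hx₁, hy₁⟩ := hfg.localSurj m y hy
    refine ⟨T₁, π₁, hπ₁, x₁ ≫ f.f m, y₁, ?_, ?_⟩
    · rw [Category.assoc, f.comm, reassoc_of% hx₁, zero_comp]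
    · rw [Category.assoc]
      exact hy₁

end TwoOutOfThree

/-! ### A generalized Eilenberg–Zilber theorem -/

section EilenbergZilber

open AlgebraicTopology

variable {A : Type u} [Category.{v} A] [Preadditive A] {D : Type u'} [Category.{v'} D]
  [Preadditive D] {F : SimplicialObject D ⥤ ChainComplex A ℕ} (L : LevelwiseFunctoriality F)
  (Z : SimplicialObject D) (q : ℕ)

/-- The simplicial object `k ↦ F (n ↦ Z ([k] * [n]))_q`. -/
abbrev joinRow (F : SimplicialObject D ⥤ ChainComplex A ℕ) (Z : SimplicialObject D) (q : ℕ) :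
    SimplicialObject A :=
  (levelwise (HomologicalComplex.eval A (ComplexShape.down ℕ) q)).obj
    ((levelwise F).obj (joinObj Z))

/-- The constant simplicial object `F (Z)_q`. -/
abbrev constRow (F : SimplicialObject D ⥤ ChainComplex A ℕ) (Z : SimplicialObject D) (q : ℕ) :
    SimplicialObject A :=
  (levelwise (HomologicalComplex.eval A (ComplexShape.down ℕ) q)).obj
    ((levelwise F).obj ((constOuter D).obj Z))

/-- The morphism induced by a family of maps `[k'] * [n] ⟶ [k] * [n]`. -/
def joinRowMap {k k' : ℕ} (φ : ∀ n : ℕ, ⦋k' + n + 1⦌ ⟶ ⦋k + n + 1⦌) :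
    (joinRow F Z q) _⦋k⦌ ⟶ (joinRow F Z q) _⦋k'⦌ :=
  L.map (X := (joinObj Z).obj (op ⦋k⦌)) (Y := (joinObj Z).obj (op ⦋k'⦌))
    (fun n => Z.map (φ n).op) q

lemma joinRowMap_comp {k k' k'' : ℕ} (φ : ∀ n : ℕ, ⦋k' + n + 1⦌ ⟶ ⦋k + n + 1⦌)
    (ψ : ∀ n : ℕ, ⦋k'' + n + 1⦌ ⟶ ⦋k' + n + 1⦌) :
    joinRowMap L Z q φ ≫ joinRowMap L Z q ψ = joinRowMap L Z q fun n => ψ n ≫ φ n := by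
  refine (L.map_comp _ _ q).trans ?_
  unfold joinRowMap
  congr 1
  funext n
  exact (Z.map_comp _ _).symm

lemma joinRowMap_id (k : ℕ) :
    joinRowMap L Z q (fun n => 𝟙 ⦋k + n + 1⦌) = 𝟙 _ := by
  refine Eq.trans ?_ (L.map_id ((joinObj Z).obj (op ⦋k⦌)) q)
  unfold joinRowMap
  congr 1
  funext n
  exact Z.map_id _

lemma joinRow_δ {k : ℕ} (j : Fin (k + 2)) :
    (joinRow F Z q).δ j =
      joinRowMap L Z q fun n => joinMap (SimplexCategory.δ j) (𝟙 ⦋n⦌) :=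
  (L.map_app ((joinObj Z).δ j) q).symm

lemma joinRow_σ {k : ℕ} (j : Fin (k + 1)) :
    (joinRow F Z q).σ j =
      joinRowMap L Z q fun n => joinMap (SimplexCategory.σ j) (𝟙 ⦋n⦌) :=
  (L.map_app ((joinObj Z).σ j) q).symm

/-- The augmentation of the simplicial object `k ↦ F (n ↦ Z ([k] * [n]))_q`. -/
abbrev joinRowSnd (F : SimplicialObject D ⥤ ChainComplex A ℕ) (Z : SimplicialObject D) (q : ℕ) :
    joinRow F Z q ⟶ constRow F Z q :=
  (levelwise (HomologicalComplex.eval A (ComplexShape.down ℕ) q)).map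
    ((levelwise F).map (joinObjSnd Z))

lemma joinRowSnd_app (k : SimplexCategoryᵒᵖ) :
    (joinRowSnd F Z q).app k = L.map (X := (joinObj Z).obj k) (Y := Z)
      (fun n => Z.map (joinInr k.unop ⦋n⦌).op) q :=
  (L.map_app ((joinObjSnd Z).app k) q).symm

/-- The section of the augmentation given by the maps `[k] * [n] ⟶ [n]`. -/
def joinRowSection : constRow F Z q ⟶ joinRow F Z q where
  app k := L.map (X := Z) (Y := (joinObj Z).obj k) (fun n => Z.map (joinSnd k.unop ⦋n⦌).op) q
  naturality k k' f := by
    have h1 : (joinRow F Z q).map f = L.map (fun n => ((joinObj Z).map f).app (op ⦋n⦌)) q :=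
      (L.map_app ((joinObj Z).map f) q).symm
    have h2 : (constRow F Z q).map f = L.map (fun n => 𝟙 (Z _⦋n⦌)) q := by
      refine Eq.trans ?_ (L.map_id Z q).symm
      exact congr_arg (fun φ => HomologicalComplex.Hom.f φ q) (F.map_id Z)
    rw [h1, h2]
    refine (L.map_comp _ _ q).trans (Eq.trans ?_ (L.map_comp _ _ q).symm)
    congr 1
    funext n
    change 𝟙 _ ≫ Z.map _ = Z.map _ ≫ Z.map _
    rw [← Z.map_comp, ← op_comp, joinMap_snd, Category.id_comp]

lemma joinRowSection_snd : joinRowSection L Z q ≫ joinRowSnd F Z q = 𝟙 _ := by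
  ext k
  rw [NatTrans.comp_app, joinRowSnd_app L]
  refine (L.map_comp _ _ q).trans (Eq.trans ?_ (L.map_id Z q))
  congr 1
  funext n
  change Z.map _ ≫ Z.map _ = _
  rw [← Z.map_comp, ← op_comp, joinInr_snd, op_id, Z.map_id]

lemma joinRowSnd_section_app (k : ℕ) :
    (joinRowSnd F Z q ≫ joinRowSection L Z q).app (op ⦋k⦌) =
      joinRowMap L Z q fun n => joinSnd ⦋k⦌ ⦋n⦌ ≫ joinInr ⦋k⦌ ⦋n⦌ := by
  rw [NatTrans.comp_app, joinRowSnd_app L]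
  refine (L.map_comp _ _ q).trans ?_
  unfold joinRowMap
  congr 1
  funext n
  exact (Z.map_comp _ _).symm

/-- The contraction of the augmented simplicial object `k ↦ F (n ↦ Z ([k] * [n]))_q`. -/
def joinRowHomotopy :
    SimplicialObject.Homotopy (𝟙 _) (joinRowSnd F Z q ≫ joinRowSection L Z q) where
  h {k} i := joinRowMap L Z q fun n => contractLeft k n i
  h_zero_comp_δ_zero k := by
    -- `contractLeft k n 0` keeps only the element `0` of `[k + 1]` in `[k]`. When that is omitted,
    -- all of `[k]` collapses to the first element of `[n]`, as prescribed by the section.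
    rw [joinRow_δ L, joinRowMap_comp, joinRowSnd_section_app]
    congr 1
    funext n
    refine hom_ext_val fun x => ?_
    rw [comp_apply, contractLeft_apply]
    erw [joinMap_δ_id]
    change _ = k + 1 + (x.1 - k - 1)
    simp only [Fin.val_zero]
    grind
  h_last_comp_δ_last k := by
    rw [joinRow_δ L, joinRowMap_comp]
    refine Eq.trans ?_ (joinRowMap_id L Z q k)
    congr 1
    funext n
    refine hom_ext_val fun x => ?_
    rw [comp_apply, contractLeft_apply]
    erw [joinMap_δ_id]
    change _ = x.1
    simp only [Fin.val_last]
    grind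
  h_succ_comp_δ_castSucc_of_lt {k} i j hij := by
    rw [joinRow_δ L, joinRow_δ L, joinRowMap_comp, joinRowMap_comp]
    congr 1
    funext n
    refine hom_ext_val fun x => ?_
    have hij' : i.1 ≤ j.1 := hij
    have hx := x.2
    rw [comp_apply, comp_apply, contractLeft_apply]
    erw [joinMap_δ_id, joinMap_δ_id, contractLeft_apply]
    simp only [Fin.val_castSucc, Fin.val_succ]
    grind
  h_succ_comp_δ_castSucc_succ {k} j := by
    rw [joinRow_δ L, joinRowMap_comp, joinRowMap_comp]
    congr 1
    funext n
    refine hom_ext_val fun x => ?_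
    have hx := x.2
    rw [comp_apply, comp_apply, contractLeft_apply, contractLeft_apply]
    erw [joinMap_δ_id]
    simp only [Fin.val_castSucc, Fin.val_succ]
    grind
  h_castSucc_comp_δ_succ_of_lt {k} i j hji := by
    rw [joinRow_δ L, joinRow_δ L, joinRowMap_comp, joinRowMap_comp]
    congr 1
    funext n
    refine hom_ext_val fun x => ?_
    have hij' : j.1 < i.1 := hji
    have hx := x.2
    rw [comp_apply, comp_apply, contractLeft_apply]
    erw [joinMap_δ_id, joinMap_δ_id, contractLeft_apply]
    simp only [Fin.val_castSucc, Fin.val_succ]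
    grind
  h_comp_σ_castSucc_of_le {k} i j hij := by
    rw [joinRow_σ L, joinRow_σ L, joinRowMap_comp, joinRowMap_comp]
    congr 1
    funext n
    refine hom_ext_val fun x => ?_
    have hij' : i.1 ≤ j.1 := hij
    have hx := x.2
    rw [comp_apply, comp_apply, contractLeft_apply]
    erw [joinMap_σ_id, joinMap_σ_id, contractLeft_apply]
    simp only [Fin.val_castSucc, Fin.val_succ]
    grind
  h_comp_σ_succ_of_lt {k} i j hji := by
    rw [joinRow_σ L, joinRow_σ L, joinRowMap_comp, joinRowMap_comp]
    congr 1
    funext n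
    refine hom_ext_val fun x => ?_
    have hij' : j.1 ≤ i.1 := hji
    have hx := x.2
    rw [comp_apply, comp_apply, contractLeft_apply]
    erw [joinMap_σ_id, joinMap_σ_id, contractLeft_apply]
    simp only [Fin.val_castSucc, Fin.val_succ]
    grind

variable {J : MorphismProperty A} [J.IsMultiplicative]

-- The contraction is not natural in `n`, so it exists only on the components of a fixed degree `q`.
-- This is enough, because `localQis_simple_of_rows` asks for an equivalence in each row separately.
include L in
lemma localQis_joinRowSnd :
    localQis J ((alternatingFaceMapComplex A).map (joinRowSnd F Z q)) :=
  localQis_of_homotopyEquiv J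
    { hom := (alternatingFaceMapComplex A).map (joinRowSnd F Z q)
      inv := (alternatingFaceMapComplex A).map (joinRowSection L Z q)
      homotopyHomInvId := ((Homotopy.ofEq ((CategoryTheory.Functor.map_id _ _).symm)).trans
        ((joinRowHomotopy L Z q).toChainHomotopy.trans
          (Homotopy.ofEq (CategoryTheory.Functor.map_comp _ _ _)))).symm
      homotopyInvHomId := Homotopy.ofEq (by
        rw [← CategoryTheory.Functor.map_comp, joinRowSection_snd, CategoryTheory.Functor.map_id]) }

variable [HasFiniteBiproducts A]

include L in
lemma localQis_simple_joinObjSnd :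
    localQis J ((simple A).map ((levelwise F).map (joinObjSnd Z))) :=
  localQis_simple_of_rows _ fun q => localQis_joinRowSnd L Z q

/-- The natural transformation `F ∘ - ⟶ G ∘ -` on simplicial objects. -/
def levelwiseTrans {F G : SimplicialObject D ⥤ ChainComplex A ℕ} (τ : F ⟶ G)
    (R : SimplicialObject (SimplicialObject D)) :
    (levelwise F).obj R ⟶ (levelwise G).obj R where
  app k := τ.app (R.obj k)
  naturality _ _ f := τ.naturality (R.map f)

/-- A generalized Eilenberg-Zilber theorem: a natural transformation between functors from
simplicial objects to complexes which preserve simplicial homotopy equivalences (up to local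
quasi-isomorphisms) and which depend functorially on the underlying graded objects is a local
quasi-isomorphism as soon as it is one on constant simplicial objects. -/
theorem localQis_of_const {F G : SimplicialObject D ⥤ ChainComplex A ℕ}
    (LF : LevelwiseFunctoriality F) (LG : LevelwiseFunctoriality G) (τ : F ⟶ G)
    (hτ : ∀ X : D, localQis J (τ.app ((SimplicialObject.const D).obj X)))
    (hF : ∀ ⦃X Y : SimplicialObject D⦄ (f : X ⟶ Y), simplicialHomotopyEquivalences D f →
      localQis J (F.map f))
    (hG : ∀ ⦃X Y : SimplicialObject D⦄ (f : X ⟶ Y), simplicialHomotopyEquivalences D f →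
      localQis J (G.map f)) (Z : SimplicialObject D) : localQis J (τ.app Z) := by
  -- Column by column: `n ↦ Z ([k] * [n])` is simplicially homotopy equivalent to the constant
  -- object `Z_k`, on which `hτ` applies.
  have h1 : localQis J ((simple A).map (levelwiseTrans τ (joinObj Z))) := by
    refine localQis_simple_of_levels _ fun k => ?_
    have h2 := simplicialHomotopyEquivalences_joinObjFst Z k
    have h3 := (hF _ h2).comp J (hτ (Z _⦋k⦌))
    have h4 : F.map (joinObjFst Z (op ⦋k⦌)) ≫ τ.app _ = _ := τ.naturality (joinObjFst Z (op ⦋k⦌))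
    rw [h4] at h3
    exact h3.of_comp_right (hG _ h2)
  -- The augmentation compares the total complexes of `F` and of `G` on the resolution with those on
  -- `Δ × Z`, and it is an equivalence for both functors.
  have h5 : levelwiseTrans τ (joinObj Z) ≫ (levelwise G).map (joinObjSnd Z) =
      (levelwise F).map (joinObjSnd Z) ≫ levelwiseTrans τ ((constOuter D).obj Z) := by
    apply NatTrans.ext
    funext k
    exact (τ.naturality ((joinObjSnd Z).app k)).symm
  have h6 : localQis J ((simple A).map (levelwiseTrans τ ((constOuter D).obj Z))) := by
    have h7 := h1.comp J (localQis_simple_joinObjSnd LG Z)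
    rw [← CategoryTheory.Functor.map_comp, h5, CategoryTheory.Functor.map_comp] at h7
    exact h7.of_comp_left (localQis_simple_joinObjSnd LF Z)
  -- `F (Δ × Z)` is identified with `F Z × Δ`, and likewise for `G`.
  have h8 : (constLevelwise F).inv.app Z ≫ levelwiseTrans τ ((constOuter D).obj Z) =
      (SimplicialObject.const _).map (τ.app Z) ≫ (constLevelwise G).inv.app Z := by
    apply NatTrans.ext
    funext k
    change 𝟙 _ ≫ τ.app Z = τ.app Z ≫ 𝟙 _
    rw [Category.id_comp, Category.comp_id]
  have h9 : localQis J ((simple A).map ((SimplicialObject.const _).map (τ.app Z))) := by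
    have hi : ∀ {H : SimplicialObject D ⥤ ChainComplex A ℕ},
        localQis J ((simple A).map ((constLevelwise H).inv.app Z)) := fun {H} =>
      localQis_of_homotopyEquiv J (HomotopyEquiv.ofIso
        ((simple A).mapIso ((constLevelwise H).app Z).symm))
    have h10 := (hi (H := F)).comp J h6
    rw [← CategoryTheory.Functor.map_comp, h8, CategoryTheory.Functor.map_comp] at h10
    exact h10.of_comp_right hi
  -- Naturality of the equivalence `λ` passes from `s (τ_Z × Δ)` to `τ_Z`.
  have h11 := h9.comp J (localQis_lamChain (J := J) (G.obj Z))
  have h12 : (simple A).map ((SimplicialObject.const _).map (τ.app Z)) ≫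
      (lamChain A).app (G.obj Z) = (lamChain A).app (F.obj Z) ≫ τ.app Z :=
    (lamChain A).naturality (τ.app Z)
  rw [h12] at h11
  exact h11.of_comp_left (localQis_lamChain _)

end EilenbergZilber

/-! ### The Alexander–Whitney map is an equivalence -/

section AlexanderWhitney

variable {A : Type u} [Category.{v} A] [Preadditive A] [HasFiniteBiproducts A]

lemma front_self (n : ℕ) : front n n = 𝟙 ⦋n⦌ :=
  hom_ext_val fun x => by
    have := x.2
    change min x.1 n = x.1
    omega

lemma back_self (n : ℕ) : back n n = 𝟙 ⦋n⦌ :=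
  hom_ext_val fun x => by
    have := x.2
    change n - (n - x.1) = x.1
    omega

lemma biMap_constOuter {C : Type u'} [Category.{v'} C] (X : SimplicialObject C) {n m i j : ℕ}
    (f : ⦋i⦌ ⟶ ⦋n⦌) (g : ⦋j⦌ ⟶ ⦋m⦌) : biMap ((constOuter C).obj X) f g = X.map g.op :=
  Category.comp_id _

lemma biMap_constInner {C : Type u'} [Category.{v'} C] (X : SimplicialObject C) {n m i j : ℕ}
    (f : ⦋i⦌ ⟶ ⦋n⦌) (g : ⦋j⦌ ⟶ ⦋m⦌) : biMap ((constInner C).obj X) f g = X.map f.op :=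
  Category.id_comp _

/-- The natural transformation `λ_{s X} : s s (Δ × X) ⟶ s X`. -/
def outerLam (A : Type u) [Category.{v} A] [Preadditive A] [HasFiniteBiproducts A] :
    constOuter (ChainComplex A ℕ) ⋙ iterated (simple A) ⟶ simple A :=
  whiskerRight (constLevelwise (simple A)).hom (simple A) ≫ whiskerLeft (simple A) (lamChain A)

/-- The natural transformation `s (λ_X) : s s (X × Δ) ⟶ s X`. -/
def innerLam (A : Type u) [Category.{v} A] [Preadditive A] [HasFiniteBiproducts A] :
    constInner (ChainComplex A ℕ) ⋙ iterated (simple A) ⟶ simple A :=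
  -- The transformation `simpleLam` does not involve the class of equivalences, so any class will
  -- do.
  (chainData A ⊤).simpleLam

lemma iteratedι_outerLam (X : SimplicialObject (ChainComplex A ℕ)) (i j p q : ℕ)
    (h : p + j + i = q) :
    iteratedι ((constOuter _).obj X) i j p q ≫ ((outerLam A).app X).f q =
      if i = 0 then simpleι₀ X j p q else 0 := by
  have h1 : outerι ((constOuter _).obj X) i (p + j) q ≫ ((outerLam A).app X).f q =
      constι ((simple A).obj X) i (p + j) q ≫ lamHom ((simple A).obj X) q := by
    change _ ≫ ((simple A).map ((constLevelwise (simple A)).hom.app X)).f q ≫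
      lamHom ((simple A).obj X) q = _
    have h2 : outerι ((constOuter _).obj X) i (p + j) q ≫
      ((simple A).map ((constLevelwise (simple A)).hom.app X)).f q = 𝟙 _ ≫
        constι ((simple A).obj X) i (p + j) q :=
      simpleι₀_map ((constLevelwise (simple A)).hom.app X) i (p + j) q
    rw [← Category.assoc]
    refine (congr_arg (fun φ => φ ≫ lamHom ((simple A).obj X) q) h2).trans ?_
    rw [Category.id_comp]
  unfold iteratedι
  refine (Category.assoc _ _ _).trans ((congr_arg (fun φ => _ ≫ φ) h1).trans ?_)
  split_ifs with hi
  · subst hi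
    obtain rfl : p + j = q := h
    refine (congr_arg (fun φ => _ ≫ φ) (constι_lamHom_zero ((simple A).obj X) (p + j))).trans ?_
    rw [simpleι₀_eq _ _ _ _ rfl]
    exact Category.comp_id _
  · rw [constι_lamHom_pos _ _ _ _ hi]
    exact comp_zero

/-- On `Δ × X` the map `λ` kills the summands with `i > 0`, so only the term `(j, i) = (n, 0)` of
the Alexander–Whitney sum survives. Its front face is the identity of `[n]`, and its back face acts
trivially. -/
lemma alexanderWhitney_outerLam (X : SimplicialObject (ChainComplex A ℕ)) :
    (alexanderWhitney A).app ((constOuter _).obj X) ≫ (outerLam A).app X =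
      (simple A).map ((diagConstOuter _).hom.app X) := by
  refine HomologicalComplex.hom_ext _ _ fun q => diag_hom_ext fun n p h => ?_
  have h1 : diagι ((constOuter _).obj X) n p q ≫ ((simple A).map
      ((diagConstOuter _).hom.app X)).f q = simpleι₀ X n p q :=
    (simpleι₀_map ((diagConstOuter _).hom.app X) n p q).trans (Category.id_comp _)
  refine Eq.trans ?_ h1.symm
  change _ ≫ awHom _ q ≫ _ = _
  rw [diagι_awHom_assoc _ _ _ _ h, Preadditive.sum_comp,
    Finset.sum_eq_single_of_mem (n, 0) (by simp)]
  · unfold awTerm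
    rw [Category.assoc, iteratedι_outerLam X 0 n p q h, if_pos rfl, biMap_constOuter, front_self,
      op_id, X.map_id]
    exact Category.id_comp _
  · rintro ⟨j, i⟩ hx hne
    have hji : j + i = n := by simpa using hx
    unfold awTerm
    rw [Category.assoc, iteratedι_outerLam X i j p q (by omega), if_neg, comp_zero]
    rintro rfl
    exact hne (by rw [← hji, add_zero])

lemma iteratedι_innerLam (X : SimplicialObject (ChainComplex A ℕ)) (i j p q : ℕ) :
    iteratedι ((constInner _).obj X) i j p q ≫ ((innerLam A).app X).f q =
      if j = 0 then simpleι₀ X i p q else 0 := by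
  have h1 : outerι ((constInner _).obj X) i (p + j) q ≫ ((innerLam A).app X).f q =
      lamHom (X _⦋i⦌) (p + j) ≫ simpleι₀ X i (p + j) q :=
    simpleι₀_map (X := (levelwise (simple A)).obj ((constInner _).obj X)) (Y := X) _ i (p + j) q
  have h2 : simpleι (((constInner _).obj X).obj (op ⦋i⦌)) j p (p + j) rfl =
      constι (X _⦋i⦌) j p (p + j) := (simpleι₀_eq _ _ _ _ _).symm
  unfold iteratedι
  refine (Category.assoc _ _ _).trans ((congr_arg (fun φ => _ ≫ φ) h1).trans ?_)
  refine (Category.assoc _ _ _).symm.trans ?_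
  refine (congr_arg (fun φ => (φ ≫ lamHom (X _⦋i⦌) (p + j)) ≫ simpleι₀ X i (p + j) q) h2).trans ?_
  split_ifs with hj
  · subst hj
    refine (congr_arg (fun φ => φ ≫ _) (constι_lamHom_zero (X _⦋i⦌) p)).trans ?_
    exact Category.id_comp _
  · refine (congr_arg (fun φ => φ ≫ _) (constι_lamHom_pos (X _⦋i⦌) j p (p + j) hj)).trans ?_
    exact zero_comp

/-- On `X × Δ` the surviving term is `(j, i) = (0, n)`, whose back face is the identity. -/
lemma alexanderWhitney_innerLam (X : SimplicialObject (ChainComplex A ℕ)) :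
    (alexanderWhitney A).app ((constInner _).obj X) ≫ (innerLam A).app X =
      (simple A).map ((diagConstInner _).hom.app X) := by
  refine HomologicalComplex.hom_ext _ _ fun q => diag_hom_ext fun n p h => ?_
  have h1 : diagι ((constInner _).obj X) n p q ≫ ((simple A).map
      ((diagConstInner _).hom.app X)).f q = simpleι₀ X n p q :=
    (simpleι₀_map ((diagConstInner _).hom.app X) n p q).trans (Category.id_comp _)
  refine Eq.trans ?_ h1.symm
  change _ ≫ awHom _ q ≫ _ = _
  rw [diagι_awHom_assoc _ _ _ _ h, Preadditive.sum_comp,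
    Finset.sum_eq_single_of_mem (0, n) (by simp)]
  · unfold awTerm
    rw [Category.assoc, iteratedι_innerLam, if_pos rfl, biMap_constInner, back_self,
      op_id, X.map_id]
    exact Category.id_comp _
  · rintro ⟨j, i⟩ hx hne
    have hji : j + i = n := by simpa using hx
    unfold awTerm
    rw [Category.assoc, iteratedι_innerLam, if_neg]
    · exact comp_zero
    · rintro rfl
      exact hne (by rw [← hji, zero_add])

variable {J : MorphismProperty A} [J.IsMultiplicative]

omit [HasFiniteBiproducts A] in
lemma localQis_of_isIso {C D : ChainComplex A ℕ} (f : C ⟶ D) [IsIso f] : localQis J f :=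
  localQis_of_homotopyEquiv J (HomotopyEquiv.ofIso (asIso f))

/-- `localQis_of_const` reduces the claim to objects `Δ × X`. There the composition with `λ` is an
isomorphism by `alexanderWhitney_outerLam`, and `λ` is an equivalence. -/
lemma localQis_alexanderWhitney (Z : SimplicialObject (SimplicialObject (ChainComplex A ℕ))) :
    localQis J ((alexanderWhitney A).app Z) := by
  refine localQis_of_const (diagSimpleFunctoriality A) (levelwiseSimpleFunctoriality (simple A))
    (alexanderWhitney A) (fun X => ?_) (fun X Y f hf => ?_) (fun X Y f hf => ?_) Z
  · refine localQis.of_comp_right (g := (outerLam A).app X) ?_ ?_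
    · rw [alexanderWhitney_outerLam X]
      exact localQis_of_isIso _
    · exact localQis.comp J (localQis_of_isIso
        ((simple A).map ((constLevelwise (simple A)).hom.app X)))
        (localQis_lamChain ((simple A).obj X))
  · exact localQis_simple_map (simplicialHomotopyEquivalences_diag_map hf)
  · exact localQis_simple_map (simplicialHomotopyEquivalences_levelwise_map _ hf)

end AlexanderWhitney

/-! ### The comparison `K D ⟶ s K` -/

section Comparison

open AlgebraicTopology

variable {A : Type u} [Category.{v} A] [Preadditive A] [HasFiniteBiproducts A]

/-- The inclusion of `X_{i,j}` as a summand of `(s K X)_q` if `j + i = q`, and `0` otherwise. -/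
def cmpι (X : SimplicialObject (SimplicialObject A)) (i j q : ℕ) :
    (X.obj (op ⦋i⦌)).obj (op ⦋j⦌) ⟶
      ((levelwise (alternatingFaceMapComplex A) ⋙ simple A).obj X).X q :=
  simpleι₀ ((levelwise (alternatingFaceMapComplex A)).obj X) i j q

/-- The composition `X_{n,n} ⟶ X_{i,j} ⟶ (s K X)_q` of the map induced by `f : [i] ⟶ [n]`
and `g : [j] ⟶ [n]` and of the inclusion of the summand `X_{i,j}` (if `j + i = q`). -/
def cmpTerm (X : SimplicialObject (SimplicialObject A)) {n i j : ℕ} (f : ⦋i⦌ ⟶ ⦋n⦌)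
    (g : ⦋j⦌ ⟶ ⦋n⦌) (q : ℕ) : (X.obj (op ⦋n⦌)).obj (op ⦋n⦌) ⟶
      ((levelwise (alternatingFaceMapComplex A) ⋙ simple A).obj X).X q :=
  biMap X f g ≫ cmpι X i j q

lemma biMap_cmpTerm (X : SimplicialObject (SimplicialObject A)) {m n i j : ℕ}
    (θ : ⦋n⦌ ⟶ ⦋m⦌) (f : ⦋i⦌ ⟶ ⦋n⦌) (g : ⦋j⦌ ⟶ ⦋n⦌) (q : ℕ) :
    biMap X θ θ ≫ cmpTerm X f g q = cmpTerm X (f ≫ θ) (g ≫ θ) q := by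
  unfold cmpTerm
  rw [← Category.assoc, biMap_comp]

/-- The bisimplicial Alexander-Whitney map `(K D X)_q ⟶ (s K X)_q`. -/
def cmpHom (X : SimplicialObject (SimplicialObject A)) (q : ℕ) :
    (X.obj (op ⦋q⦌)).obj (op ⦋q⦌) ⟶
      ((levelwise (alternatingFaceMapComplex A) ⋙ simple A).obj X).X q :=
  ∑ x ∈ Finset.HasAntidiagonal.antidiagonal q, cmpTerm X (back q x.2) (front q x.1) q

/-- The boundary in the second simplicial direction. -/
def cmpBdryInner (X : SimplicialObject (SimplicialObject A)) (i j : ℕ) :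
    (X.obj (op ⦋i⦌)).obj (op ⦋j⦌) ⟶ (X.obj (op ⦋i⦌)).obj (op ⦋j - 1⦌) :=
  match j with
  | 0 => 0
  | j + 1 => ∑ l : Fin (j + 2), ((-1 : ℤ) ^ (l : ℕ)) • biMap X (𝟙 ⦋i⦌) (SimplexCategory.δ l)

/-- The boundary in the first simplicial direction. -/
def cmpBdryOuter (X : SimplicialObject (SimplicialObject A)) (j i : ℕ) :
    (X.obj (op ⦋i⦌)).obj (op ⦋j⦌) ⟶ (X.obj (op ⦋i - 1⦌)).obj (op ⦋j⦌) :=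
  match i with
  | 0 => 0
  | i + 1 => ∑ l : Fin (i + 2), ((-1 : ℤ) ^ (l : ℕ)) • biMap X (SimplexCategory.δ l) (𝟙 ⦋j⦌)

lemma cmpι_d (X : SimplicialObject (SimplicialObject A)) (i j q : ℕ) (h : j + i = q + 1) :
    cmpι X i j (q + 1) ≫
        ((levelwise (alternatingFaceMapComplex A) ⋙ simple A).obj X).d (q + 1) q =
      cmpBdryInner X i j ≫ cmpι X i (j - 1) q +
        ((-1 : ℤ) ^ j) • (cmpBdryOuter X j i ≫ cmpι X (i - 1) j q) := by
  have h1 := simpleι_d ((levelwise (alternatingFaceMapComplex A)).obj X) i j (q + 1) q h rfl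
  rw [← simpleι₀_eq] at h1
  have h2 : (((levelwise (alternatingFaceMapComplex A)).obj X).obj (op ⦋i⦌)).d j (j - 1) =
      cmpBdryInner X i j := by
    cases j with
    | zero => exact HomologicalComplex.shape _ 0 (0 - 1) (by simp)
    | succ j =>
      refine (alternatingFaceMapComplex_obj_d (X.obj (op ⦋i⦌)) j).trans ?_
      refine Finset.sum_congr rfl fun l _ => ?_
      congr 1
      unfold biMap
      rw [op_id, X.map_id, NatTrans.id_app, Category.comp_id]
      rfl
  have h3 : bdry ((levelwise (alternatingFaceMapComplex A)).obj X) i j = cmpBdryOuter X j i := by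
    cases i with
    | zero => exact bdry_zero _ _
    | succ i =>
      refine (bdry_succ _ _ _).trans (Finset.sum_congr rfl fun l _ => ?_)
      congr 1
      unfold biMap
      rw [op_id, CategoryTheory.Functor.map_id, Category.id_comp]
      rfl
  refine h1.trans ?_
  rw [← h2, ← h3]
  rfl

/-- The part of the boundary of `cmpTerm` in the second simplicial direction. -/
lemma cmpTerm_bdryInner (X : SimplicialObject (SimplicialObject A)) {n i j : ℕ} (f : ⦋i⦌ ⟶ ⦋n⦌)
    (g : ⦋j + 1⦌ ⟶ ⦋n⦌) (q : ℕ) :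
    biMap X f g ≫ cmpBdryInner X i (j + 1) ≫ cmpι X i j q =
      ∑ l : Fin (j + 2), ((-1 : ℤ) ^ (l : ℕ)) • cmpTerm X f (SimplexCategory.δ l ≫ g) q := by
  unfold cmpBdryInner
  refine (congr_arg (fun φ => biMap X f g ≫ φ) (Preadditive.sum_comp _ _ _)).trans ?_
  refine (Preadditive.comp_sum _ _ _).trans (Finset.sum_congr rfl fun l _ => ?_)
  unfold cmpTerm
  refine (congr_arg (fun φ => biMap X f g ≫ φ) (Preadditive.zsmul_comp _ _ _)).trans ?_
  refine (Preadditive.comp_zsmul _ _ _).trans ?_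
  rw [← Category.assoc, biMap_comp, Category.id_comp]

/-- The part of the boundary of `cmpTerm` in the first simplicial direction. -/
lemma cmpTerm_bdryOuter (X : SimplicialObject (SimplicialObject A)) {n i j : ℕ}
    (f : ⦋i + 1⦌ ⟶ ⦋n⦌) (g : ⦋j⦌ ⟶ ⦋n⦌) (q : ℕ) :
    biMap X f g ≫ cmpBdryOuter X j (i + 1) ≫ cmpι X i j q =
      ∑ l : Fin (i + 2), ((-1 : ℤ) ^ (l : ℕ)) • cmpTerm X (SimplexCategory.δ l ≫ f) g q := by
  unfold cmpBdryOuter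
  refine (congr_arg (fun φ => biMap X f g ≫ φ) (Preadditive.sum_comp _ _ _)).trans ?_
  refine (Preadditive.comp_sum _ _ _).trans (Finset.sum_congr rfl fun l _ => ?_)
  unfold cmpTerm
  refine (congr_arg (fun φ => biMap X f g ≫ φ) (Preadditive.zsmul_comp _ _ _)).trans ?_
  refine (Preadditive.comp_zsmul _ _ _).trans ?_
  rw [← Category.assoc, biMap_comp, Category.id_comp]

/-- For `k ≤ j` the coface `δ k` passes to the front face and leaves the back face alone; for `k >
j` it is the other way round. The right-hand side has two further terms, the last face of the front
and the zeroth face of the back. Both give the same morphism, with opposite signs. -/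
lemma cmp_cancel (X : SimplicialObject (SimplicialObject A)) (j i q : ℕ) :
    ∑ k : Fin (j + i + 2), ((-1 : ℤ) ^ (k : ℕ)) •
        cmpTerm X (back (j + i) i ≫ SimplexCategory.δ k) (front (j + i) j ≫ SimplexCategory.δ k) q =
      ∑ l : Fin (j + 2), ((-1 : ℤ) ^ (l : ℕ)) •
        cmpTerm X (back (j + i + 1) i) (SimplexCategory.δ l ≫ front (j + i + 1) (j + 1)) q +
      ((-1 : ℤ) ^ j) • ∑ l : Fin (i + 2), ((-1 : ℤ) ^ (l : ℕ)) •
        cmpTerm X (SimplexCategory.δ l ≫ back (j + i + 1) (i + 1)) (front (j + i + 1) j) q := by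
  have e : (j + 1) + (i + 1) = j + i + 2 := by omega
  rw [Fin.sum_univ_castSucc (n := j + 1), Fin.sum_univ_succ (n := i + 1), δ_last_front, δ_zero_back,
    ← (finCongr e).sum_comp, Fin.sum_univ_add, smul_add, Finset.smul_sum]
  have h1 : ∀ l : Fin (j + 1), ((-1 : ℤ) ^ ((finCongr e (Fin.castAdd (i + 1) l) : _) : ℕ)) •
      cmpTerm X (back (j + i) i ≫ SimplexCategory.δ (finCongr e (Fin.castAdd (i + 1) l)))
        (front (j + i) j ≫ SimplexCategory.δ (finCongr e (Fin.castAdd (i + 1) l))) q =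
      ((-1 : ℤ) ^ (l.castSucc : ℕ)) • cmpTerm X (back (j + i + 1) i)
        (SimplexCategory.δ l.castSucc ≫ front (j + i + 1) (j + 1)) q := by
    intro l
    rw [back_δ_low j i l _ (by simp), front_δ_low j i l _ (by simp)]
    simp
  have h2 : ∀ l : Fin (i + 1), ((-1 : ℤ) ^ ((finCongr e (Fin.natAdd (j + 1) l) : _) : ℕ)) •
      cmpTerm X (back (j + i) i ≫ SimplexCategory.δ (finCongr e (Fin.natAdd (j + 1) l)))
        (front (j + i) j ≫ SimplexCategory.δ (finCongr e (Fin.natAdd (j + 1) l))) q =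
      ((-1 : ℤ) ^ j) • ((-1 : ℤ) ^ (l.succ : ℕ)) • cmpTerm X
        (SimplexCategory.δ l.succ ≫ back (j + i + 1) (i + 1)) (front (j + i + 1) j) q := by
    intro l
    rw [back_δ_high j i l _ (by simp), front_δ_high j i l _ (by simp), smul_smul, ← pow_add]
    congr 2
    simp
    omega
  rw [Finset.sum_congr rfl (fun l _ => h1 l), Finset.sum_congr rfl (fun l _ => h2 l)]
  simp only [Fin.val_last, Fin.val_zero, pow_zero, one_smul, pow_succ, mul_neg, mul_one, neg_smul]
  abel

lemma cmpHom_comm (X : SimplicialObject (SimplicialObject A)) (q : ℕ) :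
    cmpHom X (q + 1) ≫
        ((levelwise (alternatingFaceMapComplex A) ⋙ simple A).obj X).d (q + 1) q =
      ((diag A ⋙ alternatingFaceMapComplex A).obj X).d (q + 1) q ≫ cmpHom X q := by
  have h1 : ((diag A ⋙ alternatingFaceMapComplex A).obj X).d (q + 1) q =
      ∑ k : Fin (q + 2), ((-1 : ℤ) ^ (k : ℕ)) • biMap X (SimplexCategory.δ k)
        (SimplexCategory.δ k) := alternatingFaceMapComplex_obj_d ((diag A).obj X) q
  have h2 : cmpHom X (q + 1) ≫
        ((levelwise (alternatingFaceMapComplex A) ⋙ simple A).obj X).d (q + 1) q =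
      ∑ x ∈ Finset.HasAntidiagonal.antidiagonal (q + 1),
        (biMap X (back (q + 1) x.2) (front (q + 1) x.1) ≫ cmpBdryInner X x.2 x.1 ≫
            cmpι X x.2 (x.1 - 1) q +
          ((-1 : ℤ) ^ x.1) • (biMap X (back (q + 1) x.2) (front (q + 1) x.1) ≫
            cmpBdryOuter X x.1 x.2 ≫ cmpι X (x.2 - 1) x.1 q)) := by
    unfold cmpHom cmpTerm
    refine (Preadditive.sum_comp _ _ _).trans (Finset.sum_congr rfl fun x hx => ?_)
    refine (Category.assoc _ _ _).trans ?_
    rw [cmpι_d X x.2 x.1 q (by simpa using hx), Preadditive.comp_add,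
      Preadditive.comp_zsmul]
  have h3 : ((diag A ⋙ alternatingFaceMapComplex A).obj X).d (q + 1) q ≫ cmpHom X q =
      ∑ x ∈ Finset.HasAntidiagonal.antidiagonal q, ∑ k : Fin (q + 2), ((-1 : ℤ) ^ (k : ℕ)) •
        cmpTerm X (back q x.2 ≫ SimplexCategory.δ k) (front q x.1 ≫ SimplexCategory.δ k) q := by
    rw [h1]
    unfold cmpHom
    refine (Preadditive.comp_sum _ _ _).trans (Finset.sum_congr rfl fun x hx => ?_)
    refine (Preadditive.sum_comp _ _ _).trans (Finset.sum_congr rfl fun k _ => ?_)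
    refine (Preadditive.zsmul_comp _ _ _).trans ?_
    congr 1
    exact biMap_cmpTerm X _ _ _ q
  -- The inner boundary vanishes for `x.1 = 0` and the outer one for `x.2 = 0`. Shifting the
  -- respective index puts both sums over the antidiagonal of `q`, where `cmp_cancel` applies term
  -- by term.
  rw [h2, h3, Finset.sum_add_distrib, Finset.Nat.sum_antidiagonal_succ,
    Finset.Nat.sum_antidiagonal_succ', cmpBdryInner, cmpBdryOuter, zero_comp, zero_comp, comp_zero,
    comp_zero, smul_zero, zero_add, zero_add, ← Finset.sum_add_distrib]
  refine Finset.sum_congr rfl fun x hx => ?_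
  obtain ⟨j, i⟩ := x
  obtain rfl : j + i = q := by simpa using hx
  refine Eq.trans ?_ (cmp_cancel X j i (j + i)).symm
  rw [← cmpTerm_bdryInner, ← cmpTerm_bdryOuter]
  rfl

/-- The bisimplicial Alexander-Whitney map `K D X ⟶ s K X`. -/
def cmp (A : Type u) [Category.{v} A] [Preadditive A] [HasFiniteBiproducts A] :
    diag A ⋙ alternatingFaceMapComplex A ⟶ levelwise (alternatingFaceMapComplex A) ⋙ simple A where
  app X :=
    { f := cmpHom X
      comm' := fun q q' hq => by
        obtain rfl : q' + 1 = q := hq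
        exact cmpHom_comm X q' }
  naturality X Y α := by
    ext q
    change (α.app (op ⦋q⦌)).app (op ⦋q⦌) ≫ cmpHom Y q = cmpHom X q ≫ _
    unfold cmpHom
    rw [Preadditive.comp_sum, Preadditive.sum_comp]
    refine Finset.sum_congr rfl fun x _ => ?_
    unfold cmpTerm
    rw [← Category.assoc, biMap_naturality, Category.assoc, Category.assoc]
    congr 1
    exact (simpleι₀_map ((levelwise (alternatingFaceMapComplex A)).map α) x.2 x.1 q).symm

end Comparison

/-! ### Compatibility of the comparison with `λ` and `μ` -/

section ComparisonCompatibility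

open AlgebraicTopology

variable {A : Type u} [Category.{v} A] [Preadditive A] [HasFiniteBiproducts A]

/-- The inclusion of `X_j` as the summand of simplicial degree `i` of `s (K X × Δ)_q`, via
`K (X × Δ) = K X × Δ`. -/
def constCmpι (X : SimplicialObject A) (i j q : ℕ) : X _⦋j⦌ ⟶
    ((SimplicialObject.const _ ⋙ simple A).obj ((alternatingFaceMapComplex A).obj X)).X q :=
  constι ((alternatingFaceMapComplex A).obj X) i j q

/-- As in `alexanderWhitney_outerLam`, only the term with `i = 0` survives `λ`. -/
lemma cmp_lam (X : SimplicialObject A) :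
    (cmp A).app ((constOuter A).obj X) ≫
        (simple A).map ((constLevelwise (alternatingFaceMapComplex A)).hom.app X) ≫
        (lamChain A).app ((alternatingFaceMapComplex A).obj X) =
      (alternatingFaceMapComplex A).map ((diagConstOuter A).hom.app X) := by
  refine HomologicalComplex.hom_ext _ _ fun q => ?_
  have h1 : ∀ i j : ℕ, cmpι ((constOuter A).obj X) i j q ≫
      ((simple A).map ((constLevelwise (alternatingFaceMapComplex A)).hom.app X)).f q =
        constCmpι X i j q := fun i j =>
    (simpleι₀_map ((constLevelwise (alternatingFaceMapComplex A)).hom.app X) i j q).trans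
      (Category.id_comp _)
  have h2 : ∀ i j : ℕ, cmpι ((constOuter A).obj X) i j q ≫
      ((simple A).map ((constLevelwise (alternatingFaceMapComplex A)).hom.app X)).f q ≫
        lamHom ((alternatingFaceMapComplex A).obj X) q =
        constCmpι X i j q ≫ lamHom ((alternatingFaceMapComplex A).obj X) q := fun i j =>
    (Category.assoc _ _ _).symm.trans (congr_arg (fun φ => φ ≫ lamHom _ q) (h1 i j))
  change cmpHom ((constOuter A).obj X) q ≫
    ((simple A).map ((constLevelwise (alternatingFaceMapComplex A)).hom.app X)).f q ≫
      lamHom ((alternatingFaceMapComplex A).obj X) q = 𝟙 (X _⦋q⦌)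
  unfold cmpHom
  refine (Preadditive.sum_comp _ _ _).trans ?_
  rw [Finset.sum_eq_single_of_mem (q, 0) (by simp)]
  · unfold cmpTerm
    refine (Category.assoc _ _ _).trans ((congr_arg (fun φ => _ ≫ φ) (h2 0 q)).trans ?_)
    refine (congr_arg (fun φ => _ ≫ φ)
      (constι_lamHom_zero ((alternatingFaceMapComplex A).obj X) q)).trans ?_
    refine (Category.comp_id _).trans ?_
    rw [biMap_constOuter, front_self]
    exact X.map_id _
  · rintro ⟨j, i⟩ hx hne
    have hji : j + i = q := by simpa using hx
    have hi : i ≠ 0 := by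
      rintro rfl
      exact hne (by rw [← hji, add_zero])
    unfold cmpTerm
    refine (Category.assoc _ _ _).trans ((congr_arg (fun φ => _ ≫ φ) (h2 i j)).trans ?_)
    refine (congr_arg (fun φ => _ ≫ φ)
      (constι_lamHom_pos ((alternatingFaceMapComplex A).obj X) i j q hi)).trans ?_
    exact comp_zero

variable {J : MorphismProperty A} [J.IsMultiplicative]

/-- The argument is that of `localQis_alexanderWhitney`, with `cmp_lam` for the constant objects. -/
lemma localQis_cmp (Z : SimplicialObject (SimplicialObject A)) :
    localQis J ((cmp A).app Z) := by
  refine localQis_of_const (diagFunctoriality A)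
    (levelwiseSimpleFunctoriality (alternatingFaceMapComplex A))
    (cmp A) (fun X => ?_) (fun X Y f hf => ?_) (fun X Y f hf => ?_) Z
  · refine localQis.of_comp_right
      (g := (simple A).map ((constLevelwise (alternatingFaceMapComplex A)).hom.app X) ≫
        (lamChain A).app ((alternatingFaceMapComplex A).obj X)) ?_ ?_
    · rw [cmp_lam X]
      exact localQis_of_isIso _
    · exact localQis.comp J (localQis_of_isIso _) (localQis_lamChain _)
  · exact localQis_alternatingFaceMapComplex_map (simplicialHomotopyEquivalences_diag_map hf)
  · exact localQis_simple_map (simplicialHomotopyEquivalences_levelwise_map _ hf)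

/-- The morphism `Z_{n,m,l} ⟶ Z_{i,j,k}` induced by maps `[i] ⟶ [n]`, `[j] ⟶ [m]`, `[k] ⟶ [l]`. -/
def triMap {C : Type u'} [Category.{v'} C]
    (Z : SimplicialObject (SimplicialObject (SimplicialObject C))) {n m l i j k : ℕ}
    (f : ⦋i⦌ ⟶ ⦋n⦌) (g : ⦋j⦌ ⟶ ⦋m⦌) (h : ⦋k⦌ ⟶ ⦋l⦌) :
    ((Z.obj (op ⦋n⦌)).obj (op ⦋m⦌)).obj (op ⦋l⦌) ⟶
      ((Z.obj (op ⦋i⦌)).obj (op ⦋j⦌)).obj (op ⦋k⦌) :=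
  biMap (Z.obj (op ⦋n⦌)) g h ≫ ((Z.map f.op).app (op ⦋j⦌)).app (op ⦋k⦌)

lemma triMap_comp {C : Type u'} [Category.{v'} C]
    (Z : SimplicialObject (SimplicialObject (SimplicialObject C))) {n m l i j k i' j' k' : ℕ}
    (f : ⦋i⦌ ⟶ ⦋n⦌) (g : ⦋j⦌ ⟶ ⦋m⦌) (h : ⦋k⦌ ⟶ ⦋l⦌) (f' : ⦋i'⦌ ⟶ ⦋i⦌) (g' : ⦋j'⦌ ⟶ ⦋j⦌)
    (h' : ⦋k'⦌ ⟶ ⦋k⦌) :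
    triMap Z f g h ≫ triMap Z f' g' h' = triMap Z (f' ≫ f) (g' ≫ g) (h' ≫ h) := by
  unfold triMap
  have h1 := biMap_naturality (Z.map f.op) g' h'
  rw [Category.assoc, reassoc_of% h1, ← Category.assoc, biMap_comp, op_comp, Z.map_comp]
  rfl

lemma biMap_diag {C : Type u'} [Category.{v'} C]
    (Z : SimplicialObject (SimplicialObject (SimplicialObject C))) {n l i k : ℕ}
    (f : ⦋i⦌ ⟶ ⦋n⦌) (h : ⦋k⦌ ⟶ ⦋l⦌) :
    biMap ((diag (SimplicialObject C)).obj Z) f h = triMap Z f f h :=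
  (Category.assoc _ _ _).symm

lemma biMap_levelwise_diag {C : Type u'} [Category.{v'} C]
    (Z : SimplicialObject (SimplicialObject (SimplicialObject C))) {n m i j : ℕ}
    (f : ⦋i⦌ ⟶ ⦋n⦌) (g : ⦋j⦌ ⟶ ⦋m⦌) :
    biMap ((levelwise (diag C)).obj Z) f g = triMap Z f g g := rfl

omit [HasFiniteBiproducts A] in
lemma biMap_levelwise_levelwise
    (Z : SimplicialObject (SimplicialObject (SimplicialObject A))) {n m i j k : ℕ}
    (f : ⦋i⦌ ⟶ ⦋n⦌) (g : ⦋j⦌ ⟶ ⦋m⦌) :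
    (biMap ((levelwise (levelwise (alternatingFaceMapComplex A))).obj Z) f g).f k =
      triMap Z f g (𝟙 ⦋k⦌) := by
  unfold triMap biMap
  rw [op_id, CategoryTheory.Functor.map_id]
  exact congr_arg (fun φ => φ ≫ _) (Category.id_comp _).symm

lemma biMap_eq_triMap {C : Type u'} [Category.{v'} C]
    (Z : SimplicialObject (SimplicialObject (SimplicialObject C))) {n m l j k : ℕ}
    (g : ⦋j⦌ ⟶ ⦋m⦌) (h : ⦋k⦌ ⟶ ⦋l⦌) :
    biMap (Z.obj (op ⦋n⦌)) g h = triMap Z (𝟙 ⦋n⦌) g h := by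
  unfold triMap
  rw [op_id, Z.map_id]
  exact (Category.comp_id _).symm

/-- Coassociativity: an ordinal of dimension `j + j' + i'` is cut into a front, a middle and a back
piece, which do not depend on the cut that is made first. The three identities for `back` and
`front` concern the back, the middle and the front piece. -/
lemma back_back (j j' i' : ℕ) :
    back (j' + i') i' ≫ back (j + (j' + i')) (j' + i') = back (j + (j' + i')) i' := by
  refine hom_ext_val fun x => ?_
  have hx := x.2
  simp only [comp_apply, back_apply]
  omega

lemma front_back (j j' i' : ℕ) :
    front (j' + i') j' ≫ back (j + (j' + i')) (j' + i') =
      back (j + j') j' ≫ front (j + (j' + i')) (j + j') := by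
  refine hom_ext_val fun x => ?_
  have hx := x.2
  simp only [comp_apply, back_apply, front_apply]
  omega

lemma front_front (j j' i' : ℕ) :
    front (j + j') j ≫ front (j + (j' + i')) (j + j') = front (j + (j' + i')) j := by
  refine hom_ext_val fun x => ?_
  have hx := x.2
  simp only [comp_apply, front_apply]
  omega

lemma sum_antidiagonal_assoc {M : Type*} [AddCommMonoid M] (q : ℕ) (T : ℕ → ℕ → ℕ → M) :
    ∑ x ∈ Finset.HasAntidiagonal.antidiagonal q, ∑ y ∈ Finset.HasAntidiagonal.antidiagonal x.2,
        T x.1 y.1 y.2 =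
      ∑ x ∈ Finset.HasAntidiagonal.antidiagonal q, ∑ y ∈ Finset.HasAntidiagonal.antidiagonal x.1,
        T y.1 y.2 x.2 := by
  rw [Finset.sum_sigma', Finset.sum_sigma']
  refine Finset.sum_nbij' (fun z => ⟨(z.1.1 + z.2.1, z.2.2), (z.1.1, z.2.1)⟩)
    (fun z => ⟨(z.2.1, z.2.2 + z.1.2), (z.2.2, z.1.2)⟩) ?_ ?_ ?_ ?_ ?_
  · rintro ⟨⟨a, b⟩, ⟨c, d⟩⟩ h
    simp only [Finset.mem_sigma, Finset.HasAntidiagonal.mem_antidiagonal, and_true] at h ⊢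
    omega
  · rintro ⟨⟨a, b⟩, ⟨c, d⟩⟩ h
    simp only [Finset.mem_sigma, Finset.HasAntidiagonal.mem_antidiagonal, and_true] at h ⊢
    omega
  · rintro ⟨⟨a, b⟩, ⟨c, d⟩⟩ h
    simp only [Finset.mem_sigma, Finset.HasAntidiagonal.mem_antidiagonal] at h
    obtain ⟨-, rfl⟩ := h
    rfl
  · rintro ⟨⟨a, b⟩, ⟨c, d⟩⟩ h
    simp only [Finset.mem_sigma, Finset.HasAntidiagonal.mem_antidiagonal] at h
    obtain ⟨-, rfl⟩ := h
    rfl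
  · rintro ⟨⟨a, b⟩, ⟨c, d⟩⟩ h
    rfl

/-- The inclusion of `Z_{i,j,k}` as a summand of `s s K Z`. -/
def triι (Z : SimplicialObject (SimplicialObject (SimplicialObject A))) (i j k q : ℕ) :
    ((Z.obj (op ⦋i⦌)).obj (op ⦋j⦌)).obj (op ⦋k⦌) ⟶ ((iterated (simple A)).obj
      ((levelwise (levelwise (alternatingFaceMapComplex A))).obj Z)).X q :=
  iteratedι ((levelwise (levelwise (alternatingFaceMapComplex A))).obj Z) i j k q

/-- The composition of `cmp` and of the Alexander-Whitney map. -/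
def cmpAw (Z : SimplicialObject (SimplicialObject (SimplicialObject A))) :
    (diag (SimplicialObject A) ⋙ diag A ⋙ alternatingFaceMapComplex A).obj Z ⟶
      (iterated (simple A)).obj ((levelwise (levelwise (alternatingFaceMapComplex A))).obj Z) :=
  (cmp A).app ((diag _).obj Z) ≫
    (simple A).map ((diagLevelwise (alternatingFaceMapComplex A)).hom.app Z) ≫
    (alexanderWhitney A).app ((levelwise (levelwise (alternatingFaceMapComplex A))).obj Z)

/-- The composition of `cmp` and of `cmp` in each simplicial degree. -/
def cmpCmp (Z : SimplicialObject (SimplicialObject (SimplicialObject A))) :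
    (levelwise (diag A) ⋙ diag A ⋙ alternatingFaceMapComplex A).obj Z ⟶
      (iterated (simple A)).obj ((levelwise (levelwise (alternatingFaceMapComplex A))).obj Z) :=
  (cmp A).app ((levelwise (diag A)).obj Z) ≫ (simple A).map
    (((SimplicialObject.whiskering _ _).map (cmp A)).app Z)

lemma cmpAw_f (Z : SimplicialObject (SimplicialObject (SimplicialObject A))) (q : ℕ) :
    (cmpAw Z).f q = ∑ x ∈ Finset.HasAntidiagonal.antidiagonal q,
      ∑ y ∈ Finset.HasAntidiagonal.antidiagonal x.2,
        triMap Z (back x.2 y.2 ≫ back q x.2) (front x.2 y.1 ≫ back q x.2) (front q x.1) ≫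
          triι Z y.2 y.1 x.1 q := by
  have h1 : ∀ i j : ℕ, cmpι ((diag _).obj Z) i j q ≫
      ((simple A).map ((diagLevelwise (alternatingFaceMapComplex A)).hom.app Z)).f q =
      diagι ((levelwise (levelwise (alternatingFaceMapComplex A))).obj Z) i j q := fun i j =>
    (simpleι₀_map ((diagLevelwise (alternatingFaceMapComplex A)).hom.app Z) i j q).trans
      (Category.id_comp _)
  change cmpHom ((diag _).obj Z) q ≫ ((simple A).map _).f q ≫ awHom _ q = _
  unfold cmpHom
  refine (Preadditive.sum_comp _ _ _).trans (Finset.sum_congr rfl fun x hx => ?_)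
  have hx' : x.1 + x.2 = q := by simpa using hx
  unfold cmpTerm
  refine (Category.assoc _ _ _).trans ((congr_arg (fun φ => _ ≫ φ)
    ((Category.assoc _ _ _).symm.trans ((congr_arg (fun φ => φ ≫ _) (h1 x.2 x.1)).trans
      (diagι_awHom _ x.2 x.1 q hx')))).trans ?_)
  refine (Preadditive.comp_sum _ _ _).trans (Finset.sum_congr rfl fun y _ => ?_)
  unfold awTerm
  refine (Category.assoc _ _ _).symm.trans (congr_arg (fun φ => φ ≫ triι Z y.2 y.1 x.1 q) ?_)
  rw [biMap_diag, biMap_levelwise_levelwise]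
  refine (triMap_comp _ _ _ _ _ _ _).trans ?_
  rw [Category.id_comp]

lemma cmpCmp_f (Z : SimplicialObject (SimplicialObject (SimplicialObject A))) (q : ℕ) :
    (cmpCmp Z).f q = ∑ x ∈ Finset.HasAntidiagonal.antidiagonal q,
      ∑ y ∈ Finset.HasAntidiagonal.antidiagonal x.1,
        triMap Z (back q x.2) (back x.1 y.2 ≫ front q x.1) (front x.1 y.1 ≫ front q x.1) ≫
          triι Z x.2 y.2 y.1 q := by
  have h1 : ∀ i j : ℕ, cmpι ((levelwise (diag A)).obj Z) i j q ≫
      ((simple A).map (((SimplicialObject.whiskering _ _).map (cmp A)).app Z)).f q =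
      cmpHom (Z.obj (op ⦋i⦌)) j ≫
        outerι ((levelwise (levelwise (alternatingFaceMapComplex A))).obj Z) i j q := fun i j =>
    simpleι₀_map (((SimplicialObject.whiskering _ _).map (cmp A)).app Z) i j q
  change cmpHom ((levelwise (diag A)).obj Z) q ≫ ((simple A).map _).f q = _
  conv_lhs => rw [cmpHom]
  refine (Preadditive.sum_comp _ _ _).trans (Finset.sum_congr rfl fun x hx => ?_)
  have hx' : x.1 + x.2 = q := by simpa using hx
  unfold cmpTerm
  refine (Category.assoc _ _ _).trans ((congr_arg (fun φ => _ ≫ φ) (h1 x.2 x.1)).trans ?_)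
  unfold cmpHom
  refine (congr_arg (fun φ => _ ≫ φ) (Preadditive.sum_comp _ _ _)).trans ?_
  refine (Preadditive.comp_sum _ _ _).trans (Finset.sum_congr rfl fun y hy => ?_)
  have hy' : y.1 + y.2 = x.1 := by simpa using hy
  have h2 : cmpι (Z.obj (op ⦋x.2⦌)) y.2 y.1 x.1 ≫
      outerι ((levelwise (levelwise (alternatingFaceMapComplex A))).obj Z) x.2 x.1 q =
      triι Z x.2 y.2 y.1 q :=
    (congr_arg (fun φ => φ ≫ outerι ((levelwise (levelwise (alternatingFaceMapComplex A))).obj Z)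
      x.2 x.1 q) (simpleι₀_eq _ _ _ _ hy')).trans (simpleι_outerι _ _ _ _ _ _ _)
  unfold cmpTerm
  refine (congr_arg (fun φ => _ ≫ φ) ((Category.assoc _ _ _).trans
    (congr_arg (fun φ => _ ≫ φ) h2))).trans ((Category.assoc _ _ _).symm.trans
      (congr_arg (fun φ => φ ≫ triι Z x.2 y.2 y.1 q) ?_))
  rw [biMap_levelwise_diag, biMap_eq_triMap]
  refine (triMap_comp _ _ _ _ _ _ _).trans ?_
  rw [Category.id_comp]

/-- The compatibility of the comparison of the simple functors with the Alexander-Whitney maps. -/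
lemma cmpAw_eq (Z : SimplicialObject (SimplicialObject (SimplicialObject A))) :
    cmpAw Z = (alternatingFaceMapComplex A).map ((muDiag A).app Z) ≫ cmpCmp Z := by
  -- The map induced by `muDiag` is the identity in every degree and can be dropped.
  refine HomologicalComplex.hom_ext _ _ fun q => Eq.trans ?_
    (Category.id_comp ((cmpCmp Z).f q)).symm
  rw [cmpCmp_f, cmpAw_f]
  -- Both sides are sums over `j + j' + i' = q`; only the bracketing of the index differs.
  have h1 := sum_antidiagonal_assoc q fun j j' i' =>
    triMap Z (back q i') (back (j + j') j' ≫ front q (j + j')) (front q j) ≫ triι Z i' j' j q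
  refine Eq.trans (Finset.sum_congr rfl fun x hx => Finset.sum_congr rfl fun y hy => ?_)
    (h1.trans (Finset.sum_congr rfl fun x hx => Finset.sum_congr rfl fun y hy => ?_))
  · obtain ⟨j, i⟩ := x
    obtain ⟨j', i'⟩ := y
    obtain rfl : j + i = q := by simpa using hx
    obtain rfl : j' + i' = i := by simpa using hy
    rw [back_back, front_back]
  · obtain ⟨k, i'⟩ := x
    obtain ⟨j, j'⟩ := y
    obtain rfl : k + i' = q := by simpa using hx
    obtain rfl : j + j' = k := by simpa using hy
    have h2 := front_front j j' i'
    rw [← add_assoc] at h2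
    dsimp only
    rw [h2]

end ComparisonCompatibility

/-! ### Cylinders and simplicial homotopies -/

section Cylinder

variable {C : Type u'} [Category.{v'} C] [HasFiniteCoproducts C]

/-- The inclusion `X_n ⟶ (Cyl X)_n` indexed by `σ : [n] ⟶ [1]`. -/
def cylι (X : SimplicialObject C) {n : ℕ} (σ : ⦋n⦌ ⟶ ⦋1⦌) : X _⦋n⦌ ⟶ (cyl X) _⦋n⦌ :=
  Sigma.ι (fun _ : (⦋n⦌ ⟶ ⦋1⦌) => X _⦋n⦌) σ

lemma cylι_map (X : SimplicialObject C) {n m : ℕ} (σ : ⦋n⦌ ⟶ ⦋1⦌) (g : ⦋m⦌ ⟶ ⦋n⦌) :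
    cylι X σ ≫ (cyl X).map g.op = X.map g.op ≫ cylι X (g ≫ σ) :=
  Sigma.ι_desc _ _

/-- The morphism from `(Cyl X)_n` with given restrictions to the summands. -/
def cylDesc {X : SimplicialObject C} {n : ℕ} {T : C} (f : (⦋n⦌ ⟶ ⦋1⦌) → (X _⦋n⦌ ⟶ T)) :
    (cyl X) _⦋n⦌ ⟶ T :=
  Sigma.desc f

lemma cylι_desc {X : SimplicialObject C} {n : ℕ} {T : C} (f : (⦋n⦌ ⟶ ⦋1⦌) → (X _⦋n⦌ ⟶ T))
    (σ : ⦋n⦌ ⟶ ⦋1⦌) : cylι X σ ≫ cylDesc f = f σ :=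
  Sigma.ι_desc _ _

lemma cyl_hom_ext {X : SimplicialObject C} {n : ℕ} {T : C} {f g : (cyl X) _⦋n⦌ ⟶ T}
    (h : ∀ σ : ⦋n⦌ ⟶ ⦋1⦌, cylι X σ ≫ f = cylι X σ ≫ g) : f = g :=
  Sigma.hom_ext _ _ h

/-- The map `[n] ⟶ [1]` with `x ↦ 0` if and only if `x < i`. -/
def step (n i : ℕ) : ⦋n⦌ ⟶ ⦋1⦌ :=
  SimplexCategory.mkHom ⟨fun x => if x.1 < i then 0 else 1, fun x y h => by
    have : x.1 ≤ y.1 := h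
    dsimp only
    split_ifs
    · exact le_rfl
    · exact Fin.zero_le _
    · omega
    · exact le_rfl⟩

lemma step_apply (n i : ℕ) (x : Fin (n + 1)) :
    ((SimplexCategory.Hom.toOrderHom (step n i) x : Fin 2) : ℕ) = if x.1 < i then 0 else 1 := by
  change ((if x.1 < i then (0 : Fin 2) else 1 : Fin 2) : ℕ) = _
  split_ifs <;> rfl

/-- The coface `δ 0 : [0] ⟶ [1]` omits `0`, so this end is indexed by the constant map `1`, which is
`step n 0`. -/
lemma toCyl_zero_app (X : SimplicialObject C) (n : ℕ) :
    (toCyl X (SimplexCategory.δ 0)).app (op ⦋n⦌) = cylι X (step n 0) := by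
  refine congr_arg (cylι X) (hom_ext_val fun x => ?_)
  rw [step_apply, if_neg (Nat.not_lt_zero _)]
  rfl

lemma toCyl_one_app (X : SimplicialObject C) (n : ℕ) :
    (toCyl X (SimplexCategory.δ 1)).app (op ⦋n⦌) = cylι X (step n (n + 1)) := by
  refine congr_arg (cylι X) (hom_ext_val fun x => ?_)
  rw [step_apply, if_pos x.2]
  rfl

/-- The morphism `X_n ⟶ Y_m` associated to a morphism `Cyl X ⟶ Y` and an `m`-simplex of
`Δ[n] × Δ[1]`. -/
def cylEval {X Y : SimplicialObject C} (Φ : cyl X ⟶ Y) {n m : ℕ} (f : ⦋m⦌ ⟶ ⦋n⦌)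
    (σ : ⦋m⦌ ⟶ ⦋1⦌) : X _⦋n⦌ ⟶ Y _⦋m⦌ :=
  X.map f.op ≫ cylι X σ ≫ Φ.app (op ⦋m⦌)

lemma cylEval_map {X Y : SimplicialObject C} (Φ : cyl X ⟶ Y) {n m l : ℕ} (f : ⦋m⦌ ⟶ ⦋n⦌)
    (σ : ⦋m⦌ ⟶ ⦋1⦌) (g : ⦋l⦌ ⟶ ⦋m⦌) :
    cylEval Φ f σ ≫ Y.map g.op = cylEval Φ (g ≫ f) (g ≫ σ) := by
  unfold cylEval
  rw [Category.assoc, Category.assoc, ← Φ.naturality, ← Category.assoc (cylι X σ), cylι_map,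
    op_comp, X.map_comp, Category.assoc, Category.assoc]

lemma map_cylEval {X Y : SimplicialObject C} (Φ : cyl X ⟶ Y) {n m l : ℕ} (f : ⦋m⦌ ⟶ ⦋n⦌)
    (σ : ⦋m⦌ ⟶ ⦋1⦌) (g : ⦋n⦌ ⟶ ⦋l⦌) :
    X.map g.op ≫ cylEval Φ f σ = cylEval Φ (f ≫ g) σ := by
  unfold cylEval
  rw [op_comp, X.map_comp, Category.assoc]

lemma cylEval_congr {X Y : SimplicialObject C} (Φ : cyl X ⟶ Y) {n m : ℕ} {f f' : ⦋m⦌ ⟶ ⦋n⦌}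
    {σ σ' : ⦋m⦌ ⟶ ⦋1⦌} (hf : ∀ x : Fin (m + 1), ((SimplexCategory.Hom.toOrderHom f x :
      Fin (n + 1)) : ℕ) = ((SimplexCategory.Hom.toOrderHom f' x : Fin (n + 1)) : ℕ))
    (hσ : ∀ x : Fin (m + 1), ((SimplexCategory.Hom.toOrderHom σ x : Fin 2) : ℕ) =
      ((SimplexCategory.Hom.toOrderHom σ' x : Fin 2) : ℕ)) :
    cylEval Φ f σ = cylEval Φ f' σ' := by
  rw [hom_ext_val hf, hom_ext_val hσ]

/-- The simplicial homotopy associated to a morphism `Cyl X ⟶ Y`. -/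
def cylHomotopy {X Y : SimplicialObject C} (Φ : cyl X ⟶ Y) :
    SimplicialObject.Homotopy (toCyl X (SimplexCategory.δ 1) ≫ Φ)
      (toCyl X (SimplexCategory.δ 0) ≫ Φ) where
  -- The pairs formed by `σ i` and this step map are the `n + 1` nondegenerate simplices of top
  -- dimension of the prism `Δ[n] × Δ[1]`.
  h {n} i := cylEval Φ (SimplexCategory.σ i) (step (n + 1) (i.1 + 1))
  h_zero_comp_δ_zero n := by
    refine (cylEval_map _ _ _ _).trans ?_
    rw [NatTrans.comp_app, toCyl_zero_app]
    have h1 : cylι X (step n 0) ≫ Φ.app (op ⦋n⦌) = cylEval Φ (𝟙 ⦋n⦌) (step n 0) := by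
      unfold cylEval
      rw [op_id, X.map_id, Category.id_comp]
    rw [h1]
    refine cylEval_congr Φ (fun x => ?_) (fun x => ?_)
    · rw [comp_apply, σ_apply, δ_apply]
      change _ = x.1
      simp only [Fin.val_zero]
      grind
    · rw [comp_apply, step_apply, step_apply, δ_apply]
      simp only [Fin.val_zero]
      grind
  h_last_comp_δ_last n := by
    refine (cylEval_map _ _ _ _).trans ?_
    rw [NatTrans.comp_app, toCyl_one_app]
    have h1 : cylι X (step n (n + 1)) ≫ Φ.app (op ⦋n⦌) =
        cylEval Φ (𝟙 ⦋n⦌) (step n (n + 1)) := by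
      unfold cylEval
      rw [op_id, X.map_id, Category.id_comp]
    rw [h1]
    refine cylEval_congr Φ (fun x => ?_) (fun x => ?_)
    · have hx := x.2
      rw [comp_apply, σ_apply, δ_apply]
      change _ = x.1
      simp only [Fin.val_last]
      grind
    · have hx := x.2
      rw [comp_apply, step_apply, step_apply, δ_apply]
      simp only [Fin.val_last]
      grind
  h_succ_comp_δ_castSucc_of_lt {n} i j hij := by
    have hij' : i.1 ≤ j.1 := hij
    refine (cylEval_map _ _ _ _).trans (Eq.trans ?_ (map_cylEval _ _ _ _).symm)
    refine cylEval_congr Φ (fun x => ?_) (fun x => ?_)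
    · have hx := x.2
      rw [comp_apply, comp_apply, σ_apply, δ_apply, δ_apply, σ_apply]
      simp only [Fin.val_succ, Fin.val_castSucc]
      grind
    · have hx := x.2
      rw [comp_apply, step_apply, step_apply, δ_apply]
      simp only [Fin.val_succ, Fin.val_castSucc]
      grind
  h_succ_comp_δ_castSucc_succ {n} j := by
    refine (cylEval_map _ _ _ _).trans (Eq.trans ?_ (cylEval_map _ _ _ _).symm)
    refine cylEval_congr Φ (fun x => ?_) (fun x => ?_)
    · have hx := x.2
      rw [comp_apply, comp_apply, σ_apply, δ_apply, σ_apply, δ_apply]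
      simp only [Fin.val_succ, Fin.val_castSucc]
      grind
    · have hx := x.2
      rw [comp_apply, comp_apply, step_apply, step_apply, δ_apply]
      simp only [Fin.val_succ, Fin.val_castSucc]
      grind
  h_castSucc_comp_δ_succ_of_lt {n} i j hji := by
    have hij' : j.1 < i.1 := hji
    refine (cylEval_map _ _ _ _).trans (Eq.trans ?_ (map_cylEval _ _ _ _).symm)
    refine cylEval_congr Φ (fun x => ?_) (fun x => ?_)
    · have hx := x.2
      rw [comp_apply, comp_apply, σ_apply, δ_apply, δ_apply, σ_apply]
      simp only [Fin.val_succ, Fin.val_castSucc]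
      grind
    · have hx := x.2
      rw [comp_apply, step_apply, step_apply, δ_apply]
      simp only [Fin.val_succ, Fin.val_castSucc]
      grind
  h_comp_σ_castSucc_of_le {n} i j hij := by
    have hij' : i.1 ≤ j.1 := hij
    refine (cylEval_map _ _ _ _).trans (Eq.trans ?_ (map_cylEval _ _ _ _).symm)
    refine cylEval_congr Φ (fun x => ?_) (fun x => ?_)
    · have hx := x.2
      rw [comp_apply, comp_apply, σ_apply, σ_apply, σ_apply, σ_apply]
      simp only [Fin.val_succ, Fin.val_castSucc]
      grind
    · have hx := x.2
      rw [comp_apply, step_apply, step_apply, σ_apply]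
      simp only [Fin.val_succ, Fin.val_castSucc]
      grind
  h_comp_σ_succ_of_lt {n} i j hji := by
    have hij' : j.1 ≤ i.1 := hji
    refine (cylEval_map _ _ _ _).trans (Eq.trans ?_ (map_cylEval _ _ _ _).symm)
    refine cylEval_congr Φ (fun x => ?_) (fun x => ?_)
    · have hx := x.2
      rw [comp_apply, comp_apply, σ_apply, σ_apply, σ_apply, σ_apply]
      simp only [Fin.val_succ, Fin.val_castSucc]
      grind
    · have hx := x.2
      rw [comp_apply, step_apply, step_apply, σ_apply]
      simp only [Fin.val_succ, Fin.val_castSucc]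
      grind

end Cylinder

/-! ### Lifting chain maps by the Dold–Kan correspondence -/

section DoldKan

open AlgebraicTopology AlgebraicTopology.DoldKan CategoryTheory.Idempotents

variable {A : Type u} [Category.{v} A] [Preadditive A] [HasFiniteBiproducts A]

/-- `A` need not be idempotent complete, so the Dold–Kan equivalence `N₂` lives on Karoubi
envelopes. `N₁` is its restriction along the fully faithful `toKaroubi`. -/
instance N₁_full : (N₁ : SimplicialObject A ⥤ _).Full := by
  have : (N₂ : Karoubi (SimplicialObject A) ⥤ _).Full :=
    inferInstanceAs (CategoryTheory.Preadditive.DoldKan.equivalence (C := A)).functor.Full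
  exact Functor.Full.of_iso (toKaroubiCompN₂IsoN₁ (C := A))

instance N₁_faithful : (N₁ : SimplicialObject A ⥤ _).Faithful := by
  have : (N₂ : Karoubi (SimplicialObject A) ⥤ _).Faithful :=
    inferInstanceAs (CategoryTheory.Preadditive.DoldKan.equivalence (C := A)).functor.Faithful
  exact Functor.Faithful.of_iso (toKaroubiCompN₂IsoN₁ (C := A))

omit [HasFiniteBiproducts A] in
lemma PInfty_comp_map {X Y : SimplicialObject A} (f : X ⟶ Y) :
    (PInfty : (alternatingFaceMapComplex A).obj X ⟶ _) ≫ (alternatingFaceMapComplex A).map f =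
      (alternatingFaceMapComplex A).map f ≫ PInfty :=
  (natTransPInfty A).naturality f |>.symm

/-- Every chain map between alternating face map complexes comes from a simplicial map, up to the
projections on the normalized complexes. -/
lemma exists_simplicial_map {X Y : SimplicialObject A}
    (φ : (alternatingFaceMapComplex A).obj X ⟶ (alternatingFaceMapComplex A).obj Y) :
    ∃ f : X ⟶ Y, (PInfty : (alternatingFaceMapComplex A).obj X ⟶ _) ≫
      (alternatingFaceMapComplex A).map f =
      (PInfty : (alternatingFaceMapComplex A).obj X ⟶ _) ≫ φ ≫ PInfty := by
  let ψ : (N₁ : SimplicialObject A ⥤ _).obj X ⟶ N₁.obj Y :=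
    { f := (PInfty : (alternatingFaceMapComplex A).obj X ⟶ _) ≫ φ ≫ PInfty
      comm := by
        change (PInfty ≫ (PInfty ≫ φ ≫ PInfty) ≫ PInfty : (alternatingFaceMapComplex A).obj X ⟶ _) = _
        simp only [Category.assoc, PInfty_idem, PInfty_idem_assoc] }
  obtain ⟨f, hf⟩ := (N₁ : SimplicialObject A ⥤ _).map_surjective ψ
  exact ⟨f, congr_arg Karoubi.Hom.f hf⟩

lemma simplicial_map_ext {X Y : SimplicialObject A} {f g : X ⟶ Y}
    (h : (PInfty : (alternatingFaceMapComplex A).obj X ⟶ _) ≫ (alternatingFaceMapComplex A).map f =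
      PInfty ≫ (alternatingFaceMapComplex A).map g) : f = g :=
  (N₁ : SimplicialObject A ⥤ _).map_injective (Karoubi.Hom.ext h)

end DoldKan

/-! ### Lifting chain homotopies to simplicial homotopies -/

section HomotopyLifting

open AlgebraicTopology AlgebraicTopology.DoldKan

variable {A : Type u} [Category.{v} A] [Preadditive A] [HasFiniteBiproducts A]

/-- The value of `σ : [n] ⟶ [1]` at `k`. -/
def stepVal {n : ℕ} (σ : ⦋n⦌ ⟶ ⦋1⦌) (k : Fin (n + 1)) : ℕ :=
  ((SimplexCategory.Hom.toOrderHom σ k : Fin 2) : ℕ)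

lemma stepVal_lt {n : ℕ} (σ : ⦋n⦌ ⟶ ⦋1⦌) (k : Fin (n + 1)) : stepVal σ k < 2 :=
  (SimplexCategory.Hom.toOrderHom σ k : Fin 2).2

lemma stepVal_mono {n : ℕ} (σ : ⦋n⦌ ⟶ ⦋1⦌) {k l : Fin (n + 1)} (h : k ≤ l) :
    stepVal σ k ≤ stepVal σ l :=
  (SimplexCategory.Hom.toOrderHom σ).monotone h

lemma stepVal_δ {n : ℕ} (σ : ⦋n + 1⦌ ⟶ ⦋1⦌) (i : Fin (n + 2)) (k : Fin (n + 1)) :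
    stepVal (SimplexCategory.δ i ≫ σ) k = stepVal σ (i.succAbove k) := rfl

variable {X Y : SimplicialObject A} {f g : X ⟶ Y}
  (h : Homotopy ((alternatingFaceMapComplex A).map f) ((alternatingFaceMapComplex A).map g))

/-- The component `X_n ⟶ Y_{n+1}` of a chain homotopy. -/
def homotopyComponent (n : ℕ) : X _⦋n⦌ ⟶ Y _⦋n + 1⦌ := h.hom n (n + 1)

/-- The alternating sum of the faces. -/
abbrev faceSum (X : SimplicialObject A) (n : ℕ) : X _⦋n + 1⦌ ⟶ X _⦋n⦌ :=
  ∑ i : Fin (n + 2), ((-1 : ℤ) ^ (i : ℕ)) • X.δ i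

omit [HasFiniteBiproducts A] in
lemma homotopyComponent_zero :
    f.app (op ⦋0⦌) = homotopyComponent h 0 ≫ faceSum Y 0 + g.app (op ⦋0⦌) := by
  have h1 := h.comm 0
  rw [dNext_eq_zero _ _ (by simp), prevD_eq (w := show (ComplexShape.down ℕ).Rel 1 0 by simp),
    zero_add] at h1
  have h2 : ((alternatingFaceMapComplex A).obj Y).d 1 0 = faceSum Y 0 :=
    alternatingFaceMapComplex_obj_d Y 0
  rw [h2] at h1
  exact h1

omit [HasFiniteBiproducts A] in
lemma homotopyComponent_succ (n : ℕ) :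
    f.app (op ⦋n + 1⦌) = faceSum X n ≫ homotopyComponent h n +
      homotopyComponent h (n + 1) ≫ faceSum Y (n + 1) + g.app (op ⦋n + 1⦌) := by
  have h1 := h.comm (n + 1)
  rw [dNext_eq (w := show (ComplexShape.down ℕ).Rel (n + 1) n by simp),
    prevD_eq (w := show (ComplexShape.down ℕ).Rel (n + 2) (n + 1) by simp)] at h1
  have h2 : ((alternatingFaceMapComplex A).obj Y).d (n + 2) (n + 1) = faceSum Y (n + 1) :=
    alternatingFaceMapComplex_obj_d Y (n + 1)
  have h3 : ((alternatingFaceMapComplex A).obj X).d (n + 1) n = faceSum X n :=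
    alternatingFaceMapComplex_obj_d X n
  rw [h2, h3] at h1
  exact h1

/-- The correction term: it is `h ∘ d_0` on the summand indexed by `(0, 1, …, 1)`. -/
def jumpTerm {n : ℕ} (σ : ⦋n⦌ ⟶ ⦋1⦌) : X _⦋n⦌ ⟶ Y _⦋n⦌ :=
  match n, σ with
  | 0, _ => 0
  | n + 1, σ => if stepVal σ 0 = stepVal σ 1 then 0 else X.δ 0 ≫ homotopyComponent h n

/-- The morphism `Cyl X ⟶ Y` in degree `n` on the summand indexed by `σ`. -/
def cylTerm {n : ℕ} (σ : ⦋n⦌ ⟶ ⦋1⦌) : X _⦋n⦌ ⟶ Y _⦋n⦌ :=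
  (if stepVal σ 0 = 0 then f else g).app (op ⦋n⦌) - jumpTerm h σ

omit [HasFiniteBiproducts A] in
lemma jumpTerm_of_eq {n : ℕ} (σ : ⦋n⦌ ⟶ ⦋1⦌) (hσ : ∀ k, stepVal σ 0 = stepVal σ k) :
    jumpTerm h σ = 0 := by
  cases n with
  | zero => rfl
  | succ n => exact if_pos (hσ 1)

omit [HasFiniteBiproducts A] in
lemma faceSum_naturality (f : X ⟶ Y) (n : ℕ) :
    f.app (op ⦋n + 1⦌) ≫ faceSum Y n = faceSum X n ≫ f.app (op ⦋n⦌) := by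
  rw [Preadditive.comp_sum, Preadditive.sum_comp]
  refine Finset.sum_congr rfl fun i _ => ?_
  rw [Preadditive.comp_zsmul, Preadditive.zsmul_comp]
  congr 1
  exact (SimplicialObject.δ_naturality f i).symm

-- All faces of `σ` have the same initial value as `σ`, so the main terms match by naturality of `f`
-- or `g`. Correction terms can only come from the faces `0` and `1`; they have opposite signs and
-- cancel because `X.δ 1 ≫ X.δ 0 = X.δ 0 ≫ X.δ 0`.
omit [HasFiniteBiproducts A] in
lemma comp_faceSum_of_eq {n : ℕ} (σ : ⦋n + 1⦌ ⟶ ⦋1⦌) (hσ : stepVal σ 0 = stepVal σ 1) :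
    cylTerm h σ ≫ faceSum Y n =
      ∑ i : Fin (n + 2), ((-1 : ℤ) ^ (i : ℕ)) • X.δ i ≫ cylTerm h (SimplexCategory.δ i ≫ σ) := by
  have h0 : ∀ i : Fin (n + 2), stepVal (SimplexCategory.δ i ≫ σ) 0 = stepVal σ 0 := fun i => by
    rw [stepVal_δ]
    obtain rfl | ⟨i, rfl⟩ := Fin.eq_zero_or_eq_succ i
    · exact hσ.symm
    · rfl
  have h1 : jumpTerm h σ = 0 := if_pos hσ
  have h2 : ∑ i : Fin (n + 2), ((-1 : ℤ) ^ (i : ℕ)) • X.δ i ≫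
      jumpTerm h (SimplexCategory.δ i ≫ σ) = 0 := by
    cases n with
    | zero =>
      refine Finset.sum_eq_zero fun i _ => ?_
      rw [show jumpTerm h (SimplexCategory.δ i ≫ σ) = 0 from rfl, comp_zero, smul_zero]
    | succ n =>
      have h3 : ∀ i : Fin (n + 3), jumpTerm h (SimplexCategory.δ i ≫ σ) =
        if stepVal σ 0 = stepVal σ (i.succAbove 1) then 0 else
          X.δ 0 ≫ homotopyComponent h n := fun i => by
        rw [← h0 i]
        rfl
      rw [Fin.sum_univ_succ, Fin.sum_univ_succ, Finset.sum_eq_zero, add_zero]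
      · rw [h3, h3]
        have h4 : (Fin.succAbove (0 : Fin (n + 3)) 1) = Fin.succAbove (Fin.succ 0) 1 := rfl
        rw [h4]
        split_ifs
        · simp
        · have h5 : X.δ (Fin.succ (0 : Fin (n + 2))) ≫ X.δ (0 : Fin (n + 2)) = X.δ 0 ≫ X.δ 0 :=
            X.δ_comp_δ (le_refl (0 : Fin (n + 2)))
          rw [reassoc_of% h5]
          simp
      · intro i _
        have h6 : Fin.succAbove i.succ.succ 1 = 1 := by
          apply Fin.ext
          simp [Fin.succAbove, Fin.lt_def]
        rw [h3, h6, if_pos hσ, comp_zero, smul_zero]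
  have h7 : ∀ i : Fin (n + 2), ((-1 : ℤ) ^ (i : ℕ)) • X.δ i ≫
      cylTerm h (SimplexCategory.δ i ≫ σ) =
      (((-1 : ℤ) ^ (i : ℕ)) • X.δ i) ≫ (if stepVal σ 0 = 0 then f else g).app (op ⦋n⦌) -
        ((-1 : ℤ) ^ (i : ℕ)) • X.δ i ≫ jumpTerm h (SimplexCategory.δ i ≫ σ) := fun i => by
    unfold cylTerm
    rw [h0, Preadditive.comp_sub, smul_sub, Preadditive.zsmul_comp]
  rw [Finset.sum_congr rfl fun i _ => h7 i, Finset.sum_sub_distrib, h2, sub_zero,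
    ← Preadditive.sum_comp, ← faceSum_naturality]
  unfold cylTerm
  rw [h1, sub_zero]

-- Here `σ = (0, 1, …, 1)`. Its face `0` is constant and contributes `g`. For `n > 0` the other
-- faces are again of the form `(0, 1, …, 1)` and contribute `f - X.δ 0 ≫ h`; for `n = 0` the other
-- face is constant and contributes `f`. With `X.δ i.succ ≫ X.δ 0 = X.δ 0 ≫ X.δ i`, the claim
-- becomes the homotopy relation for `h` precomposed with `X.δ 0`.
omit [HasFiniteBiproducts A] in
lemma comp_faceSum_of_ne {n : ℕ} (σ : ⦋n + 1⦌ ⟶ ⦋1⦌) (hσ : stepVal σ 0 ≠ stepVal σ 1) :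
    cylTerm h σ ≫ faceSum Y n =
      ∑ i : Fin (n + 2), ((-1 : ℤ) ^ (i : ℕ)) • X.δ i ≫ cylTerm h (SimplexCategory.δ i ≫ σ) := by
  have h0 : stepVal σ 0 = 0 := by
    have := stepVal_lt σ 1
    have := stepVal_mono σ (Fin.zero_le 1)
    omega
  have h1 : ∀ k : Fin (n + 1), stepVal σ k.succ = 1 := fun k => by
    have := stepVal_lt σ k.succ
    have := stepVal_mono σ (show (1 : Fin (n + 2)) ≤ k.succ by
      rw [Fin.le_def]
      simp)
    have := stepVal_lt σ 1
    omega
  have h2 : cylTerm h (SimplexCategory.δ 0 ≫ σ) = g.app (op ⦋n⦌) := by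
    unfold cylTerm
    rw [jumpTerm_of_eq, sub_zero, if_neg]
    · rw [stepVal_δ, Fin.succAbove_zero, h1]
      exact one_ne_zero
    · intro k
      rw [stepVal_δ, stepVal_δ, Fin.succAbove_zero, h1, h1]
  have h3 : ∀ i : Fin (n + 1), stepVal (SimplexCategory.δ i.succ ≫ σ) 0 = 0 := fun i => h0
  have h4 : cylTerm h σ = f.app (op ⦋n + 1⦌) - X.δ 0 ≫ homotopyComponent h n := by
    unfold cylTerm
    rw [if_pos h0]
    congr 1
    exact if_neg hσ
  rw [h4, Preadditive.sub_comp, faceSum_naturality, faceSum, Fin.sum_univ_succ,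
    Fin.sum_univ_succ (f := fun i : Fin (n + 2) => ((-1 : ℤ) ^ (i : ℕ)) • X.δ i ≫
      cylTerm h (SimplexCategory.δ i ≫ σ)), h2, Category.assoc]
  cases n with
  | zero =>
    have h5 := homotopyComponent_zero h
    have h6 : ∀ i : Fin 1, cylTerm h (SimplexCategory.δ i.succ ≫ σ) = f.app (op ⦋0⦌) := fun i => by
      unfold cylTerm
      rw [if_pos (h3 i)]
      exact sub_zero _
    rw [← sub_eq_iff_eq_add] at h5
    have hs : ∑ i : Fin 1, ((-1 : ℤ) ^ (i.succ : ℕ)) • X.δ i.succ ≫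
        cylTerm h (SimplexCategory.δ i.succ ≫ σ) =
        (∑ i : Fin 1, ((-1 : ℤ) ^ (i.succ : ℕ)) • X.δ i.succ) ≫ f.app (op ⦋0⦌) := by
      rw [Preadditive.sum_comp]
      exact Finset.sum_congr rfl fun i _ => by rw [h6 i, Preadditive.zsmul_comp]
    rw [← h5, hs, Preadditive.add_comp, Preadditive.comp_sub]
    simp only [Fin.val_zero, pow_zero, one_smul]
    abel
  | succ n =>
    have h5 := homotopyComponent_succ h n
    have h6 : ∀ i : Fin (n + 2), cylTerm h (SimplexCategory.δ i.succ ≫ σ) =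
        f.app (op ⦋n + 1⦌) - X.δ 0 ≫ homotopyComponent h n := fun i => by
      unfold cylTerm
      rw [if_pos (h3 i)]
      congr 1
      refine if_neg ?_
      rw [h3 i, stepVal_δ]
      have h7 : Fin.succAbove i.succ 1 = (Fin.succAbove i 0).succ := Fin.succ_succAbove_succ i 0
      rw [h7, h1]
      simp
    rw [← sub_eq_iff_eq_add, ← sub_eq_iff_eq_add'] at h5
    have h8 : X.δ 0 ≫ faceSum X n ≫ homotopyComponent h n =
        - ∑ i : Fin (n + 2), (((-1 : ℤ) ^ (i.succ : ℕ)) • X.δ i.succ) ≫ X.δ 0 ≫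
          homotopyComponent h n := by
      rw [← Category.assoc, Preadditive.comp_sum, Preadditive.sum_comp, ← Finset.sum_neg_distrib]
      refine Finset.sum_congr rfl fun i _ => ?_
      have h9 : X.δ i.succ ≫ X.δ (0 : Fin (n + 2)) = X.δ 0 ≫ X.δ i := X.δ_comp_δ (Fin.zero_le i)
      rw [Preadditive.comp_zsmul, Preadditive.zsmul_comp, Preadditive.zsmul_comp,
        ← Category.assoc (X.δ i.succ), h9, Fin.val_succ, pow_succ, mul_neg, mul_one, neg_smul,
        neg_neg]
    have hs : ∑ i : Fin (n + 2), ((-1 : ℤ) ^ (i.succ : ℕ)) • X.δ i.succ ≫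
        cylTerm h (SimplexCategory.δ i.succ ≫ σ) =
        (∑ i : Fin (n + 2), ((-1 : ℤ) ^ (i.succ : ℕ)) • X.δ i.succ) ≫ f.app (op ⦋n + 1⦌) -
          ∑ i : Fin (n + 2), (((-1 : ℤ) ^ (i.succ : ℕ)) • X.δ i.succ) ≫ X.δ 0 ≫
            homotopyComponent h n := by
      rw [Preadditive.sum_comp, ← Finset.sum_sub_distrib]
      exact Finset.sum_congr rfl fun i _ => by
        rw [h6 i, Preadditive.zsmul_comp, Preadditive.zsmul_comp, Preadditive.comp_sub, smul_sub]
    rw [← h5, hs, Preadditive.comp_sub, Preadditive.comp_sub, h8, Preadditive.add_comp]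
    simp only [Fin.val_zero, pow_zero, one_smul]
    abel

/-- The chain map `K (Cyl X) ⟶ K Y` associated to a chain homotopy. -/
def cylChainMap : (alternatingFaceMapComplex A).obj (cyl X) ⟶
    (alternatingFaceMapComplex A).obj Y where
  f n := cylDesc fun σ => cylTerm h σ
  comm' i j hij := by
    obtain rfl : j + 1 = i := hij
    refine (congr_arg (fun φ => _ ≫ φ) (alternatingFaceMapComplex_obj_d Y j)).trans
      (Eq.trans ?_ (congr_arg (fun φ => φ ≫ _) (alternatingFaceMapComplex_obj_d (cyl X) j)).symm)
    refine cyl_hom_ext fun σ => ?_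
    have h1 : cylι X σ ≫ faceSum (cyl X) j ≫ cylDesc (fun σ => cylTerm h σ) =
        ∑ i : Fin (j + 2), ((-1 : ℤ) ^ (i : ℕ)) • X.δ i ≫
          cylTerm h (SimplexCategory.δ i ≫ σ) := by
      rw [← Category.assoc, Preadditive.comp_sum, Preadditive.sum_comp]
      refine Finset.sum_congr rfl fun i _ => ?_
      rw [Preadditive.comp_zsmul, Preadditive.zsmul_comp]
      congr 1
      refine (congr_arg (fun φ => φ ≫ cylDesc (fun σ => cylTerm h σ))
        (cylι_map X σ (SimplexCategory.δ i))).trans ?_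
      rw [Category.assoc, cylι_desc]
      rfl
    have h2 : cylι X σ ≫ cylDesc (fun σ => cylTerm h σ) ≫ faceSum Y j =
        cylTerm h σ ≫ faceSum Y j := by
      rw [← Category.assoc, cylι_desc]
    refine h2.trans (Eq.trans ?_ h1.symm)
    by_cases hσ : stepVal σ 0 = stepVal σ 1
    · exact comp_faceSum_of_eq h σ hσ
    · exact comp_faceSum_of_ne h σ hσ

lemma toCyl_one_cylChainMap :
    (alternatingFaceMapComplex A).map (toCyl X (SimplexCategory.δ 1)) ≫ cylChainMap h =
      (alternatingFaceMapComplex A).map f := by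
  refine HomologicalComplex.hom_ext _ _ fun n => ?_
  change (toCyl X (SimplexCategory.δ 1)).app (op ⦋n⦌) ≫ cylDesc (fun σ => cylTerm h σ) = f.app _
  rw [toCyl_one_app, cylι_desc]
  have h1 : ∀ k : Fin (n + 1), stepVal (step n (n + 1)) k = 0 := fun k =>
    (step_apply _ _ _).trans (if_pos k.2)
  unfold cylTerm
  rw [if_pos (h1 0), jumpTerm_of_eq, sub_zero]
  intro k
  rw [h1, h1]

lemma toCyl_zero_cylChainMap :
    (alternatingFaceMapComplex A).map (toCyl X (SimplexCategory.δ 0)) ≫ cylChainMap h =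
      (alternatingFaceMapComplex A).map g := by
  refine HomologicalComplex.hom_ext _ _ fun n => ?_
  change (toCyl X (SimplexCategory.δ 0)).app (op ⦋n⦌) ≫ cylDesc (fun σ => cylTerm h σ) = g.app _
  rw [toCyl_zero_app, cylι_desc]
  have h1 : ∀ k : Fin (n + 1), stepVal (step n 0) k = 1 := fun k =>
    (step_apply _ _ _).trans (if_neg (Nat.not_lt_zero _))
  unfold cylTerm
  rw [if_neg (by rw [h1]; exact one_ne_zero), jumpTerm_of_eq, sub_zero]
  intro k
  rw [h1, h1]

include h in
/-- Simplicial maps which are homotopic on the alternating face map complexes are homotopic. -/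
theorem nonempty_simplicialHomotopy : Nonempty (SimplicialObject.Homotopy f g) := by
  -- Fullness realizes the chain map out of the cylinder by a simplicial map, up to the projectors
  -- `PInfty`.
  obtain ⟨Φ, hΦ⟩ := exists_simplicial_map (cylChainMap h)
  -- On the two ends `Φ` agrees with `f` and `g` after composition with `PInfty`, hence exactly, by
  -- faithfulness.
  have h1 : ∀ (e : X ⟶ cyl X) (f' : X ⟶ Y),
      (alternatingFaceMapComplex A).map e ≫ cylChainMap h = (alternatingFaceMapComplex A).map f' →
      e ≫ Φ = f' := fun e f' he => by
    apply simplicial_map_ext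
    rw [CategoryTheory.Functor.map_comp, ← Category.assoc, PInfty_comp_map, Category.assoc, hΦ,
      ← Category.assoc, ← PInfty_comp_map, Category.assoc, reassoc_of% he,
      ← PInfty_comp_map, PInfty_idem_assoc]
  have h2 := cylHomotopy Φ
  rw [h1 _ _ (toCyl_one_cylChainMap h), h1 _ _ (toCyl_zero_cylChainMap h)] at h2
  exact ⟨h2⟩

/-- A morphism of simplicial objects is a simplicial homotopy equivalence if and only if it is a
homotopy equivalence on the alternating face map complexes. -/
theorem simplicialHomotopyEquivalences_iff (f : X ⟶ Y) :
    simplicialHomotopyEquivalences A f ↔ HomologicalComplex.homotopyEquivalences A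
      (ComplexShape.down ℕ) ((alternatingFaceMapComplex A).map f) := by
  constructor
  · rintro ⟨g, ⟨h⟩, ⟨h'⟩⟩
    exact ⟨{
      hom := (alternatingFaceMapComplex A).map f
      inv := (alternatingFaceMapComplex A).map g
      homotopyHomInvId := ((Homotopy.ofEq (CategoryTheory.Functor.map_comp _ _ _).symm).trans
        h.toChainHomotopy).trans (Homotopy.ofEq (CategoryTheory.Functor.map_id _ _))
      homotopyInvHomId := ((Homotopy.ofEq (CategoryTheory.Functor.map_comp _ _ _).symm).trans
        h'.toChainHomotopy).trans (Homotopy.ofEq (CategoryTheory.Functor.map_id _ _)) }, rfl⟩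
  · rintro ⟨e, he⟩
    obtain ⟨g, hg⟩ := exists_simplicial_map e.inv
    -- The two maps agree up to the projectors `PInfty`, which are homotopic to the identity.
    have h1 : Homotopy ((alternatingFaceMapComplex A).map g) e.inv :=
      ((Homotopy.ofEq (Category.id_comp _).symm).trans
        ((homotopyPInftyToId Y).symm.compRight ((alternatingFaceMapComplex A).map g))).trans
      ((Homotopy.ofEq hg).trans (((homotopyPInftyToId Y).compRight (e.inv ≫ PInfty)).trans
        ((Homotopy.ofEq (Category.id_comp _)).trans (((homotopyPInftyToId X).compLeft e.inv).trans
          (Homotopy.ofEq (Category.comp_id _))))))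
    refine ⟨g, nonempty_simplicialHomotopy ?_, nonempty_simplicialHomotopy ?_⟩
    · exact (Homotopy.ofEq (by rw [CategoryTheory.Functor.map_comp, he])).trans
        ((h1.compLeft e.hom).trans (e.homotopyHomInvId.trans
          (Homotopy.ofEq (CategoryTheory.Functor.map_id _ _).symm)))
    · exact (Homotopy.ofEq (by rw [CategoryTheory.Functor.map_comp, he])).trans
        ((h1.compRight e.hom).trans (e.homotopyInvHomId.trans
          (Homotopy.ofEq (CategoryTheory.Functor.map_id _ _).symm)))

end HomotopyLifting

/-! ### The projection of the cylinder -/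

section CylinderProjection

variable {C : Type u'} [Category.{v'} C] [HasFiniteCoproducts C]

/-- The inclusion `X_n ⟶ (Cyl X)_n` indexed by `σ`. -/
def cylIncl (X : SimplicialObject C) (n : SimplexCategoryᵒᵖ) (σ : n.unop ⟶ ⦋1⦌) :
    X.obj n ⟶ (cyl X).obj n :=
  Sigma.ι (fun _ : (n.unop ⟶ ⦋1⦌) => X.obj n) σ

/-- The morphism from `(Cyl X)_n` with given restrictions to the summands. -/
def cylOut (X : SimplicialObject C) (n : SimplexCategoryᵒᵖ) {T : C}
    (φ : (n.unop ⟶ ⦋1⦌) → (X.obj n ⟶ T)) : (cyl X).obj n ⟶ T :=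
  Sigma.desc φ

lemma cylIncl_out (X : SimplicialObject C) (n : SimplexCategoryᵒᵖ) {T : C}
    (φ : (n.unop ⟶ ⦋1⦌) → (X.obj n ⟶ T)) (σ : n.unop ⟶ ⦋1⦌) :
    cylIncl X n σ ≫ cylOut X n φ = φ σ :=
  Sigma.ι_desc _ _

lemma cylIncl_out_assoc (X : SimplicialObject C) (n : SimplexCategoryᵒᵖ) {T T' : C}
    (φ : (n.unop ⟶ ⦋1⦌) → (X.obj n ⟶ T)) (σ : n.unop ⟶ ⦋1⦌) (h : T ⟶ T') :
    cylIncl X n σ ≫ cylOut X n φ ≫ h = φ σ ≫ h := by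
  rw [← Category.assoc, cylIncl_out]

lemma cyl_obj_hom_ext {X : SimplicialObject C} {n : SimplexCategoryᵒᵖ} {T : C}
    {f g : (cyl X).obj n ⟶ T} (h : ∀ σ, cylIncl X n σ ≫ f = cylIncl X n σ ≫ g) : f = g :=
  Sigma.hom_ext _ _ h

lemma cylIncl_map (X : SimplicialObject C) {n m : SimplexCategoryᵒᵖ} (f : n ⟶ m)
    (σ : n.unop ⟶ ⦋1⦌) :
    cylIncl X n σ ≫ (cyl X).map f = X.map f ≫ cylIncl X m (f.unop ≫ σ) :=
  Sigma.ι_desc _ _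

lemma cylIncl_map_assoc (X : SimplicialObject C) {n m : SimplexCategoryᵒᵖ} (f : n ⟶ m)
    (σ : n.unop ⟶ ⦋1⦌) {T : C} (h : (cyl X).obj m ⟶ T) :
    cylIncl X n σ ≫ (cyl X).map f ≫ h = X.map f ≫ cylIncl X m (f.unop ≫ σ) ≫ h := by
  rw [← Category.assoc, cylIncl_map, Category.assoc]

/-- The morphism `Cyl X ⟶ Y` with given restrictions to the summands. -/
def cylHomMk {X Y : SimplicialObject C}
    (φ : ∀ n : SimplexCategoryᵒᵖ, (n.unop ⟶ ⦋1⦌) → (X.obj n ⟶ Y.obj n))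
    (h : ∀ (n m : SimplexCategoryᵒᵖ) (f : n ⟶ m) (σ : n.unop ⟶ ⦋1⦌),
      X.map f ≫ φ m (f.unop ≫ σ) = φ n σ ≫ Y.map f) : cyl X ⟶ Y where
  app n := cylOut X n (φ n)
  naturality n m f := by
    refine cyl_obj_hom_ext fun σ => ?_
    rw [cylIncl_map_assoc, cylIncl_out, cylIncl_out_assoc, h]

/-- The projection `Cyl X ⟶ X`. -/
def cylProj (X : SimplicialObject C) : cyl X ⟶ X :=
  cylHomMk (fun n _ => 𝟙 (X.obj n)) (fun n m f σ => by rw [Category.comp_id, Category.id_comp])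

lemma toCyl_cylProj (X : SimplicialObject C) (e : ⦋0⦌ ⟶ ⦋1⦌) : toCyl X e ≫ cylProj X = 𝟙 X := by
  apply NatTrans.ext
  funext n
  exact Sigma.ι_desc _ _

/-- The minimum of two maps `[n] ⟶ [1]`. -/
def stepInf {n : SimplexCategory} (σ τ : n ⟶ ⦋1⦌) : n ⟶ ⦋1⦌ :=
  SimplexCategory.Hom.mk (SimplexCategory.Hom.toOrderHom σ ⊓ SimplexCategory.Hom.toOrderHom τ)

/-- The morphism `Cyl (Cyl X) ⟶ Cyl X` given by the minimum. -/
def cylInf (X : SimplicialObject C) : cyl (cyl X) ⟶ cyl X :=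
  cylHomMk (fun n τ => cylOut X n fun σ => cylIncl X n (stepInf σ τ)) (fun n m f τ => by
    refine cyl_obj_hom_ext fun σ => ?_
    rw [cylIncl_map_assoc, cylIncl_out, cylIncl_out_assoc, cylIncl_map]
    rfl)

/-- This end has as index the constant map `1`, which is neutral for the minimum. -/
lemma toCyl_zero_cylInf (X : SimplicialObject C) :
    toCyl (cyl X) (SimplexCategory.δ 0) ≫ cylInf X = 𝟙 (cyl X) := by
  apply NatTrans.ext
  funext n
  refine (cylIncl_out _ _ _ _).trans (cyl_obj_hom_ext fun σ => ?_)
  refine (cylIncl_out _ _ _ _).trans (Eq.trans ?_ (Category.comp_id _).symm)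
  refine congr_arg (cylIncl X n) ?_
  apply SimplexCategory.Hom.ext
  apply OrderHom.ext
  funext x
  exact inf_of_le_left (Fin.le_last _)

/-- This end has as index the constant map `0`, which is absorbing for the minimum, so the whole
cylinder is pushed onto it. -/
lemma toCyl_one_cylInf (X : SimplicialObject C) :
    toCyl (cyl X) (SimplexCategory.δ 1) ≫ cylInf X =
      cylProj X ≫ toCyl X (SimplexCategory.δ 1) := by
  apply NatTrans.ext
  funext n
  refine (cylIncl_out _ _ _ _).trans (cyl_obj_hom_ext fun σ => ?_)
  refine (cylIncl_out _ _ _ _).trans (Eq.trans ?_ ((cylIncl_out_assoc X n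
    (fun _ => 𝟙 (X.obj n)) σ _).trans (Category.id_comp _)).symm)
  refine congr_arg (cylIncl X n) ?_
  apply SimplexCategory.Hom.ext
  apply OrderHom.ext
  funext x
  exact inf_of_le_right (Fin.zero_le _)

/-- The projection `Cyl X ⟶ X` is a simplicial homotopy equivalence. -/
lemma simplicialHomotopyEquivalences_cylProj (X : SimplicialObject C) :
    simplicialHomotopyEquivalences C (cylProj X) := by
  have h1 := cylHomotopy (cylInf X)
  rw [toCyl_zero_cylInf, toCyl_one_cylInf] at h1
  -- The homotopy attached to `cylProj X` goes from `𝟙 X` to itself.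
  have h2 := cylHomotopy (cylProj X)
  rw [toCyl_cylProj, toCyl_cylProj] at h2
  refine ⟨toCyl X (SimplexCategory.δ 1), ⟨h1⟩, ⟨?_⟩⟩
  rw [toCyl_cylProj]
  exact h2

end CylinderProjection

/-! ### Pushouts along direct summands -/

section SplitPushout

variable {D : Type u'} [Category.{v'} D] [Preadditive D]

/-- The pushout of the inclusion of a direct summand exists. -/
lemma isPushout_of_split [HasBinaryBiproducts D] {P V R Q : D} (a : P ⟶ V) (r : V ⟶ P)
    (ι : R ⟶ V) (κ : V ⟶ R) (har : a ≫ r = 𝟙 P) (hικ : ι ≫ κ = 𝟙 R)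
    (h : r ≫ a + κ ≫ ι = 𝟙 V) (c : P ⟶ Q) :
    IsPushout a c (biprod.lift (r ≫ c) κ) (biprod.inl : Q ⟶ Q ⊞ R) := by
  have h1 : a ≫ κ = 0 := by
    have h2 : a ≫ κ ≫ ι = 0 := by
      have := congr_arg (fun φ => a ≫ φ) h
      simpa [reassoc_of% har] using this
    have := congr_arg (fun φ => φ ≫ κ) h2
    simpa [hικ] using this
  have h3 : ι ≫ r = 0 := by
    have h2 : ι ≫ r ≫ a = 0 := by
      have := congr_arg (fun φ => ι ≫ φ) h
      simpa [reassoc_of% hικ] using this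
    have := congr_arg (fun φ => φ ≫ r) h2
    simpa [har] using this
  refine ⟨⟨?_⟩, ⟨PushoutCocone.IsColimit.mk _ (fun s => biprod.desc s.inr (ι ≫ s.inl))
    (fun s => ?_) (fun s => ?_) (fun s m hm hm' => ?_)⟩⟩
  · apply biprod.hom_ext <;> simp [reassoc_of% har, h1]
  · rw [biprod.lift_desc, Category.assoc, ← s.condition, ← Category.assoc κ, ← Category.assoc r,
      ← Preadditive.add_comp, h, Category.id_comp]
  · simp
  · apply biprod.hom_ext'
    · simpa using hm'
    · rw [biprod.inr_desc, ← hm]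
      have h4 : ι ≫ biprod.lift (r ≫ c) κ = (biprod.inr : R ⟶ Q ⊞ R) := by
        apply biprod.hom_ext <;> simp [reassoc_of% h3, hικ]
      rw [reassoc_of% h4]

lemma coprod_desc_inl_add_desc_inr [HasBinaryCoproducts D] (X Y : D) :
    coprod.desc (𝟙 X) (0 : Y ⟶ X) ≫ coprod.inl + coprod.desc (0 : X ⟶ Y) (𝟙 Y) ≫ coprod.inr =
      𝟙 (X ⨿ Y) := by
  apply coprod.hom_ext
  · rw [Preadditive.comp_add, coprod.inl_desc_assoc, coprod.inl_desc_assoc]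
    simp
  · rw [Preadditive.comp_add, coprod.inr_desc_assoc, coprod.inr_desc_assoc]
    simp

end SplitPushout

/-! ### Degreewise splitting of the ends of the cylinder -/

section CylinderEnds

variable {D : Type u'} [Category.{v'} D] [Preadditive D] [HasFiniteBiproducts D]

/-- The inclusion `X ⊔ X ⟶ Cyl X` of the two ends. -/
abbrev cylEnds (X : SimplicialObject D) : X ⨿ X ⟶ cyl X :=
  coprod.desc (toCyl X (SimplexCategory.δ 0)) (toCyl X (SimplexCategory.δ 1))

/-- The constant map `[n] ⟶ [1]` factoring through `e : [0] ⟶ [1]`. -/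
abbrev endIndex (n : SimplexCategory) (e : ⦋0⦌ ⟶ ⦋1⦌) : n ⟶ ⦋1⦌ :=
  SimplexCategory.const n ⦋0⦌ 0 ≫ e

lemma endIndex_ne (n : SimplexCategory) :
    endIndex n (SimplexCategory.δ 1) ≠ endIndex n (SimplexCategory.δ 0) := by
  intro h
  have h1 := congr_arg (fun σ => SimplexCategory.Hom.toOrderHom σ 0) h
  exact Fin.zero_ne_one (n := 0) h1

open Classical in
/-- A retraction of the inclusion of the two ends, in degree `n`. -/
def cylRetract (X : SimplicialObject D) (n : SimplexCategoryᵒᵖ) :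
    (cyl X).obj n ⟶ (X ⨿ X).obj n :=
  cylOut X n fun σ =>
    if σ = endIndex n.unop (SimplexCategory.δ 0) then (coprod.inl : X ⟶ X ⨿ X).app n
    else if σ = endIndex n.unop (SimplexCategory.δ 1) then (coprod.inr : X ⟶ X ⨿ X).app n else 0

lemma toCyl_zero_cylRetract (X : SimplicialObject D) (n : SimplexCategoryᵒᵖ) :
    (toCyl X (SimplexCategory.δ 0)).app n ≫ cylRetract X n = (coprod.inl : X ⟶ X ⨿ X).app n :=
  (Sigma.ι_desc _ _).trans (if_pos rfl)

lemma toCyl_one_cylRetract (X : SimplicialObject D) (n : SimplexCategoryᵒᵖ) :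
    (toCyl X (SimplexCategory.δ 1)).app n ≫ cylRetract X n = (coprod.inr : X ⟶ X ⨿ X).app n :=
  (Sigma.ι_desc _ _).trans ((if_neg (endIndex_ne n.unop)).trans (if_pos rfl))

lemma cylEnds_cylRetract (X : SimplicialObject D) (n : SimplexCategoryᵒᵖ) :
    (cylEnds X).app n ≫ cylRetract X n = 𝟙 _ := by
  have h1 : (coprod.inl : X ⟶ X ⨿ X) ≫ cylEnds X = toCyl X (SimplexCategory.δ 0) :=
    coprod.inl_desc _ _
  have h2 : (coprod.inr : X ⟶ X ⨿ X) ≫ cylEnds X = toCyl X (SimplexCategory.δ 1) :=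
    coprod.inr_desc _ _
  have h3 := congr_app (coprod_desc_inl_add_desc_inr X X) n
  have h4 : (cylEnds X).app n = (coprod.desc (𝟙 X) (0 : X ⟶ X)).app n ≫
      (toCyl X (SimplexCategory.δ 0)).app n + (coprod.desc (0 : X ⟶ X) (𝟙 X)).app n ≫
      (toCyl X (SimplexCategory.δ 1)).app n := by
    rw [← h1, ← h2]
    have h5 : cylEnds X = coprod.desc (𝟙 X) (0 : X ⟶ X) ≫ coprod.inl ≫ cylEnds X +
        coprod.desc (0 : X ⟶ X) (𝟙 X) ≫ coprod.inr ≫ cylEnds X := by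
      rw [← Category.assoc, ← Category.assoc, ← Preadditive.add_comp,
        coprod_desc_inl_add_desc_inr, Category.id_comp]
    exact congr_app h5 n
  rw [h4, Preadditive.add_comp, Category.assoc, Category.assoc, toCyl_zero_cylRetract,
    toCyl_one_cylRetract]
  exact h3

/-- The indices of the summands of the cylinder which do not belong to the two ends. -/
abbrev InnerIndex (n : SimplexCategory) : Type :=
  { σ : n ⟶ ⦋1⦌ // σ ≠ endIndex n (SimplexCategory.δ 0) ∧ σ ≠ endIndex n (SimplexCategory.δ 1) }

/-- The inclusion of the summands which do not belong to the two ends. -/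
def cylInnerι (X : SimplicialObject D) (n : SimplexCategoryᵒᵖ) :
    (∐ fun _ : InnerIndex n.unop => X.obj n) ⟶ (cyl X).obj n :=
  Sigma.desc fun σ => cylIncl X n σ.1

open Classical in
/-- The projection onto the summands which do not belong to the two ends. -/
def cylInnerProj (X : SimplicialObject D) (n : SimplexCategoryᵒᵖ) :
    (cyl X).obj n ⟶ ∐ fun _ : InnerIndex n.unop => X.obj n :=
  cylOut X n fun σ =>
    if h : σ ≠ endIndex n.unop (SimplexCategory.δ 0) ∧ σ ≠ endIndex n.unop (SimplexCategory.δ 1)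
      then Sigma.ι (fun _ : InnerIndex n.unop => X.obj n) ⟨σ, h⟩ else 0

lemma cylInnerι_cylInnerProj (X : SimplicialObject D) (n : SimplexCategoryᵒᵖ) :
    cylInnerι X n ≫ cylInnerProj X n = 𝟙 _ := by
  refine Sigma.hom_ext _ _ fun σ => ?_
  refine (Sigma.ι_desc_assoc _ _ _).trans ((cylIncl_out _ _ _ _).trans ?_)
  rw [dif_pos σ.2, Category.comp_id]

/-- Each index is one of the two ends or lies in `InnerIndex`; the identity is checked on the three
kinds of summands. -/
lemma cylRetract_add_cylInnerProj (X : SimplicialObject D) (n : SimplexCategoryᵒᵖ) :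
    cylRetract X n ≫ (cylEnds X).app n + cylInnerProj X n ≫ cylInnerι X n = 𝟙 _ := by
  refine cyl_obj_hom_ext fun σ => ?_
  rw [Preadditive.comp_add, Category.comp_id, cylRetract, cylInnerProj, cylIncl_out_assoc,
    cylIncl_out_assoc]
  by_cases hσ : σ = endIndex n.unop (SimplexCategory.δ 0)
  · subst hσ
    rw [if_pos rfl, dif_neg (fun h => h.1 rfl), zero_comp, add_zero]
    exact congr_app (coprod.inl_desc (toCyl X (SimplexCategory.δ 0))
      (toCyl X (SimplexCategory.δ 1))) n
  · by_cases hσ' : σ = endIndex n.unop (SimplexCategory.δ 1)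
    · subst hσ'
      rw [if_neg hσ, if_pos rfl, dif_neg (fun h => h.2 rfl), zero_comp, add_zero]
      exact congr_app (coprod.inr_desc (toCyl X (SimplexCategory.δ 0))
        (toCyl X (SimplexCategory.δ 1))) n
    · rw [if_neg hσ, if_neg hσ', dif_pos ⟨hσ, hσ'⟩, zero_comp, zero_add]
      exact Sigma.ι_desc _ _

/-- In degree `n` the two ends form a direct summand of the cylinder, with complement the coproduct
over `InnerIndex`. So `isPushout_of_split` provides the pushout, although `D` need not have pushouts
in general. -/
instance hasColimit_span_flip_obj {X Q : SimplicialObject D} (c : X ⨿ X ⟶ Q)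
    (n : SimplexCategoryᵒᵖ) :
    HasColimit ((CategoryTheory.Functor.flip (span (C := SimplexCategoryᵒᵖ ⥤ D)
      (cylEnds X) c)).obj n) := by
  have := HasBinaryBiproducts.of_hasBinaryCoproducts (C := D)
  have h1 := isPushout_of_split _ (cylRetract X n) (cylInnerι X n) (cylInnerProj X n)
    (cylEnds_cylRetract X n) (cylInnerι_cylInnerProj X n) (cylRetract_add_cylInnerProj X n)
    (c.app n)
  have h2 : HasColimit (span (((CategoryTheory.Functor.flip (span (C := SimplexCategoryᵒᵖ ⥤ D)
      (cylEnds X) c)).obj n).map WalkingSpan.Hom.fst) (((CategoryTheory.Functor.flip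
      (span (C := SimplexCategoryᵒᵖ ⥤ D) (cylEnds X) c)).obj n).map WalkingSpan.Hom.snd)) :=
    h1.hasPushout
  exact hasColimit_of_iso (diagramIsoSpan _)

lemma hasPushout_cylEnds {X Q : SimplicialObject D} (c : X ⨿ X ⟶ Q) :
    HasPushout (cylEnds X) c :=
  functorCategoryHasColimit (C := D) (K := SimplexCategoryᵒᵖ)
    (span (C := SimplexCategoryᵒᵖ ⥤ D) (cylEnds X) c)

/-- The pushouts exist in every degree, so pushouts of simplicial objects along `cylEnds` are
computed degreewise. -/
lemma isPushout_app {X Q C : SimplicialObject D} {c : X ⨿ X ⟶ Q} {j : cyl X ⟶ C} {i : Q ⟶ C}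
    (h : IsPushout (cylEnds X) c j i) (n : SimplexCategoryᵒᵖ) :
    IsPushout ((cylEnds X).app n) (c.app n) (j.app n) (i.app n) := by
  have : PreservesColimit (span (C := SimplexCategoryᵒᵖ ⥤ D) (cylEnds X) c)
    ((evaluation SimplexCategoryᵒᵖ D).obj n) := inferInstance
  exact IsPushout.map (C := SimplexCategoryᵒᵖ ⥤ D) ((evaluation SimplexCategoryᵒᵖ D).obj n) h

end CylinderEnds

/-! ### Additive functors with values in chain complexes -/

section AdditiveFunctorsToChainComplexes

variable {A : Type u} [Category.{v} A] [Preadditive A] {J : MorphismProperty A}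
  [J.IsMultiplicative]

/-- Local quasi-isomorphisms are stable by retracts. -/
lemma localQis.of_retract {C D C' D' : ChainComplex A ℕ} {f : C ⟶ D} {f' : C' ⟶ D'} (i : C ⟶ C')
    (p : C' ⟶ C) (j : D ⟶ D') (q : D' ⟶ D) (hip : i ≫ p = 𝟙 C) (hjq : j ≫ q = 𝟙 D)
    (hi : i ≫ f' = f ≫ j) (hq : f' ≫ q = p ≫ f) (hf' : localQis J f') : localQis J f := by
  have hip' := fun m => congr_arg (fun φ => HomologicalComplex.Hom.f φ m) hip
  have hjq' := fun m => congr_arg (fun φ => HomologicalComplex.Hom.f φ m) hjq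
  have hi' := fun m => congr_arg (fun φ => HomologicalComplex.Hom.f φ m) hi
  have hq' := fun m => congr_arg (fun φ => HomologicalComplex.Hom.f φ m) hq
  simp only [HomologicalComplex.comp_f, HomologicalComplex.id_f] at hip' hjq' hi' hq'
  refine localQis_of_inj_of_surj J (fun m T x y hx hxy => ?_) (fun m T y hy => ?_)
  · obtain ⟨T', π, hπ, x', hx'⟩ := hf'.localInj m (x ≫ i.f m) (y ≫ j.f (m + 1))
      (by rw [Category.assoc, i.comm, reassoc_of% hx, zero_comp])
      (by rw [Category.assoc, hi', reassoc_of% hxy, Category.assoc, j.comm])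
    refine ⟨T', π, hπ, x' ≫ p.f (m + 1), ?_⟩
    rw [Category.assoc, p.comm, reassoc_of% hx', hip', Category.comp_id]
  · obtain ⟨T', π, hπ, x, y', hx, hy'⟩ := hf'.localSurj m (y ≫ j.f m)
      (by rw [Category.assoc, j.comm, reassoc_of% hy, zero_comp])
    refine ⟨T', π, hπ, x ≫ p.f m, y' ≫ q.f (m + 1), ?_, ?_⟩
    · rw [Category.assoc, p.comm, reassoc_of% hx, zero_comp]
    · rw [Category.assoc, ← hq', reassoc_of% hy', Preadditive.add_comp, Category.assoc,
        Category.assoc, hjq', Category.comp_id, Category.assoc, Category.assoc, q.comm]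

variable {S : Type u'} [Category.{v'} S] [Preadditive S] [HasBinaryBiproducts S]
  [HasBinaryCoproducts (ChainComplex A ℕ)] (F : S ⥤ ChainComplex A ℕ) [F.Additive]

/-- The comparison isomorphism `F X ⊔ F Y ≅ F (X ⊕ Y)`. -/
def coprodIsoMapBiprod (X Y : S) : F.obj X ⨿ F.obj Y ≅ F.obj (X ⊞ Y) where
  hom := coprod.desc (F.map biprod.inl) (F.map biprod.inr)
  inv := F.map biprod.fst ≫ coprod.inl + F.map biprod.snd ≫ coprod.inr
  hom_inv_id := by
    apply coprod.hom_ext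
    · rw [coprod.inl_desc_assoc, Preadditive.comp_add, ← F.map_comp_assoc, ← F.map_comp_assoc]
      simp
    · rw [coprod.inr_desc_assoc, Preadditive.comp_add, ← F.map_comp_assoc, ← F.map_comp_assoc]
      simp
  inv_hom_id := by
    rw [Preadditive.add_comp, Category.assoc, Category.assoc, coprod.inl_desc, coprod.inr_desc,
      ← F.map_comp, ← F.map_comp, ← F.map_add, biprod.total, F.map_id]

lemma localQis_map_biprodMap {X Y X' Y' : S} {f : X ⟶ Y} {f' : X' ⟶ Y'}
    (hf : localQis J (F.map f)) (hf' : localQis J (F.map f')) :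
    localQis J (F.map (biprod.map f f')) := by
  have h1 : (coprodIsoMapBiprod F X X').hom ≫ F.map (biprod.map f f') =
      coprod.map (F.map f) (F.map f') ≫ (coprodIsoMapBiprod F Y Y').hom := by
    apply coprod.hom_ext
    · change coprod.inl ≫ coprod.desc _ _ ≫ _ = coprod.inl ≫ _ ≫ coprod.desc _ _
      rw [coprod.inl_desc_assoc, coprod.inl_map_assoc, coprod.inl_desc, ← F.map_comp,
        ← F.map_comp, biprod.inl_map]
    · change coprod.inr ≫ coprod.desc _ _ ≫ _ = coprod.inr ≫ _ ≫ coprod.desc _ _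
      rw [coprod.inr_desc_assoc, coprod.inr_map_assoc, coprod.inr_desc, ← F.map_comp,
        ← F.map_comp, biprod.inr_map]
  refine localQis.of_comp_left (f := (coprodIsoMapBiprod F X X').hom) ?_ (localQis_of_isIso _)
  rw [h1]
  exact localQis.comp J (localQis_coprodMap hf hf') (localQis_of_isIso _)

omit [HasBinaryCoproducts (ChainComplex A ℕ)] [F.Additive] in
lemma localQis_map_of_biprodMap_right {X Y X' Y' : S} {f : X ⟶ Y} {f' : X' ⟶ Y'}
    (h : localQis J (F.map (biprod.map f f'))) : localQis J (F.map f') := by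
  refine h.of_retract (F.map biprod.inr) (F.map biprod.snd) (F.map biprod.inr)
    (F.map biprod.snd) ?_ ?_ ?_ ?_
  · rw [← F.map_comp, biprod.inr_snd, F.map_id]
  · rw [← F.map_comp, biprod.inr_snd, F.map_id]
  · rw [← F.map_comp, ← F.map_comp, biprod.inr_map]
  · rw [← F.map_comp, ← F.map_comp, biprod.map_snd]

/-- The isomorphism `X ⊕ X ≅ X ⊔ X` given by `(s, t) ↦ (t, s - t)`. -/
def biprodShear [HasBinaryCoproducts S] (X : S) : X ⊞ X ≅ X ⨿ X where
  hom := biprod.desc coprod.inr (coprod.inl - coprod.inr)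
  inv := coprod.desc (biprod.lift (𝟙 X) (𝟙 X)) (biprod.lift (𝟙 X) 0)
  hom_inv_id := by
    apply biprod.hom_ext'
    · rw [biprod.inl_desc_assoc, coprod.inr_desc]
      apply biprod.hom_ext <;> simp
    · rw [biprod.inr_desc_assoc, Preadditive.sub_comp, coprod.inl_desc, coprod.inr_desc]
      apply biprod.hom_ext <;> simp
  inv_hom_id := by
    apply coprod.hom_ext
    · rw [coprod.inl_desc_assoc, biprod.lift_desc]
      simp
    · rw [coprod.inr_desc_assoc, biprod.lift_desc]
      simp

/-- For `Z = 0` and a projection `p : V ⟶ X` such that `F p` is a local quasi-isomorphism and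
`X ⊔ X ⟶ V` is a section of `p` on both summands, `F (X ⊔ X ⟶ V ⊕ (Y ⊔ Z))` is a local
quasi-isomorphism if and only if `F f` is. -/
lemma localQis_map_lift_iff [HasBinaryCoproducts S] {X Y Z V : S} (f : X ⟶ Y) (g : X ⟶ Z)
    (hZ : IsZero Z) (a : X ⨿ X ⟶ V) (p : V ⟶ X) (hap : a ≫ p = coprod.desc (𝟙 X) (𝟙 X))
    (hp : localQis J (F.map p)) :
    localQis J (F.map (biprod.lift a (coprod.map f g))) ↔ localQis J (F.map f) := by
  let e : Y ⨿ Z ≅ Y :=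
    { hom := coprod.desc (𝟙 Y) 0
      inv := coprod.inl
      hom_inv_id := by
        apply coprod.hom_ext
        · rw [coprod.inl_desc_assoc, Category.id_comp, Category.comp_id]
        · exact hZ.eq_of_src _ _
      inv_hom_id := coprod.inl_desc _ _ }
  -- The shear diagonalizes the map to `(s, t) ↦ (s, f t)`: the first component is `t + (s - t)`
  -- because `p` retracts both ends, and `Z = 0` removes the contribution of `s - t` to the second.
  have h1 : (biprodShear X).hom ≫ biprod.lift a (coprod.map f g) ≫ biprod.map p e.hom =
      biprod.map (𝟙 X) f := by
    have h2 : coprod.inl ≫ coprod.map f g ≫ e.hom = f := by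
      change _ ≫ _ ≫ coprod.desc _ _ = _
      rw [coprod.inl_map_assoc, coprod.inl_desc, Category.comp_id]
    have h3 : coprod.inr ≫ coprod.map f g ≫ e.hom = 0 := by
      change _ ≫ _ ≫ coprod.desc _ _ = _
      rw [coprod.inr_map_assoc, coprod.inr_desc, comp_zero]
    have h4 : coprod.inl ≫ coprod.desc (𝟙 X) (𝟙 X) = 𝟙 X := coprod.inl_desc _ _
    have h5 : coprod.inr ≫ coprod.desc (𝟙 X) (𝟙 X) = 𝟙 X := coprod.inr_desc _ _
    apply biprod.hom_ext <;> apply biprod.hom_ext' <;>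
      simp [biprodShear, hap, h2, h3, h4, h5]
  have h2 : localQis J (F.map (biprod.map p e.hom)) :=
    localQis_map_biprodMap F hp (localQis_of_isIso (F.mapIso e).hom)
  have h3 : localQis J (F.map (biprodShear X).hom) := localQis_of_isIso _
  have h4 : localQis J (F.map (biprod.lift a (coprod.map f g))) ↔
      localQis J (F.map (biprod.map (𝟙 X) f)) := by
    rw [← h1, F.map_comp, F.map_comp]
    exact ⟨fun h => localQis.comp J h3 (localQis.comp J h h2),
      fun h => (h.of_comp_left h3).of_comp_right h2⟩
  rw [h4]
  exact ⟨fun h => localQis_map_of_biprodMap_right F h, fun h => localQis_map_biprodMap F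
    (localQis_of_isIso _) h⟩

end AdditiveFunctorsToChainComplexes

/-! ### Split exact sequences from pushouts -/

section PushoutSplitting

variable {D : Type u'} [Category.{v'} D] [Preadditive D]

/-- A pushout along the inclusion of a direct summand yields a split exact sequence. -/
lemma exists_splitting_of_isPushout {P V Q C M : D} {a : P ⟶ V} {c : P ⟶ Q} {j : V ⟶ C}
    {i : Q ⟶ C} (h : IsPushout a c j i) (r : V ⟶ P) (har : a ≫ r = 𝟙 P)
    (inl : V ⟶ M) (inr : Q ⟶ M) (fst : M ⟶ V) (snd : M ⟶ Q) (h₁₁ : inl ≫ fst = 𝟙 V)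
    (h₁₂ : inl ≫ snd = 0) (h₂₁ : inr ≫ fst = 0) (h₂₂ : inr ≫ snd = 𝟙 Q)
    (htot : fst ≫ inl + snd ≫ inr = 𝟙 M) :
    ∃ t : C ⟶ M, (a ≫ inl + c ≫ inr) ≫ fst ≫ r = 𝟙 P ∧ t ≫ (fst ≫ j - snd ≫ i) = 𝟙 C ∧
      (fst ≫ r) ≫ (a ≫ inl + c ≫ inr) + (fst ≫ j - snd ≫ i) ≫ t = 𝟙 M := by
  -- The section `t` is glued from `inl - r ≫ (a ≫ inl + c ≫ inr)` on `V` and `-inr` on `Q`; they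
  -- agree on `P` because `r` retracts `a`.
  have hw : a ≫ (inl - r ≫ (a ≫ inl + c ≫ inr)) = c ≫ (-inr) := by
    rw [Preadditive.comp_sub, reassoc_of% har, Preadditive.comp_neg]
    abel
  have hj : j ≫ h.desc _ _ hw = _ := h.inl_desc _ _ hw
  have hi : i ≫ h.desc _ _ hw = _ := h.inr_desc _ _ hw
  refine ⟨h.desc _ _ hw, ?_, ?_, ?_⟩
  · simp [Preadditive.add_comp, reassoc_of% h₁₁, reassoc_of% h₂₁, har]
  · apply h.hom_ext
    · rw [reassoc_of% hj]
      simp [Preadditive.add_comp, Preadditive.sub_comp, Preadditive.comp_sub, reassoc_of% h₁₁,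
        reassoc_of% h₂₁, reassoc_of% h₁₂, reassoc_of% h₂₂, h.w]
    · rw [reassoc_of% hi]
      simp [Preadditive.comp_sub, reassoc_of% h₂₁, reassoc_of% h₂₂]
  · rw [Preadditive.sub_comp, Category.assoc, Category.assoc, Category.assoc, hj, hi,
      Preadditive.comp_sub, Preadditive.comp_neg, ← htot]
    abel

end PushoutSplitting

/-! ### Existence and acyclicity of simplicial cones -/

section Cone

variable {A : Type u} [Category.{v} A] [Preadditive A] {J : MorphismProperty A}
  [J.IsMultiplicative] [HasBinaryCoproducts (ChainComplex A ℕ)]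
  {D : Type u'} [Category.{v'} D] [Preadditive D] [HasFiniteBiproducts D]

lemma exists_isDoubleMappingCylinder {X Y Z : SimplicialObject D} (f : X ⟶ Y) (g : X ⟶ Z) :
    ∃ C, IsDoubleMappingCylinder f g C := by
  have := hasPushout_cylEnds (coprod.map f g)
  exact ⟨_, _, _, IsPushout.of_hasPushout (cylEnds X) (coprod.map f g)⟩

/-- The acyclicity criterion for simplicial cones. -/
lemma locallyAcyclic_doubleMappingCylinder_iff {F : SimplicialObject D ⥤ ChainComplex A ℕ}
    [F.Additive] (L : LevelwiseFunctoriality F)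
    {X Y Z C : SimplicialObject D} (hF : localQis J (F.map (cylProj X))) (f : X ⟶ Y) (g : X ⟶ Z)
    (hZ : IsZero Z) (hC : IsDoubleMappingCylinder f g C) :
    LocallyAcyclic J (F.obj C) ↔ localQis J (F.map f) := by
  have := HasBinaryBiproducts.of_hasBinaryCoproducts (C := SimplicialObject D)
  obtain ⟨j, i, h⟩ := hC
  let M := cyl X ⊞ (Y ⨿ Z)
  -- The sequence `X ⊔ X ⟶ M ⟶ C` is split exact in each simplicial degree, by splittings that need
  -- not be simplicial. They are chosen degree by degree, and `L` makes them act on the components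
  -- of `F`.
  have key := fun n : ℕ => exists_splitting_of_isPushout (isPushout_app h (op ⦋n⦌))
    (cylRetract X (op ⦋n⦌)) (cylEnds_cylRetract X (op ⦋n⦌))
    ((biprod.inl : _ ⟶ M).app (op ⦋n⦌)) ((biprod.inr : _ ⟶ M).app (op ⦋n⦌))
    ((biprod.fst : M ⟶ _).app (op ⦋n⦌)) ((biprod.snd : M ⟶ _).app (op ⦋n⦌))
    (congr_app (biprod.inl_fst (X := cyl X) (Y := Y ⨿ Z)) (op ⦋n⦌))
    (congr_app (biprod.inl_snd (X := cyl X) (Y := Y ⨿ Z)) (op ⦋n⦌))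
    (congr_app (biprod.inr_fst (X := cyl X) (Y := Y ⨿ Z)) (op ⦋n⦌))
    (congr_app (biprod.inr_snd (X := cyl X) (Y := Y ⨿ Z)) (op ⦋n⦌))
    (congr_app (biprod.total (X := cyl X) (Y := Y ⨿ Z)) (op ⦋n⦌))
  choose t h1 h2 h3 using key
  let a : X ⨿ X ⟶ M := cylEnds X ≫ biprod.inl + coprod.map f g ≫ biprod.inr
  let b : M ⟶ C := biprod.fst ≫ j - biprod.snd ≫ i
  have hab : a ≫ b = 0 := by
    simp only [a, b, Preadditive.add_comp, Preadditive.comp_sub, Category.assoc,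
      biprod.inl_fst_assoc, biprod.inl_snd_assoc, biprod.inr_fst_assoc, biprod.inr_snd_assoc,
      zero_comp, comp_zero]
    rw [h.w]
    abel
  have ha : a = biprod.lift (cylEnds X) (coprod.map f g) := biprod.lift_eq.symm
  -- By the shear, `F f` is an equivalence exactly when `F` of the first map of this sequence is.
  rw [← localQis_map_lift_iff F f g hZ (cylEnds X) (cylProj X) (by
    apply coprod.hom_ext
    · rw [coprod.inl_desc_assoc, coprod.inl_desc, toCyl_cylProj]
    · rw [coprod.inr_desc_assoc, coprod.inr_desc, toCyl_cylProj]) hF, ← ha]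
  refine locallyAcyclic_iff_of_split (F.map a) (F.map b)
    (L.map fun n => (biprod.fst : M ⟶ _).app (op ⦋n⦌) ≫ cylRetract X (op ⦋n⦌)) (L.map t)
    (fun q => ?_) (fun q => ?_) (fun q => ?_) (fun q => ?_)
  · rw [← L.map_app, L.map_comp, ← L.map_id]
    congr 1
    funext n
    exact h1 n
  · rw [← L.map_app, L.map_comp, ← L.map_id]
    congr 1
    funext n
    exact h2 n
  · rw [← HomologicalComplex.comp_f, ← F.map_comp, hab, F.map_zero]
    rfl
  · rw [← L.map_app, ← L.map_app, L.map_comp, L.map_comp, ← L.map_add, ← L.map_id]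
    congr 1
    funext n
    exact h3 n

end Cone

/-! ### Localizations and saturation -/

section Localization

variable {D : Type u} [Category.{v} D]

lemma localization_lift_map {W : MorphismProperty D} {D' : Type u'} [Category.{v'} D']
    (G : D ⥤ D') (hG : W.IsInvertedBy G) {X Y : D} (f : X ⟶ Y) :
    (Localization.Construction.lift G hG).map (W.Q.map f) = G.map f := by
  have h := CategoryTheory.Functor.congr_hom (Localization.Construction.fac G hG) f
  exact h.trans ((Category.id_comp _).trans (Category.comp_id _))

/-- A class of morphisms which consists of the morphisms sent to isomorphisms by a family of
functors is saturated. -/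
lemma saturated_of_functors {D' : Type u'} [Category.{v'} D'] {ι : Type*} (G : ι → D ⥤ D')
    {E : MorphismProperty D} (hE : ∀ ⦃X Y : D⦄ (f : X ⟶ Y), E f ↔ ∀ i, IsIso ((G i).map f))
    ⦃X Y : D⦄ (f : X ⟶ Y) : E f ↔ IsIso (E.Q.map f) := by
  refine ⟨fun hf => E.Q_inverts f hf, fun hf => (hE f).2 fun i => ?_⟩
  have hG : E.IsInvertedBy (G i) := fun _ _ g hg => (hE g).1 hg i
  have h : IsIso ((Localization.Construction.lift (G i) hG).map (E.Q.map f)) := inferInstance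
  rwa [localization_lift_map] at h

variable (E : MorphismProperty D) {J : Type u'} [Category.{v'} J] {J' : Type u''}
  [Category.{v''} J']

lemma precomp_map_funQ (G : J ⥤ J') {S T : J' ⥤ D} (α : S ⟶ T) :
    (precomp E G).map ((funQ E J').map α) = (funQ E J).map (whiskerLeft G α) :=
  localization_lift_map _ _ α

lemma postcomp_map_funQ {E : MorphismProperty D} {D' : Type*} [Category* D']
    {E' : MorphismProperty D'} (ψ : D ⥤ D')
    (hψ : ∀ ⦃X Y : D⦄ (f : X ⟶ Y), E f → E' (ψ.map f)) {S T : J ⥤ D} (α : S ⟶ T) :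
    (postcomp J ψ hψ).map ((funQ E J).map α) = (funQ E' J).map (whiskerRight α ψ) :=
  localization_lift_map _ _ α

lemma levelwiseSimple_map_funQ {E : MorphismProperty D} (s : SimplicialObject D ⥤ D)
    (hs : ∀ ⦃X Y : SimplicialObject D⦄ (f : X ⟶ Y), (∀ n, E (f.app n)) → E (s.map f))
    {S T : J ⥤ D} (α : S ⟶ T) :
    (levelwiseSimple J s hs).map ((funQ E J).map α) = (funQ E (SimplicialObject J)).map
      (whiskerRight ((SimplicialObject.whiskering J D).map α) s) :=
  localization_lift_map _ _ α

lemma comp_congr {X Y Z : D} {f f' : X ⟶ Y} {g g' : Y ⟶ Z} (hf : f = f') (hg : g = g') :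
    f ≫ g = f' ≫ g' := by
  rw [hf, hg]

lemma isIso_funQ_map {S T : J ⥤ D} (α : S ⟶ T) (h : ∀ j, E (α.app j)) :
    IsIso ((funQ E J).map α) :=
  MorphismProperty.Q_inverts _ _ h

end Localization

/-! ### Additive functors and coproducts -/

section AdditiveFunctors

variable {D : Type u} [Category.{v} D] [Preadditive D] {D' : Type u'} [Category.{v'} D']
  [Preadditive D'] [HasBinaryCoproducts D] [HasBinaryCoproducts D']

lemma isIso_coprodComparison_of_additive (F : D ⥤ D') [F.Additive] (X Y : D) :
    IsIso (coprodComparison F X Y) := by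
  refine ⟨F.map (coprod.desc (𝟙 X) 0) ≫ coprod.inl + F.map (coprod.desc 0 (𝟙 Y)) ≫ coprod.inr,
    ?_, ?_⟩
  · apply coprod.hom_ext
    · change coprod.inl ≫ coprod.desc _ _ ≫ _ = _
      rw [coprod.inl_desc_assoc, Preadditive.comp_add, ← F.map_comp_assoc, ← F.map_comp_assoc,
        coprod.inl_desc, coprod.inl_desc]
      simp
    · change coprod.inr ≫ coprod.desc _ _ ≫ _ = _
      rw [coprod.inr_desc_assoc, Preadditive.comp_add, ← F.map_comp_assoc, ← F.map_comp_assoc,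
        coprod.inr_desc, coprod.inr_desc]
      simp
  · change _ ≫ coprod.desc _ _ = _
    rw [Preadditive.add_comp, Category.assoc, Category.assoc, coprod.inl_desc, coprod.inr_desc,
      ← F.map_comp, ← F.map_comp, ← F.map_add, coprod_desc_inl_add_desc_inr, F.map_id]

end AdditiveFunctors

/-! ### Chain complexes as a simplicial descent category -/

section ChainDescent

variable {A : Type u} [Category.{v} A] [Preadditive A] [HasFiniteBiproducts A]

instance hasFiniteBiproducts_chainComplex : HasFiniteBiproducts (ChainComplex A ℕ) :=
  HasFiniteBiproducts.of_hasFiniteCoproducts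

lemma isZero_terminal_X (q : ℕ) : IsZero ((⊤_ (ChainComplex A ℕ)).X q) := by
  have h : IsZero (⊤_ (ChainComplex A ℕ)) := by
    rw [IsZero.iff_id_eq_zero]
    exact terminal.hom_ext _ _
  rw [IsZero.iff_id_eq_zero] at h ⊢
  exact congr_arg (fun φ => HomologicalComplex.Hom.f φ q) h

lemma isZero_terminal_simplicialObject {D : Type u'} [Category.{v'} D] [Preadditive D]
    [HasTerminal D] : IsZero (⊤_ (SimplicialObject D)) := by
  rw [IsZero.iff_id_eq_zero]
  exact terminal.hom_ext _ _

omit [HasFiniteBiproducts A] in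
lemma localQis_iff_of_comm {J : MorphismProperty A} [J.IsMultiplicative]
    {B C B' C' : ChainComplex A ℕ} {f : B ⟶ C} {f' : B' ⟶ C'} {e : B ⟶ B'} {e' : C ⟶ C'}
    (h : f ≫ e' = e ≫ f') (he : localQis J e) (he' : localQis J e') :
    localQis J f ↔ localQis J f' := by
  constructor
  · intro hf
    refine localQis.of_comp_left (f := e) ?_ he
    rw [← h]
    exact localQis.comp J hf he'
  · intro hf
    refine localQis.of_comp_right (g := e') ?_ he'
    rw [h]
    exact localQis.comp J he hf

lemma localQis_simple_opFunctor_map_iff {J : MorphismProperty A} [J.IsMultiplicative]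
    {X Y : SimplicialObject (ChainComplex A ℕ)} (f : X ⟶ Y) :
    localQis J ((simple A).map (SimplicialObject.opFunctor.map f)) ↔
      localQis J ((simple A).map f) :=
  localQis_iff_of_comm (revIso_hom_naturality f) (localQis_of_isIso _) (localQis_of_isIso _)

/-- Naturality of `λ` compares `s (f × Δ)` with `f` through two equivalences. -/
lemma localQis_simple_const_map_iff {J : MorphismProperty A} [J.IsMultiplicative]
    {B B' : ChainComplex A ℕ} (f : B ⟶ B') :
    localQis J ((simple A).map ((SimplicialObject.const _).map f)) ↔ localQis J f :=
  localQis_iff_of_comm ((lamChain A).naturality f) (localQis_lamChain B) (localQis_lamChain B')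

/-- The identity already holds between natural transformations, by `alexanderWhitney_outerLam`, and
the localization functor carries it over. -/
lemma chainData_muLamOuter (E : MorphismProperty (ChainComplex A ℕ)) :
    (chainData A E).muLamOuter = 𝟙 _ := by
  have h : whiskerRight (diagConstOuter (ChainComplex A ℕ)).inv (simple A) ≫
      whiskerLeft (constOuter _) (alexanderWhitney A) ≫ outerLam A = 𝟙 (simple A) := by
    apply NatTrans.ext
    funext X
    have h1 := alexanderWhitney_outerLam X
    change (simple A).map ((diagConstOuter _).inv.app X) ≫
      (alexanderWhitney A).app ((constOuter _).obj X) ≫ (outerLam A).app X = 𝟙 _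
    refine (congr_arg (fun φ => _ ≫ φ) h1).trans ?_
    refine ((simple A).map_comp _ _).symm.trans ?_
    rw [Iso.inv_hom_id_app]
    exact (simple A).map_id _
  unfold DescentData.muLamOuter
  refine (congr_arg (fun φ => _ ≫ φ ≫ _) (precomp_map_funQ E _ (alexanderWhitney A))).trans ?_
  refine (congr_arg (fun φ => _ ≫ φ) ((funQ E _).map_comp _ _).symm).trans ?_
  refine ((funQ E _).map_comp _ _).symm.trans ?_
  exact (congr_arg (fun φ => (funQ E _).map φ) h).trans ((funQ E _).map_id _)

lemma chainData_muLamInner (E : MorphismProperty (ChainComplex A ℕ)) :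
    (chainData A E).muLamInner = 𝟙 _ := by
  have h : whiskerRight (diagConstInner (ChainComplex A ℕ)).inv (simple A) ≫
      whiskerLeft (constInner _) (alexanderWhitney A) ≫ innerLam A = 𝟙 (simple A) := by
    apply NatTrans.ext
    funext X
    have h1 := alexanderWhitney_innerLam X
    change (simple A).map ((diagConstInner _).inv.app X) ≫
      (alexanderWhitney A).app ((constInner _).obj X) ≫ (innerLam A).app X = 𝟙 _
    refine (congr_arg (fun φ => _ ≫ φ) h1).trans ?_
    refine ((simple A).map_comp _ _).symm.trans ?_
    rw [Iso.inv_hom_id_app]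
    exact (simple A).map_id _
  unfold DescentData.muLamInner
  refine (congr_arg (fun φ => _ ≫ φ ≫ _) (precomp_map_funQ E _ (alexanderWhitney A))).trans ?_
  refine (congr_arg (fun φ => _ ≫ φ) ((funQ E _).map_comp _ _).symm).trans ?_
  refine ((funQ E _).map_comp _ _).symm.trans ?_
  exact (congr_arg (fun φ => (funQ E _).map φ) h).trans ((funQ E _).map_id _)

/-- Chain complexes form a simplicial descent category for any saturated class of local
quasi-isomorphisms. -/
theorem chainData_isDescent (J : MorphismProperty A) [J.IsMultiplicative]
    {E : MorphismProperty (ChainComplex A ℕ)}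
    (hE : ∀ ⦃X Y : ChainComplex A ℕ⦄ (f : X ⟶ Y), E f ↔ localQis J f)
    (hsat : ∀ ⦃X Y : ChainComplex A ℕ⦄ (f : X ⟶ Y), E f ↔ IsIso (E.Q.map f)) :
    (chainData A E).IsDescent where
  saturated := hsat
  coprod_mem _ _ _ _ f f' hf hf' :=
    (hE _).2 (localQis_coprodMap ((hE f).1 hf) ((hE f').1 hf'))
  simple_coprod X Y := by
    have := isIso_coprodComparison_of_additive (simple A) X Y
    exact (hE _).2 (localQis_of_isIso (coprodComparison (simple A) X Y))
  isIso_mu := isIso_funQ_map E (alexanderWhitney A) fun Z =>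
    (hE _).2 (localQis_alexanderWhitney Z)
  lam_mem X := (hE _).2 (localQis_lamChain X)
  exists_rho := ⟨rhoChain A, rhoChain_lamChain⟩
  compat_outer := chainData_muLamOuter E
  compat_inner := chainData_muLamInner E
  exact _ _ f hf := (hE _).2 (localQis_simple_of_levels f fun n => (hE _).1 (hf (op ⦋n⦌)))
  exists_cone _ _ _ := exists_isDoubleMappingCylinder _ _
  acyclicity A₁ B f C hC := by
    have h1 : E (terminal.from ((simple A).obj C)) ↔ LocallyAcyclic J ((simple A).obj C) :=
      (hE _).trans (localQis_iff_locallyAcyclic _ isZero_terminal_X)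
    -- The simple of the cone of `f × Δ` is acyclic exactly when `s (f × Δ)` is an equivalence, and
    -- that is compared with `f` by `λ`.
    have h2 := locallyAcyclic_doubleMappingCylinder_iff (simpleFunctoriality A) (J := J)
      (localQis_simple_map (simplicialHomotopyEquivalences_cylProj _)) _ _
      isZero_terminal_simplicialObject hC
    exact ((hE f).trans (localQis_simple_const_map_iff f).symm).trans (h2.symm.trans h1.symm)
  symmetry X Y f :=
    (hE _).trans ((localQis_simple_opFunctor_map_iff f).trans (hE _).symm)

end ChainDescent

/-! ### Simplicial objects as an additive simplicial descent category -/

section SimplicialDescentStructure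

open AlgebraicTopology

variable {A : Type u} [Category.{v} A] [Preadditive A] [HasFiniteBiproducts A]

variable {J : MorphismProperty A} [J.IsMultiplicative]

omit [Preadditive A] [HasFiniteBiproducts A] in
lemma isIso_muDiag : IsIso (muDiag A) := by
  have h : ∀ Z, IsIso ((muDiag A).app Z) := fun Z => by
    have h1 : ∀ n, IsIso (((muDiag A).app Z).app n) := fun n =>
      inferInstanceAs (IsIso (𝟙 (((Z.obj n).obj n).obj n)))
    exact NatIso.isIso_of_isIso_app _
  exact NatIso.isIso_of_isIso_app _

omit [Preadditive A] [HasFiniteBiproducts A] in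
lemma simplicialData_muLamOuter (E : MorphismProperty (SimplicialObject A)) :
    (simplicialData A E).muLamOuter = 𝟙 _ := by
  have h : whiskerRight (diagConstOuter (SimplicialObject A)).inv (diag A) ≫
      whiskerLeft (constOuter _) (muDiag A) ≫ (simplicialData A E).lamSimple = 𝟙 (diag A) := by
    apply NatTrans.ext
    funext X
    apply NatTrans.ext
    funext n
    change 𝟙 ((X.obj n).obj n) ≫ 𝟙 ((X.obj n).obj n) ≫ 𝟙 ((X.obj n).obj n) ≫
      𝟙 ((X.obj n).obj n) = 𝟙 ((X.obj n).obj n)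
    simp only [Category.comp_id]
  unfold DescentData.muLamOuter
  refine (congr_arg (fun φ => _ ≫ φ ≫ _) (precomp_map_funQ E _ (muDiag A))).trans ?_
  refine (congr_arg (fun φ => _ ≫ φ) ((funQ E _).map_comp _ _).symm).trans ?_
  refine ((funQ E _).map_comp _ _).symm.trans ?_
  exact (congr_arg (fun φ => (funQ E _).map φ) h).trans ((funQ E _).map_id _)

omit [Preadditive A] [HasFiniteBiproducts A] in
lemma simplicialData_muLamInner (E : MorphismProperty (SimplicialObject A)) :
    (simplicialData A E).muLamInner = 𝟙 _ := by
  have h : whiskerRight (diagConstInner (SimplicialObject A)).inv (diag A) ≫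
      whiskerLeft (constInner _) (muDiag A) ≫ (simplicialData A E).simpleLam = 𝟙 (diag A) := by
    apply NatTrans.ext
    funext X
    apply NatTrans.ext
    funext n
    change 𝟙 ((X.obj n).obj n) ≫ 𝟙 ((X.obj n).obj n) ≫ 𝟙 ((X.obj n).obj n) =
      𝟙 ((X.obj n).obj n)
    simp only [Category.comp_id]
  unfold DescentData.muLamInner
  refine (congr_arg (fun φ => _ ≫ φ ≫ _) (precomp_map_funQ E _ (muDiag A))).trans ?_
  refine (congr_arg (fun φ => _ ≫ φ) ((funQ E _).map_comp _ _).symm).trans ?_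
  refine ((funQ E _).map_comp _ _).symm.trans ?_
  exact (congr_arg (fun φ => (funQ E _).map φ) h).trans ((funQ E _).map_id _)

/-- The equivalence `cmp` replaces the diagonal by a total complex. Exactness and symmetry of the
diagonal are inherited from `simple` in this way. -/
lemma localQis_diag_map_iff {X Y : SimplicialObject (SimplicialObject A)} (f : X ⟶ Y) :
    localQis J ((alternatingFaceMapComplex A).map ((diag A).map f)) ↔
      localQis J ((simple A).map ((levelwise (alternatingFaceMapComplex A)).map f)) :=
  localQis_iff_of_comm ((cmp A).naturality f) (localQis_cmp X) (localQis_cmp Y)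

/-- Simplicial objects form an additive simplicial descent category for any saturated class of
morphisms inducing local quasi-isomorphisms on the alternating face map complexes. -/
theorem simplicialData_isAdditiveDescent (J : MorphismProperty A) [J.IsMultiplicative]
    {E : MorphismProperty (SimplicialObject A)}
    (hE : ∀ ⦃X Y : SimplicialObject A⦄ (f : X ⟶ Y),
      E f ↔ localQis J ((alternatingFaceMapComplex A).map f))
    (hsat : ∀ ⦃X Y : SimplicialObject A⦄ (f : X ⟶ Y), E f ↔ IsIso (E.Q.map f)) :
    (simplicialData A E).IsAdditiveDescent where
  saturated := hsat
  coprod_mem X Y X' Y' f f' hf hf' := by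
    have h1 := isIso_coprodComparison_of_additive (alternatingFaceMapComplex A) X X'
    have h2 := isIso_coprodComparison_of_additive (alternatingFaceMapComplex A) Y Y'
    have h3 := localQis_coprodMap ((hE f).1 hf) ((hE f').1 hf')
    refine (hE _).2 (localQis.of_comp_left
      (f := coprodComparison (alternatingFaceMapComplex A) X X') ?_ (localQis_of_isIso _))
    rw [coprodComparison_natural]
    exact localQis.comp J h3 (localQis_of_isIso _)
  simple_coprod X Y := by
    have := isIso_coprodComparison_of_additive (diag A) X Y
    exact (hE _).2 (localQis_of_isIso ((alternatingFaceMapComplex A).map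
      (coprodComparison (diag A) X Y)))
  isIso_mu := by
    have := isIso_muDiag (A := A)
    exact inferInstanceAs (IsIso ((funQ E _).map (muDiag A)))
  lam_mem X := (hE _).2 (localQis_of_isIso ((alternatingFaceMapComplex A).map
      ((diagConstOuter A).hom.app X)))
  exists_rho := ⟨(diagConstOuter A).inv, (diagConstOuter A).inv_hom_id⟩
  compat_outer := simplicialData_muLamOuter E
  compat_inner := simplicialData_muLamInner E
  exact _ _ f hf := (hE _).2 ((localQis_diag_map_iff f).2
    (localQis_simple_of_levels _ fun n => (hE _).1 (hf (op ⦋n⦌))))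
  exists_cone _ _ _ := exists_isDoubleMappingCylinder _ _
  acyclicity B B' f C hC := by
    have h0 : ∀ q, IsZero (((alternatingFaceMapComplex A).obj (⊤_ (SimplicialObject A))).X q) :=
      fun q => by
        have h : IsZero (⊤_ (SimplicialObject A)) := isZero_terminal_simplicialObject
        rw [IsZero.iff_id_eq_zero] at h ⊢
        exact congr_app h (op ⦋q⦌)
    have h1 : E (terminal.from ((diag A).obj C)) ↔
        LocallyAcyclic J ((diag A ⋙ alternatingFaceMapComplex A).obj C) :=
      (hE _).trans (localQis_iff_locallyAcyclic _ h0)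
    have h2 := locallyAcyclic_doubleMappingCylinder_iff (diagFunctoriality A) (J := J)
      (localQis_alternatingFaceMapComplex_map (simplicialHomotopyEquivalences_diag_map
        (simplicialHomotopyEquivalences_cylProj _))) _ _ isZero_terminal_simplicialObject hC
    have h3 : localQis J ((diag A ⋙ alternatingFaceMapComplex A).map
        ((SimplicialObject.const _).map f)) ↔ E f :=
      (localQis_iff_of_comm (whiskerRight (diagConstOuter A).hom
        (alternatingFaceMapComplex A) |>.naturality f) (localQis_of_isIso
          ((alternatingFaceMapComplex A).map ((diagConstOuter A).hom.app B))) (localQis_of_isIso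
          ((alternatingFaceMapComplex A).map ((diagConstOuter A).hom.app B')))).trans (hE f).symm
    exact (h3.symm.trans h2.symm).trans h1.symm
  symmetry X Y f := by
    -- `Υ` reverses the outer index only, so it commutes with `K` applied in the inner direction.
    have h1 : localQis J ((simple A).map ((levelwise (alternatingFaceMapComplex A)).map
        (SimplicialObject.opFunctor.map f))) ↔
        localQis J ((simple A).map ((levelwise (alternatingFaceMapComplex A)).map f)) :=
      localQis_simple_opFunctor_map_iff ((levelwise (alternatingFaceMapComplex A)).map f)
    exact (hE _).trans ((localQis_diag_map_iff _).trans (h1.trans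
      ((localQis_diag_map_iff f).symm.trans (hE _).symm)))
  simple_additive := diag_additive A
  mu_additive := by
    have h1 : (diag (SimplicialObject A) ⋙ diag A).Additive := inferInstance
    have h2 : (iterated (diag A)).Additive := inferInstance
    -- `muDiag` is a transformation between additive functors, so it also defines a morphism in the
    -- additive localization.
    refine ⟨h1, h2, (adClass E _).Q.map ⟨muDiag A⟩, ?_, ?_⟩
    · refine MorphismProperty.Q_inverts _ _ fun Z => ?_
      have h3 : IsIso ((muDiag A).app Z) := by
        have := isIso_muDiag (A := A)
        infer_instance
      exact (hE _).2 (localQis_of_isIso ((alternatingFaceMapComplex A).map ((muDiag A).app Z)))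
    · exact localization_lift_map _ _ _

end SimplicialDescentStructure

/-! ### The alternating face map complex as a descent functor -/

section DescentFunctor

open AlgebraicTopology

variable {A : Type u} [Category.{v} A] [Preadditive A] [HasFiniteBiproducts A]

/-- The alternating face map complex is a descent functor. -/
theorem isDescentFunctor_alternatingFaceMapComplex (J : MorphismProperty A) [J.IsMultiplicative]
    {E : MorphismProperty (SimplicialObject A)} {E' : MorphismProperty (ChainComplex A ℕ)}
    (hE : ∀ ⦃X Y : SimplicialObject A⦄ (f : X ⟶ Y),
      E f ↔ localQis J ((alternatingFaceMapComplex A).map f))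
    (hE' : ∀ ⦃X Y : ChainComplex A ℕ⦄ (f : X ⟶ Y), E' f ↔ localQis J f)
    (hS : (simplicialData A E).IsDescent) (hS' : (chainData A E').IsDescent) :
    DescentData.IsDescentFunctor hS hS' (alternatingFaceMapComplex A) where
  map_mem _ _ f hf := (hE' _).2 ((hE f).1 hf)
  map_coprod X Y := by
    have := isIso_coprodComparison_of_additive (alternatingFaceMapComplex A) X Y
    exact (hE' _).2 (localQis_of_isIso _)
  exists_comparison := by
    -- `Θ` is the image of an actual natural transformation, so both compatibilities can be checked
    -- before localizing.
    refine ⟨(funQ E' _).map (cmp A), isIso_funQ_map E' (cmp A) fun Z =>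
      (hE' _).2 (localQis_cmp Z), ?_, ?_⟩
    · refine (congr_arg (fun φ => φ ≫ _) (precomp_map_funQ E' _ (cmp A))).trans ?_
      refine ((funQ E' _).map_comp _ _).symm.trans ?_
      refine congr_arg (fun φ => (funQ E' _).map φ) ?_
      apply NatTrans.ext
      funext X
      exact cmp_lam X
    -- Every morphism in the diagram is the image of a natural transformation; after collecting
    -- them, what remains is `cmpAw_eq` for each trisimplicial object.
    · refine (congr_arg (fun φ => φ ≫ _) (precomp_map_funQ E' _ (cmp A))).trans ?_
      refine (congr_arg (fun φ => _ ≫ _ ≫ φ) (precomp_map_funQ E' _ (alexanderWhitney A))).trans ?_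
      have h1 := postcomp_map_funQ (E := E) (E' := E') (alternatingFaceMapComplex A)
        (fun _ _ f hf => (hE' _).2 ((hE f).1 hf)) (muDiag A)
      have h2 := precomp_map_funQ E' (levelwise (diag A)) (cmp A)
      have h3 := levelwiseSimple_map_funQ (E := E') (simple A) hS'.exact (cmp A)
      refine Eq.trans ?_ (comp_congr h1 (comp_congr h2 h3)).symm
      refine (congr_arg (fun φ => _ ≫ φ) ((funQ E' _).map_comp _ _).symm).trans ?_
      refine ((funQ E' _).map_comp _ _).symm.trans ?_
      refine Eq.trans ?_ (congr_arg (fun φ => _ ≫ φ) ((funQ E' _).map_comp _ _))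
      refine Eq.trans ?_ ((funQ E' _).map_comp _ _)
      refine congr_arg (fun φ => (funQ E' _).map φ) ?_
      apply NatTrans.ext
      funext Z
      exact cmpAw_eq Z

end DescentFunctor

/-! ### Saturation of the classes of equivalences -/

section Saturation

open AlgebraicTopology

/-- Homotopy equivalences are the maps inverted by the functor to the homotopy category, and a class
defined by inversion is saturated. -/
lemma homotopyEquivalences_saturated {A : Type u} [Category.{v} A] [Preadditive A]
    {C : Type u'} [Category.{v'} C] (F : C ⥤ ChainComplex A ℕ) {E : MorphismProperty C}
    (hE : ∀ ⦃X Y : C⦄ (f : X ⟶ Y), E f ↔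
      HomologicalComplex.homotopyEquivalences A (ComplexShape.down ℕ) (F.map f))
    ⦃X Y : C⦄ (f : X ⟶ Y) : E f ↔ IsIso (E.Q.map f) :=
  saturated_of_functors (fun _ : Unit => F ⋙ HomotopyCategory.quotient A (ComplexShape.down ℕ))
    (fun X Y f => (hE f).trans (by
      rw [← HomologicalComplex.isIso_quotient_map_iff_homotopyEquivalences]
      exact ⟨fun h _ => h, fun h => h ()⟩)) f

/-- Here the inverting functors are the homology functors in all degrees. -/
lemma quasiIso_saturated {A : Type u} [Category.{v} A] [Abelian A]
    {C : Type u'} [Category.{v'} C] (F : C ⥤ ChainComplex A ℕ) {E : MorphismProperty C}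
    (hE : ∀ ⦃X Y : C⦄ (f : X ⟶ Y), E f ↔ QuasiIso (F.map f))
    ⦃X Y : C⦄ (f : X ⟶ Y) : E f ↔ IsIso (E.Q.map f) :=
  saturated_of_functors
    (fun i : ℕ => F ⋙ HomologicalComplex.homologyFunctor A (ComplexShape.down ℕ) i)
    (fun X Y f => (hE f).trans (by
      rw [quasiIso_iff]
      exact forall_congr' fun i => quasiIsoAt_iff_isIso_homologyMap _ i)) f

end Saturation

end SimplicialDescent

end

/-! ### The additive and the abelian case -/

theorem mainTheorem5 :
    (∀ (A : Type u) [Category.{v} A] [Preadditive A] [HasFiniteBiproducts A],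
      ∃ (hS : (SimplicialDescent.simplicialH A).IsAdditiveDescent)
        (hC : (SimplicialDescent.chainH A).IsDescent),
        SimplicialDescent.DescentData.IsDescentFunctor hS.toIsDescent hC
          (AlgebraicTopology.alternatingFaceMapComplex A)) ∧
    (∀ (A : Type u) [Category.{v} A] [Abelian A],
      ∃ (hS : (SimplicialDescent.simplicialQ A).IsAdditiveDescent)
        (hC : (SimplicialDescent.chainQ A).IsDescent),
        SimplicialDescent.DescentData.IsDescentFunctor hS.toIsDescent hC
          (AlgebraicTopology.alternatingFaceMapComplex A)) := by
  refine ⟨fun A _ _ _ => ?_, fun A _ _ => ?_⟩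
  -- Additive case: the refinements are the isomorphisms, and simplicial homotopy equivalences are
  -- detected on chains by Dold–Kan.
  · have hC := fun (X Y : ChainComplex A ℕ) (f : X ⟶ Y) =>
      SimplicialDescent.homotopyEquivalences_iff_localQis f
    have hS := fun (X Y : SimplicialObject A) (f : X ⟶ Y) =>
      (SimplicialDescent.simplicialHomotopyEquivalences_iff f).trans (hC _ _ _)
    refine ⟨SimplicialDescent.simplicialData_isAdditiveDescent _ hS
        (SimplicialDescent.homotopyEquivalences_saturated _
          fun _ _ f => SimplicialDescent.simplicialHomotopyEquivalences_iff f),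
      SimplicialDescent.chainData_isDescent _ hC
        (SimplicialDescent.homotopyEquivalences_saturated (𝟭 _) fun _ _ _ => Iff.rfl), ?_⟩
    exact SimplicialDescent.isDescentFunctor_alternatingFaceMapComplex _ hS hC _ _
  -- Abelian case: the refinements are the epimorphisms. Simplicial quasi-isomorphisms are defined
  -- through `K`, so no lifting is needed.
  · have hC := fun (X Y : ChainComplex A ℕ) (f : X ⟶ Y) =>
      SimplicialDescent.quasiIso_iff_localQis f
    have hS := fun (X Y : SimplicialObject A) (f : X ⟶ Y) =>
      hC _ _ ((AlgebraicTopology.alternatingFaceMapComplex A).map f)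
    refine ⟨SimplicialDescent.simplicialData_isAdditiveDescent _ hS
        (SimplicialDescent.quasiIso_saturated (AlgebraicTopology.alternatingFaceMapComplex A)
          fun _ _ _ => Iff.rfl),
      SimplicialDescent.chainData_isDescent _ hC
        (SimplicialDescent.quasiIso_saturated (𝟭 _) fun _ _ _ => Iff.rfl), ?_⟩
    exact SimplicialDescent.isDescentFunctor_alternatingFaceMapComplex _ hS hC _ _
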